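/- Conventions. Let $n\ge 1$. For a smooth $n$-manifold $X$ (Hausdorff, second countable, without boundary), $J^1X=T^*X\times\mathbb R$ carries its canonical contact structure $\ker(dz-\lambda)$, $\lambda$ being the Liouville form. Let $\mathcal T$ be a smooth $(2n+1)$-manifold with a contact structure $\xi=\ker\alpha$ cooriented by a smooth 1-form $\alpha$. A *Darboux chart* is an open subset of $\mathcal T$ contactomorphic to an open subset of $(\mathbb R^{2n+1},\ker(dz+\sum_i x_i\,dy_i))$. A *proper embedding* is a smooth embedding whose image meets every compact set in a compact set. A *Legendrian* $L\subset\mathcal T$ is the image of a proper embedding of an $n$-manifold without boundary that is everywhere tangent to $\xi$. An *isotopy* from $L_1$ to $L_2$ is a smooth family $\kappa_t\colon N\to\mathcal T$, $t\in[0,1]$, of proper embeddings of an $n$-manifold $N$ (smooth as a map on $[0,1]\times N$) with $\kappa_0(N)=L_1$, $\kappa_1(N)=L_2$; it is *compactly supported* if $\kappa_t=\kappa_0$ for all $t$ outside a compact subset of $N$, *positive* if $\alpha(\partial_t\kappa_t(p))>0$ for all $t,p$, and *null* if $\alpha(\partial_t\kappa_t(p))=0$ for all $t,p$. $\mathrm{Diff}_0(\mathcal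 T)$ is the group of diffeomorphisms joined to $\mathrm{id}$ by a smooth path of diffeomorphisms $(f_t)_{t\in[0,1]}$ (smooth as a map on $[0,1]\times\mathcal T$); $\mathrm{Diff}_{c,0}(\mathcal T)$ is the subgroup of those joined to $\mathrm{id}$ by such a path with all $f_t$ supported in one compact set. Corollary. Let $L_1,L_2\subset\mathcal T$ be Legendrians, and let $j\colon N\to\mathcal T$ be any proper embedding of an $n$-manifold with $j(N)=L_1$. 1. Suppose that $\mathcal T$ is contactomorphic to $J^1X$ for some smooth $n$-manifold $X$ and is covered by finitely many Darboux charts. If there is a compactly supported isotopy from $L_1$ to $L_2$ starting at $j$, then there exist a positive isotopy, and a compactly supported null isotopy, from $L_1$ to $L_2$ starting at $j$. 2. Suppose that $\mathcal T$ is contactomorphic to $J^1\mathbb R^n$. (a) If $f(L_1)=L_2$ for some $f\in\mathrm{Diff}_0(\mathcal T)$, then there exist a positive isotopy and a null isotopy from $L_1$ to $L_2$ starting at $j$. (b) If $f(L_1)=L_2$ for some $f\in\mathrm{Diff}_{c,0}(\mathcal T)$, or if there is a compactly supported isotopy from $L_1$ to $L_2$ starting at $j$, then there is a compactly supported null isotopy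 from $L_1$ to $L_2$ starting at $j$. Moreover the positive isotopy can be chosen arbitrarily close to the constant isotopy outside a compact set: there is a compact $K\subset N$ such that for every neighbourhood $\mathcal W$ of the constant isotopy $(t,p)\mapsto j(p)$ in the $C^\infty$ compact-open topology on maps $[0,1]\times N\to\mathcal T$ (given by finitely many bounds on derivatives in charts over compact sets), there is a positive isotopy from $L_1$ to $L_2$ starting at $j$ that satisfies the conditions defining $\mathcal W$ at all points of $[0,1]\times(N\setminus K)$. -/

import Mathlib

open scoped Manifold ContDiff Topology
open Set Manifold Bundle

universe u v w

noncomputable section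

/-- Euclidean space `ℝᵏ`. -/
abbrev Euc (k : ℕ) : Type := EuclideanSpace ℝ (Fin k)

section Forms

variable {E : Type*} [NormedAddCommGroup E] [NormedSpace ℝ E]
  {H : Type*} [TopologicalSpace H] (I : ModelWithCorners ℝ E H)
  (M : Type*) [TopologicalSpace M] [ChartedSpace H M]

/-- A field of covectors (a not necessarily smooth 1-form) on the manifold `M`. -/
abbrev CovectorField : Type _ := (p : M) → (TangentSpace I p →L[ℝ] ℝ)

/-- The total space of the cotangent bundle `T*M`: Mathlib's bundle of continuous linear maps from
the tangent bundle to the trivial line bundle. -/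
abbrev Cotangent : Type _ :=
  TotalSpace (E →L[ℝ] ℝ) (fun p : M => TangentSpace I p →L[ℝ] ℝ)

variable {I M}

/-- Smoothness of a 1-form, as a section of the cotangent bundle. -/
def CovectorField.IsSmooth [IsManifold I ∞ M] (α : CovectorField I M) : Prop :=
  ContMDiff I (I.prod 𝓘(ℝ, E →L[ℝ] ℝ)) ∞ (fun p => (⟨p, α p⟩ : Cotangent I M))

end Forms

section JetBundle

variable (n : ℕ) (X : Type*) [TopologicalSpace X] [ChartedSpace (Euc n) X]
  [IsManifold (𝓡 n) ∞ X]

/-- The 1-jet bundle `J¹X = T*X × ℝ`: the point `(⟨x, p⟩, z)` is the 1-jet at `x` of a function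
with value `z` and differential `p`. -/
abbrev JetBundle : Type _ := Cotangent (𝓡 n) X × ℝ

/-- The model with corners (without boundary) of the `2n+1`-dimensional manifold `J¹X`. -/
abbrev jetModel : ModelWithCorners ℝ ((Euc n × (Euc n →L[ℝ] ℝ)) × ℝ)
    (ModelProd (ModelProd (Euc n) (Euc n →L[ℝ] ℝ)) ℝ) :=
  ((𝓡 n).prod 𝓘(ℝ, Euc n →L[ℝ] ℝ)).prod 𝓘(ℝ, ℝ)

/-- The canonical contact form `dz - λ` on `J¹X`, where `λ` is the Liouville form of `T*X`:
`λ = p ∘ dπ` at the point `⟨x, p⟩`, with `π : T*X → X` the projection. -/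
def jetForm : CovectorField (jetModel n) (JetBundle n X) := fun a =>
  let dz : TangentSpace (jetModel n) a →L[ℝ] ℝ :=
    mfderiv (jetModel n) 𝓘(ℝ, ℝ) (fun b : JetBundle n X => b.2) a
  let dπ : TangentSpace (jetModel n) a →L[ℝ] TangentSpace (𝓡 n) a.1.proj :=
    mfderiv (jetModel n) (𝓡 n) (fun b : JetBundle n X => b.1.proj) a
  let p : TangentSpace (𝓡 n) a.1.proj →L[ℝ] ℝ := a.1.snd
  dz - p.comp dπ

end JetBundle

section Contact

variable {E : Type*} [NormedAddCommGroup E] [NormedSpace ℝ E]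
  {H : Type*} [TopologicalSpace H] {I : ModelWithCorners ℝ E H}
  {M : Type*} [TopologicalSpace M] [ChartedSpace H M]
  {E' : Type*} [NormedAddCommGroup E'] [NormedSpace ℝ E']
  {H' : Type*} [TopologicalSpace H'] {I' : ModelWithCorners ℝ E' H'}
  {M' : Type*} [TopologicalSpace M'] [ChartedSpace H' M']

/-- `(M, ker α)` and `(M', ker β)` are contactomorphic: some diffeomorphism `Φ : M → M'` has
`dΦ (ker α) = ker β`. When `β` is a contact form and `α` is smooth, this makes `α` a contact form
as well. -/
def Contactomorphic (α : CovectorField I M) (β : CovectorField I' M') : Prop :=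
  ∃ Φ : M ≃ₘ⟮I, I'⟯ M', ∀ (p : M) (v : TangentSpace I p),
    α p v = 0 ↔ β (Φ p) (mfderiv I I' Φ p v) = 0

/-- The standard contact manifold `ℝ²ⁿ⁺¹ = ℝⁿ × ℝⁿ × ℝ`, with coordinates `(x, y, z)`. -/
abbrev StdSpace (n : ℕ) : Type := Euc n × Euc n × ℝ

/-- The standard contact form `dz + ∑ᵢ xᵢ dyᵢ` on `ℝ²ⁿ⁺¹`, at the point `(x, y, z)`, evaluated
at the tangent vector `w = (w_x, w_y, w_z)`. -/
def stdForm (n : ℕ) (a w : StdSpace n) : ℝ := w.2.2 + ∑ i, a.1 i * w.2.1 i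

/-- `e` is a Darboux chart of `(M, ker α)`: a diffeomorphism of an open subset of `M` onto an open
subset of `ℝ²ⁿ⁺¹` which takes `ker α` to the standard contact structure. -/
structure IsDarbouxChart (n : ℕ) (α : CovectorField I M)
    (e : OpenPartialHomeomorph M (StdSpace n)) : Prop where
  smooth : ContMDiffOn I 𝓘(ℝ, StdSpace n) ∞ e e.source
  smooth_symm : ContMDiffOn 𝓘(ℝ, StdSpace n) I ∞ e.symm e.target
  contact : ∀ p ∈ e.source, ∀ v : TangentSpace I p,
    α p v = 0 ↔ stdForm n (e p) (mfderiv I 𝓘(ℝ, StdSpace n) e p v) = 0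

/-- `(M, ker α)` is covered by finitely many Darboux charts. -/
def HasFiniteDarbouxCover (n : ℕ) (α : CovectorField I M) : Prop :=
  ∃ S : Set (OpenPartialHomeomorph M (StdSpace n)), S.Finite ∧
    (∀ e ∈ S, IsDarbouxChart n α e) ∧ ∀ p : M, ∃ e ∈ S, p ∈ e.source

end Contact

section Diffeotopies

variable {d : ℕ} {T : Type*} [TopologicalSpace T] [ChartedSpace (Euc d) T]

/-- `(F t)`, `t ∈ [0,1]`, is a smooth path of diffeomorphisms of `T`: every `F t` is a
diffeomorphism, and `(t, x) ↦ F t x` is smooth on `[0,1] × T`. Values of `F t` for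
`t ∉ [0,1]` are irrelevant. -/
structure IsDiffeoPath (d : ℕ) {T : Type*} [TopologicalSpace T] [ChartedSpace (Euc d) T]
    (F : ℝ → T → T) : Prop where
  smooth : ContMDiffOn (𝓘(ℝ, ℝ).prod (𝓡 d)) (𝓡 d) ∞ (fun q : ℝ × T => F q.1 q.2)
    (Icc (0 : ℝ) 1 ×ˢ univ)
  diffeo : ∀ t ∈ Icc (0 : ℝ) 1, ∃ g : T ≃ₘ⟮𝓡 d, 𝓡 d⟯ T, ⇑g = F t

/-- `f ∈ Diff₀(T)`: the diffeomorphism `f` is joined to the identity by a smooth path of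
diffeomorphisms. -/
def InDiffZero (f : T ≃ₘ⟮𝓡 d, 𝓡 d⟯ T) : Prop :=
  ∃ F : ℝ → T → T, IsDiffeoPath d F ∧ F 0 = id ∧ F 1 = f

/-- `f` is joined to the identity by a smooth path of diffeomorphisms which are all supported in
one compact set. -/
def InDiffZeroCompact (f : T ≃ₘ⟮𝓡 d, 𝓡 d⟯ T) : Prop :=
  ∃ F : ℝ → T → T, IsDiffeoPath d F ∧ F 0 = id ∧ F 1 = f ∧
    ∃ K : Set T, IsCompact K ∧ ∀ t ∈ Icc (0 : ℝ) 1, ∀ x ∉ K, F t x = x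

end Diffeotopies

section Isotopies

/-- A smooth embedding which is proper: its image meets every compact set in a compact set. -/
structure IsProperEmbedding (n d : ℕ) {N T : Type*}
    [TopologicalSpace N] [ChartedSpace (Euc n) N] [TopologicalSpace T] [ChartedSpace (Euc d) T]
    (j : N → T) : Prop where
  embedding : IsSmoothEmbedding (𝓡 n) (𝓡 d) ∞ j
  proper : ∀ K : Set T, IsCompact K → IsCompact (range j ∩ K)

/-- `L` is a Legendrian submanifold of the contact manifold `(T, ker α)` of dimension `2n+1`: the
image of a proper embedding of an `n`-dimensional manifold that is everywhere tangent
to `ker α`. (The universe of `N` is no restriction, as one can take `N` to be `L` itself.) -/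
def IsLegendrian (n : ℕ) {T : Type u} [TopologicalSpace T] [ChartedSpace (Euc (2 * n + 1)) T]
    (α : CovectorField (𝓡 (2 * n + 1)) T) (L : Set T) : Prop :=
  ∃ (N : Type u) (_ : TopologicalSpace N) (_ : ChartedSpace (Euc n) N)
    (_ : IsManifold (𝓡 n) ∞ N) (j : N → T),
    IsProperEmbedding n (2 * n + 1) j ∧ range j = L ∧
    ∀ (p : N) (v : TangentSpace (𝓡 n) p), α (j p) (mfderiv (𝓡 n) (𝓡 (2 * n + 1)) j p v) = 0

variable (n d : ℕ) {N : Type*} [TopologicalSpace N] [ChartedSpace (Euc n) N]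
  {T : Type*} [TopologicalSpace T] [ChartedSpace (Euc d) T]

/-- `κ` is a smooth isotopy of proper embeddings of `N` into `T`, with time `t ∈ [0,1]`, which
starts at the embedding `j` and ends at an embedding with image `L`. Values of `κ t` for
`t ∉ [0,1]` are irrelevant. -/
structure IsIsotopy (κ : ℝ → N → T) (j : N → T) (L : Set T) : Prop where
  smooth : ContMDiffOn (𝓘(ℝ, ℝ).prod (𝓡 n)) (𝓡 d) ∞ (fun q : ℝ × N => κ q.1 q.2)
    (Icc (0 : ℝ) 1 ×ˢ univ)
  embedding : ∀ t ∈ Icc (0 : ℝ) 1, IsProperEmbedding n d (κ t)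
  start : κ 0 = j
  finish : range (κ 1) = L

/-- The isotopy `κ` is compactly supported: it is constant in time outside a compact set. -/
def IsCompactlySupported (κ : ℝ → N → T) : Prop :=
  ∃ K : Set N, IsCompact K ∧ ∀ p ∉ K, ∀ t ∈ Icc (0 : ℝ) 1, κ t p = κ 0 p

variable {d}

/-- The velocity at time `t ∈ [0,1]` of the path `s ↦ κ s p` (one-sided at `t = 0, 1`). -/
def isotopyVelocity (κ : ℝ → N → T) (t : ℝ) (p : N) : TangentSpace (𝓡 d) (κ t p) :=
  mfderivWithin 𝓘(ℝ, ℝ) (𝓡 d) (fun s : ℝ => κ s p) (Icc (0 : ℝ) 1) t (1 : ℝ)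

/-- The isotopy `κ` is positive: all paths `t ↦ κ t p` are positively transverse to `ker α`. -/
def IsPositiveIsotopy (α : CovectorField (𝓡 d) T) (κ : ℝ → N → T) : Prop :=
  ∀ t ∈ Icc (0 : ℝ) 1, ∀ p : N, 0 < α (κ t p) (isotopyVelocity κ t p)

/-- The isotopy `κ` is null: all paths `t ↦ κ t p` are tangent to `ker α`. -/
def IsNullIsotopy (α : CovectorField (𝓡 d) T) (κ : ℝ → N → T) : Prop :=
  ∀ t ∈ Icc (0 : ℝ) 1, ∀ p : N, α (κ t p) (isotopyVelocity κ t p) = 0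

variable (d)

/-- The data of a basic neighbourhood, in the weak (compact-open) `C^∞` topology on maps
`[0,1] × N → T`, of the constant isotopy `(t, p) ↦ j p`: smooth charts `φ` of `N` and `ψ` of `T`,
a compact set `C` in the domain of `φ` which `j` maps into the domain of `ψ`, an order `r` and a
bound `ε`. Finite intersections of the basic neighbourhoods form a neighbourhood basis. -/
structure BasicNhd (j : N → T) where
  φ : OpenPartialHomeomorph N (Euc n)
  φ_mem : φ ∈ IsManifold.maximalAtlas (𝓡 n) ∞ N
  ψ : OpenPartialHomeomorph T (Euc d)
  ψ_mem : ψ ∈ IsManifold.maximalAtlas (𝓡 d) ∞ T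
  C : Set N
  C_compact : IsCompact C
  C_subset : C ⊆ φ.source
  mapsTo : MapsTo j C ψ.source
  r : ℕ
  ε : ℝ
  ε_pos : 0 < ε

variable {n d}

/-- The isotopy `κ` lies in the given basic neighbourhood of the constant isotopy at `j`, on the
complement of `K`: over the points of `C \ K`, it stays in the domain of `ψ`, and all partial
derivatives of order at most `r` (in `p` and `t`) of its coordinate expression are `ε`-close to
those of the constant isotopy. -/
def BasicNhd.MemOutside {j : N → T} (U : BasicNhd n d j) (K : Set N) (κ : ℝ → N → T) : Prop :=
  ∀ p ∈ U.C \ K, ∀ t ∈ Icc (0 : ℝ) 1, κ t p ∈ U.ψ.source ∧ ∀ k ≤ U.r,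
    ‖iteratedFDerivWithin ℝ k (fun q : ℝ × Euc n => U.ψ (κ q.1 (U.φ.symm q.2)))
        (Icc (0 : ℝ) 1 ×ˢ U.φ.target) (t, U.φ p) -
      iteratedFDerivWithin ℝ k (fun q : ℝ × Euc n => U.ψ (j (U.φ.symm q.2)))
        (Icc (0 : ℝ) 1 ×ˢ U.φ.target) (t, U.φ p)‖ < U.ε

end Isotopies

end

noncomputable section

section NullPaths

variable {E : Type*} [NormedAddCommGroup E] [NormedSpace ℝ E]
  {H : Type*} [TopologicalSpace H] {I : ModelWithCorners ℝ E H}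
  {M : Type*} [TopologicalSpace M] [ChartedSpace H M]

/-- A smooth path of diffeomorphisms of `M`, with time in `ℝ`, all of whose orbits are tangent to
the kernel of `α`. -/
structure IsNullPath (α : CovectorField I M) (F : ℝ → M ≃ₘ⟮I, I⟯ M) : Prop where
  smooth : ContMDiff (𝓘(ℝ, ℝ).prod I) I ∞ (fun q : ℝ × M => F q.1 q.2)
  null : ∀ (t : ℝ) (p : M),
    α (F t p) (mfderiv 𝓘(ℝ, ℝ) I (fun s : ℝ => F s p) t (1 : ℝ)) = 0

/-- The diffeomorphism `f` is the endpoint of a null path which starts at the identity and is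
supported in `K`. -/
def NullReachable (α : CovectorField I M) (K : Set M) (f : M ≃ₘ⟮I, I⟯ M) : Prop :=
  ∃ F : ℝ → M ≃ₘ⟮I, I⟯ M, IsNullPath α F ∧ F 0 = Diffeomorph.refl I M ∞ ∧ F 1 = f ∧
    ∀ t, ∀ x ∉ K, F t x = x

variable {α : CovectorField I M}

lemma contMDiff_orbit {F : ℝ → M → M}
    (hF : ContMDiff (𝓘(ℝ, ℝ).prod I) I ∞ (fun q : ℝ × M => F q.1 q.2)) (p : M) :
    ContMDiff 𝓘(ℝ, ℝ) I ∞ (fun s : ℝ => F s p) :=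
  hF.comp (contMDiff_id.prodMk contMDiff_const)

lemma mfderiv_reparam {γ : ℝ → M} {b : ℝ → ℝ} {t : ℝ}
    (hγ : MDifferentiableAt 𝓘(ℝ, ℝ) I γ (b t)) (hb : DifferentiableAt ℝ b t) :
    mfderiv 𝓘(ℝ, ℝ) I (fun s => γ (b s)) t (1 : ℝ) =
      deriv b t • mfderiv 𝓘(ℝ, ℝ) I γ (b t) (1 : ℝ) := by
  have h := mfderiv_comp (I := 𝓘(ℝ, ℝ)) (I' := 𝓘(ℝ, ℝ)) (I'' := I) t hγ hb.mdifferentiableAt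
  have h1 : mfderiv 𝓘(ℝ, ℝ) I (fun s => γ (b s)) t (1 : ℝ) =
      mfderiv 𝓘(ℝ, ℝ) I γ (b t) (mfderiv 𝓘(ℝ, ℝ) 𝓘(ℝ, ℝ) b t (1 : ℝ)) := by
    exact congrArg (fun L => L (1 : ℝ)) h
  have h2 : (mfderiv 𝓘(ℝ, ℝ) 𝓘(ℝ, ℝ) b t : ℝ →L[ℝ] ℝ) (1 : ℝ) = deriv b t • (1 : ℝ) := by
    rw [mfderiv_eq_fderiv, smul_eq_mul, mul_one]; rfl
  rw [h1]
  refine Eq.trans (congrArg _ h2) ?_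
  exact (mfderiv 𝓘(ℝ, ℝ) I γ (b t)).map_smul (deriv b t) (1 : ℝ)

namespace IsNullPath

variable {F G : ℝ → M ≃ₘ⟮I, I⟯ M}

lemma reparam (hF : IsNullPath α F) {b : ℝ → ℝ} (hb : ContDiff ℝ ∞ b) :
    IsNullPath α (fun t => F (b t)) where
  smooth := hF.smooth.comp ((hb.contMDiff.comp contMDiff_fst).prodMk contMDiff_snd)
  null t p := by
    have h := mfderiv_reparam (γ := fun s => F s p) (t := t)
      ((contMDiff_orbit (F := fun t => F t) hF.smooth p).mdifferentiable (by simp) (b t))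
      (hb.differentiable (by simp) t)
    refine (congrArg (α (F (b t) p)) h).trans ?_
    refine ((α (F (b t) p)).map_smul _ _).trans ?_
    rw [hF.null (b t) p, smul_zero]

lemma comp_right (hF : IsNullPath α F) (f : M ≃ₘ⟮I, I⟯ M) :
    IsNullPath α (fun t => f.trans (F t)) where
  smooth := hF.smooth.comp (contMDiff_fst.prodMk (f.contMDiff.comp contMDiff_snd))
  null t p := hF.null t (f p)

lemma const (f : M ≃ₘ⟮I, I⟯ M) : IsNullPath α (fun _ => f) where
  smooth := f.contMDiff.comp contMDiff_snd
  null t p := by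
    have : mfderiv 𝓘(ℝ, ℝ) I (fun _ : ℝ => f p) t = 0 := mfderiv_const
    refine (congrArg (fun L : ℝ →L[ℝ] TangentSpace I (f p) => α (f p) (L 1)) this).trans ?_
    exact (α (f p)).map_zero

/-- Two null paths which do not move at the same time can be composed. -/
lemma comp (hF : IsNullPath α F) (hG : IsNullPath α G)
    (h : ∀ t, (∀ᶠ s in 𝓝 t, F s = Diffeomorph.refl I M ∞) ∨ ∀ᶠ s in 𝓝 t, G s = G t) :
    IsNullPath α (fun t => (G t).trans (F t)) where
  smooth := hF.smooth.comp (contMDiff_fst.prodMk hG.smooth)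
  null t p := by
    rcases h t with h | h
    · have h1 : (fun s => (G s).trans (F s) p) =ᶠ[𝓝 t] fun s => G s p := by
        filter_upwards [h] with s hs
        simp [hs]
      have h2 : (G t).trans (F t) p = G t p := h1.eq_of_nhds
      have h3 := h1.mfderiv_eq (I := 𝓘(ℝ, ℝ)) (I' := I)
      have h4 := hG.null t p
      have key : ∀ (q : M) (L : ℝ →L[ℝ] E), q = G t p → 
          L = (mfderiv 𝓘(ℝ, ℝ) I (fun s => G s p) t : ℝ →L[ℝ] E) →
          (α q : E →L[ℝ] ℝ) (L 1) = 0 := by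
        rintro q L rfl rfl
        exact h4
      exact key _ _ h2 h3
    · have h1 : (fun s => (G s).trans (F s) p) =ᶠ[𝓝 t] fun s => F s (G t p) := by
        filter_upwards [h] with s hs
        simp [hs]
      have h3 := h1.mfderiv_eq (I := 𝓘(ℝ, ℝ)) (I' := I)
      have h4 := hF.null t (G t p)
      have key : ∀ (L : ℝ →L[ℝ] E), 
          L = (mfderiv 𝓘(ℝ, ℝ) I (fun s => F s (G t p)) t : ℝ →L[ℝ] E) →
          (α (F t (G t p)) : E →L[ℝ] ℝ) (L 1) = 0 := by
        rintro L rfl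
        exact h4
      exact key _ h3

end IsNullPath

namespace NullReachable

variable {K K' : Set M} {f g : M ≃ₘ⟮I, I⟯ M}

lemma mono (hf : NullReachable α K f) (h : K ⊆ K') : NullReachable α K' f := by
  obtain ⟨F, h1, h2, h3, h4⟩ := hf
  exact ⟨F, h1, h2, h3, fun t x hx => h4 t x fun h' => hx (h h')⟩

lemma refl : NullReachable α K (Diffeomorph.refl I M ∞) :=
  ⟨fun _ => Diffeomorph.refl I M ∞, IsNullPath.const _, rfl, rfl, fun _ _ _ => rfl⟩

lemma apply_of_notMem (hf : NullReachable α K f) {x : M} (hx : x ∉ K) : f x = x := by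
  obtain ⟨F, h1, h2, h3, h4⟩ := hf
  rw [← h3, h4 1 x hx]

lemma symm (hf : NullReachable α K f) : NullReachable α K f.symm := by
  have hf' := hf
  obtain ⟨F, h1, h2, h3, h4⟩ := hf
  refine ⟨fun t => f.symm.trans (F (1 - t)), (h1.reparam (contDiff_const.sub contDiff_id)).comp_right
    f.symm, ?_, ?_, ?_⟩
  · ext x; simp [h3]
  · ext x; simp [h2]
  · intro t x hx
    have : f.symm x = x := by
      rw [← (hf'.apply_of_notMem hx), Diffeomorph.symm_apply_apply, hf'.apply_of_notMem hx]
    simp [this, h4 _ x hx]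

/-- A null path which moves in the interior of the unit time interval only. -/
lemma exists_path (hf : NullReachable α K f) : ∃ F : ℝ → M ≃ₘ⟮I, I⟯ M, IsNullPath α F ∧
    (∀ t ≤ 1 / 3, F t = Diffeomorph.refl I M ∞) ∧ (∀ t, 2 / 3 ≤ t → F t = f) ∧
    ∀ t, ∀ x ∉ K, F t x = x := by
  obtain ⟨F, h1, h2, h3, h4⟩ := hf
  refine ⟨fun t => F (Real.smoothTransition (3 * t - 1)),
    h1.reparam (Real.smoothTransition.contDiff.comp
      ((contDiff_const.mul contDiff_id).sub contDiff_const)), ?_, ?_, fun t x hx => h4 _ x hx⟩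
  · intro t ht
    simp only [Real.smoothTransition.zero_of_nonpos (show 3 * t - 1 ≤ 0 by linarith), h2]
  · intro t ht
    simp only [Real.smoothTransition.one_of_one_le (show 1 ≤ 3 * t - 1 by linarith), h3]

lemma trans (hf : NullReachable α K f) (hg : NullReachable α K g) :
    NullReachable α K (f.trans g) := by
  obtain ⟨F, h1, h2, h3, h4⟩ := hf.exists_path
  obtain ⟨G, k1, k2, k3, k4⟩ := hg.exists_path
  refine ⟨fun t => (F (2 * t)).trans (G (2 * t - 1)), ?_, ?_, ?_, ?_⟩
  · refine (k1.reparam ((contDiff_const.mul contDiff_id).sub contDiff_const)).comp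
      (h1.reparam (contDiff_const.mul contDiff_id)) ?_
    intro t
    rcases lt_or_ge t (7 / 12 : ℝ) with h | h
    · left
      filter_upwards [Iio_mem_nhds h] with s hs
      exact k2 _ (by simp only [id, mem_Iio] at *; linarith)
    · right
      filter_upwards [Ioi_mem_nhds (show (1 / 2 : ℝ) < t by linarith)] with s hs
      simp only [mem_Ioi] at *
      rw [h3 _ (by linarith), h3 _ (by linarith)]
  · ext x
    simp only
    rw [h2 _ (by norm_num), k2 _ (by norm_num)]
    rfl
  · ext x
    simp only
    rw [h3 _ (by norm_num), k3 _ (by norm_num)]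
  · intro t x hx
    simp [h4 _ x hx, k4 _ x hx]

end NullReachable

end NullPaths

section Perturbations

variable {V : Type*} [NormedAddCommGroup V] [NormedSpace ℝ V]

lemma contMDiff_prod_of_contDiff {V' V'' : Type*} [NormedAddCommGroup V'] [NormedSpace ℝ V']
    [NormedAddCommGroup V''] [NormedSpace ℝ V''] {f : V × V' → V''} (hf : ContDiff ℝ ∞ f) :
    ContMDiff (𝓘(ℝ, V).prod 𝓘(ℝ, V')) 𝓘(ℝ, V'') ∞ f := by
  rw [← modelWithCornersSelf_prod, chartedSpaceSelf_prod]
  exact hf.contMDiff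

lemma exists_diffeomorph_add [CompleteSpace V] {h : V → V} (hh : ContDiff ℝ ∞ h) {L : ℝ}
    (hL : L < 1) (hlip : ∀ v w, ‖h v - h w‖ ≤ L * ‖v - w‖) :
    ∃ e : V ≃ₘ⟮𝓘(ℝ, V), 𝓘(ℝ, V)⟯ V, ∀ v, e v = v + h v := by
  wlog hL0 : 0 ≤ L generalizing L
  · exact this (L := 0) one_pos (fun v w => (hlip v w).trans
      (mul_le_mul_of_nonneg_right (not_le.1 hL0).le (norm_nonneg _))) le_rfl
  lift L to NNReal using hL0
  have hL1 : L < 1 := by exact_mod_cast hL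
  have happ : ApproximatesLinearOn (fun v => v + h v)
      ((ContinuousLinearEquiv.refl ℝ V : V ≃L[ℝ] V) : V →L[ℝ] V) univ L := by
    intro v _ w _
    have : v + h v - (w + h w) - ((ContinuousLinearEquiv.refl ℝ V : V ≃L[ℝ] V) : V →L[ℝ] V) (v - w)
        = h v - h w := by simp; abel
    rw [this]
    exact hlip v w
  have hc : Subsingleton V ∨ L < ‖((ContinuousLinearEquiv.refl ℝ V).symm : V →L[ℝ] V)‖₊⁻¹ := by
    rcases subsingleton_or_nontrivial V with h | h
    · exact Or.inl h
    · right
      have : ‖((ContinuousLinearEquiv.refl ℝ V).symm : V →L[ℝ] V)‖₊ = 1 :=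
        NNReal.eq (ContinuousLinearMap.norm_id (𝕜 := ℝ) (E := V))
      rw [this, inv_one]
      exact hL1
  let φ : V ≃ₜ V := happ.toHomeomorph _ hc
  have hφ : ∀ v, φ v = v + h v := fun v => rfl
  have hnorm : ∀ v, ‖-fderiv ℝ h v‖ < 1 := by
    intro v
    rw [norm_neg]
    refine lt_of_le_of_lt (norm_fderiv_le_of_lip' ℝ L.2 (Filter.Eventually.of_forall fun w => ?_)) hL
    exact hlip w v
  have hsmooth : ContDiff ℝ ∞ φ := contDiff_id.add hh
  have hder : ∀ v, HasFDerivAt φ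
      ((ContinuousLinearEquiv.unitsEquiv ℝ V (Units.oneSub _ (hnorm v)) : V ≃L[ℝ] V) :
        V →L[ℝ] V) v := by
    intro v
    have h1 : HasFDerivAt φ (ContinuousLinearMap.id ℝ V + fderiv ℝ h v) v :=
      (hasFDerivAt_id v).add (hh.differentiable (by simp) v).hasFDerivAt
    convert h1 using 1
    ext w
    simp
  exact ⟨⟨φ.toEquiv, hsmooth.contMDiff, (φ.contDiff_symm hder hsmooth).contMDiff⟩, hφ⟩

lemma lipschitz_symm_of_add {h : V → V} {L : ℝ} (hL : L ≤ 1 / 2)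
    (hlip : ∀ v w, ‖h v - h w‖ ≤ L * ‖v - w‖) {e : V ≃ₘ⟮𝓘(ℝ, V), 𝓘(ℝ, V)⟯ V}
    (he : ∀ v, e v = v + h v) (v w : V) : ‖e.symm v - e.symm w‖ ≤ 2 * ‖v - w‖ := by
  obtain ⟨v, rfl⟩ : ∃ v', e v' = v := e.surjective v
  obtain ⟨w, rfl⟩ : ∃ w', e w' = w := e.surjective w
  rw [e.symm_apply_apply, e.symm_apply_apply, he, he]
  have h1 : v - w = (v + h v - (w + h w)) - (h v - h w) := by abel
  have h2 : ‖v - w‖ ≤ ‖v + h v - (w + h w)‖ + ‖h v - h w‖ := by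
    conv_lhs => rw [h1]
    exact norm_sub_le _ _
  nlinarith [hlip v w, norm_nonneg (v - w)]

lemma nullReachable_of_add [CompleteSpace V] {α : CovectorField 𝓘(ℝ, V) V} {h : V → V}
    (hh : ContDiff ℝ ∞ h) {L : ℝ} (hL : L < 1) (hlip : ∀ v w, ‖h v - h w‖ ≤ L * ‖v - w‖)
    {B : Set V} (hB : ∀ v ∉ B, h v = 0) (hnull : ∀ (v : V) (s : ℝ), α (v + s • h v) (h v) = 0)
    {e : V ≃ₘ⟮𝓘(ℝ, V), 𝓘(ℝ, V)⟯ V} (he : ∀ v, e v = v + h v) : NullReachable α B e := by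
  have hex : ∀ t : ℝ, ∃ e : V ≃ₘ⟮𝓘(ℝ, V), 𝓘(ℝ, V)⟯ V,
      ∀ v, e v = v + Real.smoothTransition t • h v := by
    intro t
    refine exists_diffeomorph_add (contDiff_const.smul hh) hL fun v w => ?_
    rw [← smul_sub, norm_smul, Real.norm_of_nonneg (Real.smoothTransition.nonneg t)]
    exact (mul_le_of_le_one_left (norm_nonneg _) (Real.smoothTransition.le_one t)).trans (hlip v w)
  choose F hF using hex
  refine ⟨F, ⟨?_, ?_⟩, ?_, ?_, ?_⟩
  · have : ContDiff ℝ ∞ (fun q : ℝ × V => q.2 + Real.smoothTransition q.1 • h q.2) :=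
      contDiff_snd.add ((Real.smoothTransition.contDiff.comp contDiff_fst).smul
        (hh.comp contDiff_snd))
    have h2 : (fun q : ℝ × V => F q.1 q.2) =
        fun q : ℝ × V => q.2 + Real.smoothTransition q.1 • h q.2 := by
      ext q; exact hF _ _
    rw [h2]
    exact contMDiff_prod_of_contDiff this
  · intro t v
    have h1 : HasDerivAt (fun s : ℝ => F s v) (deriv Real.smoothTransition t • h v) t := by
      have h2 : (fun s : ℝ => F s v) = fun s => v + Real.smoothTransition s • h v := by
        ext s; exact hF _ _
      rw [h2]
      exact ((Real.smoothTransition.contDiff (n := 1)).differentiable (by simp)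
        t).hasDerivAt.smul_const (h v) |>.const_add v
    have h3 : mfderiv 𝓘(ℝ, ℝ) 𝓘(ℝ, V) (fun s : ℝ => F s v) t (1 : ℝ)
        = deriv Real.smoothTransition t • h v := by
      rw [mfderiv_eq_fderiv]
      exact h1.deriv
    have h4 := hnull v (Real.smoothTransition t)
    rw [← hF t v] at h4
    refine (congrArg (α (F t v)) h3).trans ?_
    refine ((α (F t v)).map_smul _ _).trans ?_
    rw [h4, smul_zero]
  · ext v; simp [hF]
  · ext v; simp [hF, he]
  · intro t v hv
    simp [hF, hB v hv]

end Perturbations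

section StandardSpace

/-- The standard contact form on `ℝ²ⁿ⁺¹`, as a field of covectors. -/
def stdCovector (n : ℕ) : CovectorField 𝓘(ℝ, StdSpace n) (StdSpace n) := fun a =>
  ((ContinuousLinearMap.snd ℝ (Euc n) ℝ).comp (ContinuousLinearMap.snd ℝ (Euc n) (Euc n × ℝ)) +
    (innerSL ℝ (a.1 : Euc n)).comp ((ContinuousLinearMap.fst ℝ (Euc n) ℝ).comp
      (ContinuousLinearMap.snd ℝ (Euc n) (Euc n × ℝ))) : StdSpace n →L[ℝ] ℝ)

variable {n : ℕ}

lemma stdCovector_apply' (a w : StdSpace n) :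
    stdCovector n a w = w.2.2 + inner ℝ a.1 w.2.1 := rfl

lemma stdCovector_apply (a w : StdSpace n) : stdCovector n a w = stdForm n a w := by
  rw [stdCovector_apply', stdForm, PiLp.inner_apply]
  simp [mul_comm]

/-- Displacement along the `y`-directions, lifted to a displacement tangent to the standard
contact structure. -/
def liftY (u : StdSpace n → Euc n) (v : StdSpace n) : StdSpace n := (0, u v, -inner ℝ v.1 (u v))

lemma contDiff_liftY {u : StdSpace n → Euc n} (hu : ContDiff ℝ ∞ u) : ContDiff ℝ ∞ (liftY u) :=
  contDiff_const.prodMk (hu.prodMk (contDiff_fst.inner ℝ hu).neg)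

/-- Displacement along the `x`-directions. -/
def liftX (u : StdSpace n → Euc n) (v : StdSpace n) : StdSpace n := (u v, 0, 0)

lemma contDiff_liftX {u : StdSpace n → Euc n} (hu : ContDiff ℝ ∞ u) : ContDiff ℝ ∞ (liftX u) :=
  hu.prodMk contDiff_const

lemma liftX_lipschitz {u : StdSpace n → Euc n} {L : ℝ}
    (hlip : ∀ v w, ‖u v - u w‖ ≤ L * ‖v - w‖) (v w : StdSpace n) :
    ‖liftX u v - liftX u w‖ ≤ L * ‖v - w‖ := by
  have : liftX u v - liftX u w = (u v - u w, 0, 0) := by simp [liftX]; rfl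
  rw [this]
  simpa [Prod.norm_def] using hlip v w

lemma norm_le_of_support [Nontrivial (StdSpace n)] {W : Type*} [NormedAddCommGroup W]
    {u : StdSpace n → W} {L R : ℝ} (hL : 0 ≤ L) (hR : 0 ≤ R)
    (hlip : ∀ v w, ‖u v - u w‖ ≤ L * ‖v - w‖) {B : Set (StdSpace n)}
    (hBR : ∀ v ∈ B, ‖v‖ ≤ R) (hu : ∀ v ∉ B, u v = 0) (v : StdSpace n) :
    ‖u v‖ ≤ (2 * R + 1) * L := by
  by_cases hv : v ∈ B
  · obtain ⟨w, hw⟩ := NormedSpace.exists_lt_norm ℝ (StdSpace n) R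
    obtain ⟨w, hw⟩ : ∃ w : StdSpace n, ‖w‖ = R + 1 := by
      have hw0 : ‖w‖ ≠ 0 := by linarith
      refine ⟨((R + 1) / ‖w‖) • w, ?_⟩
      rw [norm_smul, Real.norm_of_nonneg (by positivity)]
      field_simp
    have hwB : w ∉ B := fun h => by linarith [hBR w h]
    have h1 := hlip v w
    rw [hu w hwB, sub_zero] at h1
    have h2 : ‖v - w‖ ≤ R + (R + 1) := (norm_sub_le _ _).trans (add_le_add (hBR v hv) hw.le)
    nlinarith
  · rw [hu v hv, norm_zero]; positivity

lemma inner_lipschitz [Nontrivial (StdSpace n)]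
    {u : StdSpace n → Euc n} {L R : ℝ} (hL : 0 ≤ L) (hR : 0 ≤ R)
    (hlip : ∀ v w, ‖u v - u w‖ ≤ L * ‖v - w‖) {B : Set (StdSpace n)}
    (hBR : ∀ v ∈ B, ‖v‖ ≤ R) (hu : ∀ v ∉ B, u v = 0) (v w : StdSpace n) :
    ‖inner ℝ v.1 (u v) - inner ℝ w.1 (u w)‖ ≤ (3 * R + 1) * L * ‖v - w‖ := by
  have key : ∀ v w : StdSpace n, v ∈ B →
      ‖inner ℝ v.1 (u v) - inner ℝ w.1 (u w)‖ ≤ (3 * R + 1) * L * ‖v - w‖ := by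
    intro v w hv
    have h1 : inner ℝ v.1 (u v) - inner ℝ w.1 (u w) =
        inner ℝ v.1 (u v - u w) + inner ℝ (v.1 - w.1) (u w) := by
      rw [inner_sub_right, inner_sub_left]; ring
    rw [h1]
    have h2 : ‖inner ℝ v.1 (u v - u w)‖ ≤ R * (L * ‖v - w‖) :=
      (norm_inner_le_norm _ _).trans (mul_le_mul ((norm_fst_le v).trans (hBR v hv)) (hlip v w)
        (norm_nonneg _) hR)
    have h3 : ‖inner ℝ (v.1 - w.1) (u w)‖ ≤ ‖v - w‖ * ((2 * R + 1) * L) :=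
      (norm_inner_le_norm _ _).trans (mul_le_mul (norm_fst_le (v - w))
        (norm_le_of_support hL hR hlip hBR hu w) (norm_nonneg _) (norm_nonneg _))
    refine (norm_add_le _ _).trans ((add_le_add h2 h3).trans (le_of_eq ?_))
    ring
  by_cases hv : v ∈ B
  · exact key v w hv
  by_cases hw : w ∈ B
  · rw [norm_sub_rev, norm_sub_rev v w]; exact key w v hw
  rw [hu v hv, hu w hw]
  simp only [inner_zero_right, sub_self, norm_zero]
  positivity

lemma liftY_lipschitz [Nontrivial (StdSpace n)]
    {u : StdSpace n → Euc n} {L R : ℝ} (hL : 0 ≤ L) (hR : 0 ≤ R)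
    (hlip : ∀ v w, ‖u v - u w‖ ≤ L * ‖v - w‖) {B : Set (StdSpace n)}
    (hBR : ∀ v ∈ B, ‖v‖ ≤ R) (hu : ∀ v ∉ B, u v = 0) (v w : StdSpace n) :
    ‖liftY u v - liftY u w‖ ≤ (3 * R + 1) * L * ‖v - w‖ := by
  have h1 : liftY u v - liftY u w =
      (0, u v - u w, -(inner ℝ v.1 (u v) - inner ℝ w.1 (u w))) := by
    simp [liftY]; ring
  rw [h1]
  rw [Prod.norm_mk, Prod.norm_mk, norm_zero, norm_neg]
  refine max_le (by positivity) (max_le ((hlip v w).trans ?_)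
    (inner_lipschitz hL hR hlip hBR hu v w))
  have : L * ‖v - w‖ ≤ (3 * R + 1) * (L * ‖v - w‖) :=
    le_mul_of_one_le_left (by positivity) (by linarith)
  linarith

lemma nullReachable_liftX {u : StdSpace n → Euc n} (hu : ContDiff ℝ ∞ u) {L : ℝ} (hL : L < 1)
    (hlip : ∀ v w, ‖u v - u w‖ ≤ L * ‖v - w‖) {B : Set (StdSpace n)} (hB : ∀ v ∉ B, u v = 0) :
    ∃ e : StdSpace n ≃ₘ⟮𝓘(ℝ, StdSpace n), 𝓘(ℝ, StdSpace n)⟯ StdSpace n,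
      (∀ v, e v = v + liftX u v) ∧ NullReachable (stdCovector n) B e := by
  obtain ⟨e, he⟩ := exists_diffeomorph_add (contDiff_liftX hu) hL (liftX_lipschitz hlip)
  refine ⟨e, he, nullReachable_of_add (contDiff_liftX hu) hL (liftX_lipschitz hlip) ?_ ?_ he⟩
  · intro v hv; simp [liftX, hB v hv]
  · intro v s
    refine (stdCovector_apply' _ _).trans ?_
    simp [liftX]

lemma nullReachable_liftY {u : StdSpace n → Euc n} (hu : ContDiff ℝ ∞ u) {L : ℝ} (hL : L < 1)
    (hlip : ∀ v w, ‖liftY u v - liftY u w‖ ≤ L * ‖v - w‖) {B : Set (StdSpace n)}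
    (hB : ∀ v ∉ B, u v = 0) :
    ∃ e : StdSpace n ≃ₘ⟮𝓘(ℝ, StdSpace n), 𝓘(ℝ, StdSpace n)⟯ StdSpace n,
      (∀ v, e v = v + liftY u v) ∧ NullReachable (stdCovector n) B e := by
  obtain ⟨e, he⟩ := exists_diffeomorph_add (contDiff_liftY hu) hL hlip
  refine ⟨e, he, nullReachable_of_add (contDiff_liftY hu) hL hlip ?_ ?_ he⟩
  · intro v hv; simp [liftY, hB v hv]
  · intro v s
    refine (stdCovector_apply' _ _).trans ?_
    simp [liftY]

end StandardSpace

section SmallPerturbations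

variable {n : ℕ}

lemma exists_contDiff_bump {V : Type*} [NormedAddCommGroup V] [NormedSpace ℝ V]
    [FiniteDimensional ℝ V] {B Ω : Set V} (hB : IsCompact B) (hΩ : IsOpen Ω) (h : B ⊆ Ω) :
    ∃ B' : Set V, IsCompact B' ∧ B ⊆ B' ∧ B' ⊆ Ω ∧ ∃ χ : V → ℝ, ContDiff ℝ ∞ χ ∧
      (∀ v ∈ B, χ v = 1) ∧ (∀ v ∉ B', χ v = 0) ∧
      ∃ A : ℝ, 0 < A ∧ ∀ v w, ‖χ v - χ w‖ ≤ A * ‖v - w‖ := by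
  obtain ⟨B', hB', hBB', hB'Ω⟩ := exists_compact_between hB hΩ h
  obtain ⟨χ, h0, h1, -⟩ := exists_contMDiffMap_zero_one_of_isClosed (n := (⊤ : ℕ∞)) 𝓘(ℝ, V)
    (isOpen_interior (s := B')).isClosed_compl hB.isClosed
    (disjoint_compl_left_iff_subset.2 hBB')
  have hχ : ContDiff ℝ ∞ χ := χ.contMDiff.contDiff
  have h0' : ∀ v ∉ B', χ v = 0 := fun v hv => h0 fun hv' => hv (interior_subset hv')
  have hc : HasCompactSupport χ := HasCompactSupport.intro hB' h0'
  obtain ⟨A, hA⟩ := (hχ.of_le (by simp : (1 : WithTop ℕ∞) ≤ ∞)).lipschitzWith_of_hasCompactSupport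
    hc one_ne_zero
  refine ⟨B', hB', hBB'.trans interior_subset, hB'Ω, χ, hχ, fun v hv => h1 hv, h0', A + 1,
    by positivity, fun v w => ?_⟩
  have := hA.norm_sub_le v w
  nlinarith [norm_nonneg (v - w)]

lemma symm_apply_of_notMem {X : Type*} [TopologicalSpace X]
    {E : Type*} [NormedAddCommGroup E] [NormedSpace ℝ E] {H : Type*} [TopologicalSpace H]
    {I : ModelWithCorners ℝ E H} [ChartedSpace H X] {e : X ≃ₘ⟮I, I⟯ X} {B : Set X}
    (h : ∀ v ∉ B, e v = v) {v : X} (hv : v ∉ B) : e.symm v = v := by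
  conv_lhs => rw [← h v hv]
  exact e.symm_apply_apply v

/-- Diffeomorphisms of the standard contact space that are Lipschitz-close to the identity and
supported in a given compact set are endpoints of null paths. -/
theorem exists_nullReachable_of_small (hn : 1 ≤ n) {B Ω : Set (StdSpace n)} (hB : IsCompact B)
    (hΩ : IsOpen Ω) (hBΩ : B ⊆ Ω) :
    ∃ B' : Set (StdSpace n), IsCompact B' ∧ B' ⊆ Ω ∧ ∃ L : ℝ, 0 < L ∧
      ∀ g : StdSpace n → StdSpace n, ContDiff ℝ ∞ g → (∀ v ∉ B, g v = 0) →
        (∀ v w, ‖g v - g w‖ ≤ L * ‖v - w‖) →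
        ∃ e : StdSpace n ≃ₘ⟮𝓘(ℝ, StdSpace n), 𝓘(ℝ, StdSpace n)⟯ StdSpace n,
          (∀ v, e v = v + g v) ∧ NullReachable (stdCovector n) B' e := by
  obtain ⟨B', hB', hBB', hB'Ω, χ, hχ, hχ1, hχ0, A, hA, hχlip⟩ := exists_contDiff_bump hB hΩ hBΩ
  refine ⟨B', hB', hB'Ω, ?_⟩
  obtain ⟨R, hR⟩ := hB'.isBounded.exists_norm_le
  wlog hR0 : 0 ≤ R generalizing R
  · exact this 0 (fun v hv => (hR v hv).trans (not_le.1 hR0).le) le_rfl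
  set C : ℝ := 3 * R + 1 with hC
  have hC1 : 1 ≤ C := by linarith
  set i : Fin n := ⟨0, hn⟩
  set e₁ : Euc n := EuclideanSpace.single i 1 with he₁
  have hne₁ : ‖e₁‖ = 1 := by simp [he₁]
  set a : ℝ := 1 / (2 * A) with ha
  have ha0 : 0 < a := by positivity
  obtain ⟨L, hL0, hL1, hL2⟩ : ∃ L : ℝ, 0 < L ∧ 32 * (C * C) * L ≤ 1 ∧ 32 * (C * C) * L / a ≤ 1 := by
    refine ⟨min 1 a / (32 * (C * C)), by positivity, ?_, ?_⟩
    · field_simp; exact min_le_left _ _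
    · field_simp; exact min_le_right _ _
  have hCL : C * L ≤ 1 / 32 := by nlinarith [mul_pos (show 0 < C by linarith) hL0]
  have hLL : L ≤ 1 / 32 := by nlinarith
  refine ⟨L, hL0, fun g hg hgB hglip => ?_⟩
  have hnt : Nontrivial (StdSpace n) := by
    refine ⟨(0, 0, 1), 0, fun h => ?_⟩
    have := congrArg (fun v : StdSpace n => v.2.2) h
    simp at this
  have hBR : ∀ v ∈ B, ‖v‖ ≤ R := fun v hv => hR v (hBB' hv)
  -- the three components of `g`
  have hgx : ∀ v w, ‖(g v).1 - (g w).1‖ ≤ L * ‖v - w‖ := fun v w =>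
    (norm_fst_le (g v - g w)).trans (hglip v w)
  have hgy : ∀ v w, ‖(g v).2.1 - (g w).2.1‖ ≤ L * ‖v - w‖ := fun v w =>
    (norm_fst_le (g v - g w).2).trans ((norm_snd_le (g v - g w)).trans (hglip v w))
  have hgz : ∀ v w, ‖(g v).2.2 - (g w).2.2‖ ≤ L * ‖v - w‖ := fun v w =>
    (norm_snd_le (g v - g w).2).trans ((norm_snd_le (g v - g w)).trans (hglip v w))
  have hgyB : ∀ v ∉ B, (g v).2.1 = 0 := fun v hv => by simp [hgB v hv]
  have hgyc : ContDiff ℝ ∞ fun v => (g v).2.1 := (hg.snd).fst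
  -- the displacement in the `y`-directions
  obtain ⟨Y, hY, hYr⟩ := nullReachable_liftY hgyc (show C * L < 1 by linarith)
    (liftY_lipschitz hL0.le hR0 hgy hBR hgyB) hgyB
  have hYlip := lipschitz_symm_of_add (show C * L ≤ 1 / 2 by linarith)
    (liftY_lipschitz hL0.le hR0 hgy hBR hgyB) hY
  have hYB : ∀ v ∉ B, Y.symm v = v := fun v hv => symm_apply_of_notMem (fun v hv => hYr.apply_of_notMem hv) hv
  -- the remaining displacement in the `z`-direction
  set w₀ : StdSpace n → ℝ := fun v => (g v).2.2 + inner ℝ v.1 (g v).2.1 with hw₀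
  set w : StdSpace n → ℝ := fun v => w₀ (Y.symm v) / a with hw
  have hwc : ContDiff ℝ ∞ w :=
    ((hg.snd.snd.add (contDiff_fst.inner ℝ hgyc)).comp Y.symm.contDiff).div_const a
  have hwB : ∀ v ∉ B, w v = 0 := fun v hv => by simp [hw, hw₀, hYB v hv, hgB v hv]
  have hwlip : ∀ v v', ‖w v - w v'‖ ≤ (4 * C * L / a) * ‖v - v'‖ := by
    intro v v'
    have h1 := inner_lipschitz hL0.le hR0 hgy hBR hgyB (Y.symm v) (Y.symm v')
    have h2 := hgz (Y.symm v) (Y.symm v')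
    have h3 := hYlip v v'
    have h4 : w v - w v' = (((g (Y.symm v)).2.2 - (g (Y.symm v')).2.2) +
      (inner ℝ (Y.symm v).1 (g (Y.symm v)).2.1 - inner ℝ (Y.symm v').1 (g (Y.symm v')).2.1)) / a := by
      simp only [hw, hw₀]; ring
    rw [h4, norm_div, Real.norm_of_nonneg ha0.le, div_mul_eq_mul_div]
    refine div_le_div_of_nonneg_right ?_ ha0.le
    refine (norm_add_le _ _).trans ((add_le_add h2 h1).trans ?_)
    rw [← hC]
    have h5 : (L + C * L) * ‖Y.symm v - Y.symm v'‖ ≤ (L + C * L) * (2 * ‖v - v'‖) :=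
      mul_le_mul_of_nonneg_left h3 (by positivity)
    have h6 : L * ‖v - v'‖ ≤ C * (L * ‖v - v'‖) :=
      le_mul_of_one_le_left (by positivity) hC1
    nlinarith
  -- a displacement in the direction of the first `y`-coordinate
  set u : StdSpace n → Euc n := fun v => -(w v • e₁) with hu
  have huc : ContDiff ℝ ∞ u := (hwc.smul contDiff_const).neg
  have huB : ∀ v ∉ B, u v = 0 := fun v hv => by simp [hu, hwB v hv]
  have hulip : ∀ v v', ‖u v - u v'‖ ≤ (4 * C * L / a) * ‖v - v'‖ := by
    intro v v'
    have : u v - u v' = -((w v - w v') • e₁) := by simp only [hu, sub_smul]; abel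
    rw [this, norm_neg, norm_smul, hne₁, mul_one]
    exact hwlip v v'
  have hla : 0 ≤ 4 * C * L / a := by positivity
  have hsm : C * (4 * C * L / a) ≤ 1 / 8 := by
    have : C * (4 * C * L / a) = (32 * (C * C) * L / a) / 8 := by ring
    rw [this]; linarith
  have hulip' := liftY_lipschitz hla hR0 hulip hBR huB
  obtain ⟨P, hP, hPr⟩ := nullReachable_liftY huc (show C * (4 * C * L / a) < 1 by linarith)
    hulip' huB
  have hPlip := lipschitz_symm_of_add (show C * (4 * C * L / a) ≤ 1 / 2 by linarith) hulip' hP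
  have hPB : ∀ v ∉ B, P.symm v = v := fun v hv => symm_apply_of_notMem (fun v hv => hPr.apply_of_notMem hv) hv
  -- the translation by `a` in the first `x`-coordinate, cut off
  obtain ⟨τ, hτ, hτr⟩ := nullReachable_liftX (u := fun v : StdSpace n => -((a * χ v) • e₁))
    ((contDiff_const.mul hχ).smul contDiff_const).neg (L := 1 / 2) (by norm_num) (by
      intro v v'
      have : -((a * χ v) • e₁) - -((a * χ v') • e₁) = -((a * (χ v - χ v')) • e₁) := by
        rw [mul_sub, sub_smul]; abel
      rw [this, norm_neg, norm_smul, hne₁, mul_one, norm_mul, Real.norm_of_nonneg ha0.le]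
      have h1 := mul_le_mul_of_nonneg_left (hχlip v v') ha0.le
      refine h1.trans (le_of_eq ?_)
      rw [ha]; field_simp) (B := B') (fun v hv => by simp [hχ0 v hv])
  have hτlip := lipschitz_symm_of_add (L := 1 / 2) le_rfl (liftX_lipschitz (by
      intro v v'
      have : -((a * χ v) • e₁) - -((a * χ v') • e₁) = -((a * (χ v - χ v')) • e₁) := by
        rw [mul_sub, sub_smul]; abel
      rw [this, norm_neg, norm_smul, hne₁, mul_one, norm_mul, Real.norm_of_nonneg ha0.le]
      have h1 := mul_le_mul_of_nonneg_left (hχlip v v') ha0.le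
      refine h1.trans (le_of_eq ?_)
      rw [ha]; field_simp)) hτ
  have hτB : ∀ v ∉ B', τ.symm v = v := fun v hv => symm_apply_of_notMem (fun v hv => hτr.apply_of_notMem hv) hv
  -- the opposite displacement, conjugated by the translation
  set w₂ : StdSpace n → ℝ := fun v => w (P.symm (τ.symm v)) with hw₂
  set u₂ : StdSpace n → Euc n := fun v => w₂ v • e₁ with hu₂
  have hu₂c : ContDiff ℝ ∞ u₂ :=
    (hwc.comp (P.symm.contDiff.comp τ.symm.contDiff)).smul contDiff_const
  have hu₂B : ∀ v ∉ B', u₂ v = 0 := fun v hv => by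
    have hvB : v ∉ B := fun h => hv (hBB' h)
    simp [hu₂, hw₂, hτB v hv, hPB v hvB, hwB v hvB]
  have hu₂lip : ∀ v v', ‖u₂ v - u₂ v'‖ ≤ (4 * (4 * C * L / a)) * ‖v - v'‖ := by
    intro v v'
    rw [hu₂, ← sub_smul, norm_smul, hne₁, mul_one]
    have h1 := hwlip (P.symm (τ.symm v)) (P.symm (τ.symm v'))
    have h2 := hPlip (τ.symm v) (τ.symm v')
    have h3 := hτlip v v'
    have h4 : ‖P.symm (τ.symm v) - P.symm (τ.symm v')‖ ≤ 4 * ‖v - v'‖ := by linarith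
    calc _ ≤ _ := h1
      _ ≤ (4 * C * L / a) * (4 * ‖v - v'‖) := mul_le_mul_of_nonneg_left h4 hla
      _ = _ := by ring
  have hu₂lip' := liftY_lipschitz (by positivity) hR0 hu₂lip hR hu₂B
  have hsm₂ : C * (4 * (4 * C * L / a)) < 1 := by linarith
  obtain ⟨Q, hQ, hQr⟩ := nullReachable_liftY hu₂c hsm₂ hu₂lip' hu₂B
  -- the displacement of `y` and `z`
  obtain ⟨f, hf⟩ := exists_diffeomorph_add (h := fun v => ((0, (g v).2) : StdSpace n))
    (contDiff_const.prodMk hg.snd) (L := L) (by linarith) (by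
      intro v v'
      have : ((0, (g v).2) : StdSpace n) - (0, (g v').2) = (0, (g v - g v').2) := by
        simp
      rw [this, Prod.norm_mk, norm_zero]
      exact max_le (by positivity) ((norm_snd_le _).trans (hglip v v')))
  have hfB : ∀ v ∉ B, f v = v := fun v hv => by
    rw [hf, hgB v hv]; exact add_zero v
  have hfB' : ∀ v ∈ B, f v ∈ B := by
    intro v hv
    by_contra h
    have h1 := hfB _ h
    rw [f.injective h1] at h
    exact h hv
  have hflip := lipschitz_symm_of_add (h := fun v => ((0, (g v).2) : StdSpace n))
    (L := L) (by linarith) (by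
      intro v v'
      have : ((0, (g v).2) : StdSpace n) - (0, (g v').2) = (0, (g v - g v').2) := by
        simp
      rw [this, Prod.norm_mk, norm_zero]
      exact max_le (by positivity) ((norm_snd_le _).trans (hglip v v'))) hf
  -- the displacement of `x`
  obtain ⟨X, hX, hXr⟩ := nullReachable_liftX (u := fun v => (g (f.symm v)).1)
    ((hg.comp f.symm.contDiff).fst) (L := 2 * L) (by linarith) (by
      intro v v'
      have h1 := hgx (f.symm v) (f.symm v')
      have h2 := mul_le_mul_of_nonneg_left (hflip v v') hL0.le
      linarith) (B := B) (fun v hv => by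
        rw [symm_apply_of_notMem hfB hv, hgB v hv]; rfl)
  have hfinal : ∀ v, τ.symm (Q (τ (P (Y v)))) = f v := by
    intro v
    set v₂ := P (Y v) with hv₂
    have hwv : w₂ (τ v₂) = w₀ v / a := by simp [hw₂, hv₂, hw]
    have hwY : w (Y v) = w₀ v / a := by simp [hw]
    have e₀ : (Y v).1 = v.1 := by simp [hY, liftY]
    have e₁' : v₂ + (0, (w₀ v / a) • e₁, (a - v.1 i) * (w₀ v / a)) = f v := by
      have h1 : inner ℝ v.1 e₁ = v.1 i := by simp [he₁, EuclideanSpace.inner_single_right]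
      have h2 : v₂ = Y v + liftY u (Y v) := hP _
      rw [h2, hf]
      simp only [liftY, hu, hwY, e₀]
      rw [hY]
      simp only [liftY]
      ext1
      · simp
      ext1
      · simp
      · simp only [Prod.snd_add, inner_neg_right, inner_smul_right, h1, hw₀]
        field_simp
        ring
    have hQv : Q (τ v₂) = τ v₂ + (0, (w₀ v / a) • e₁, -((w₀ v / a) * (τ v₂).1 i)) := by
      rw [hQ, liftY]
      simp only [hu₂, hwv, inner_smul_right]
      simp [he₁, EuclideanSpace.inner_single_right]
    by_cases h0 : w₀ v = 0
    · rw [h0] at hQv e₁'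
      simp only [zero_div, zero_smul, zero_mul, neg_zero, mul_zero] at hQv e₁'
      rw [show ((0, 0, 0) : StdSpace n) = 0 from rfl, add_zero] at hQv e₁'
      rw [hQv, τ.symm_apply_apply, e₁']
    · have hvB : v ∈ B := by
        by_contra h
        exact h0 (by simp [hw₀, hgB v h])
      have hYvB : Y v ∈ B := by
        by_contra h
        have := hwB _ h
        rw [hwY] at this
        exact h0 (by simpa [ha0.ne'] using this)
      have hv₂B : v₂ ∈ B := by
        by_contra h
        have h1 := hPr.apply_of_notMem h
        exact h (P.injective h1 ▸ hYvB)
      have hτ₂ : τ v₂ = v₂ + (-(a • e₁), 0, 0) := by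
        rw [hτ, liftX, hχ1 _ hv₂B, mul_one]
      have hτf : τ (f v) = f v + (-(a • e₁), 0, 0) := by
        rw [hτ, liftX, hχ1 _ (hfB' v hvB), mul_one]
      have hx : v₂.1 = v.1 := by simp [hv₂, hP, liftY, e₀]
      have hQf : Q (τ v₂) = τ (f v) := by
        rw [hQv, hτf, ← e₁', hτ₂]
        ext1
        · simp [add_comm]
        ext1
        · simp
        · simp only [Prod.snd_add, Prod.fst_add, PiLp.add_apply, hx, PiLp.neg_apply,
            PiLp.smul_apply, he₁, PiLp.single_apply, if_true, smul_eq_mul]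
          ring
      rw [hQf, τ.symm_apply_apply]
  refine ⟨Y.trans (P.trans (τ.trans (Q.trans (τ.symm.trans X)))), fun v => ?_, ?_⟩
  · simp only [Diffeomorph.coe_trans, Function.comp_apply, hfinal]
    rw [hX, liftX, f.symm_apply_apply, hf, add_assoc]
    congr 1
    ext1
    · simp
    · simp
  · exact (hYr.mono hBB').trans ((hPr.mono hBB').trans (hτr.trans (hQr.trans
      (hτr.symm.trans (hXr.mono hBB')))))

end SmallPerturbations

section ChartTransport

lemma Diffeomorph.injective_coe {E E' : Type*} [NormedAddCommGroup E] [NormedSpace ℝ E]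
    [NormedAddCommGroup E'] [NormedSpace ℝ E'] {H H' : Type*} [TopologicalSpace H]
    [TopologicalSpace H'] {I : ModelWithCorners ℝ E H} {I' : ModelWithCorners ℝ E' H'}
    {M M' : Type*} [TopologicalSpace M] [ChartedSpace H M] [TopologicalSpace M']
    [ChartedSpace H' M'] (e : M ≃ₘ⟮I, I'⟯ M') : Function.Injective (e : M → M') :=
  e.injective

variable {V : Type*} [NormedAddCommGroup V]
  {E : Type*} [NormedAddCommGroup E] [NormedSpace ℝ E]
  {H : Type*} [TopologicalSpace H] {I : ModelWithCorners ℝ E H}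
  {T : Type*} [TopologicalSpace T] [ChartedSpace H T]

open Classical in
/-- The self-map of `T` which is `h` in the chart `ψ`, and the identity outside the chart. -/
def chartConj (ψ : OpenPartialHomeomorph T V) (h : V → V) (x : T) : T :=
  if x ∈ ψ.source then ψ.symm (h (ψ x)) else x

variable {ψ : OpenPartialHomeomorph T V}

lemma chartConj_of_mem {h : V → V} {x : T} (hx : x ∈ ψ.source) :
    chartConj ψ h x = ψ.symm (h (ψ x)) := if_pos hx

lemma chartConj_of_notMem {h : V → V} {x : T} (hx : x ∉ ψ.source) : chartConj ψ h x = x :=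
  if_neg hx

lemma chartConj_of_apply_eq {h : V → V} {x : T} (hx : h (ψ x) = ψ x) : chartConj ψ h x = x := by
  by_cases h1 : x ∈ ψ.source
  · rw [chartConj_of_mem h1, hx, ψ.left_inv h1]
  · exact chartConj_of_notMem h1

lemma chartConj_of_notMem_image {K : Set V} {h : V → V} (hh : ∀ v ∉ K, h v = v) {x : T}
    (hx : x ∉ ψ.symm '' K) : chartConj ψ h x = x := by
  by_cases h1 : x ∈ ψ.source
  · exact chartConj_of_apply_eq (hh _ fun h2 => hx ⟨_, h2, ψ.left_inv h1⟩)
  · exact chartConj_of_notMem h1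

lemma apply_mem_target {K : Set V} (hK : K ⊆ ψ.target) {h : V → V} (hinj : Function.Injective h)
    (hh : ∀ v ∉ K, h v = v) {v : V} (hv : v ∈ ψ.target) : h v ∈ ψ.target := by
  by_cases h1 : h v ∈ K
  · exact hK h1
  · rwa [hinj (hh _ h1)]

lemma chartConj_comp {K : Set V} (hK : K ⊆ ψ.target) {g h : V → V} (hinj : Function.Injective h)
    (hh : ∀ v ∉ K, h v = v) (x : T) :
    chartConj ψ g (chartConj ψ h x) = chartConj ψ (g ∘ h) x := by
  by_cases hx : x ∈ ψ.source
  · have h1 := apply_mem_target hK hinj hh (ψ.map_source hx)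
    rw [chartConj_of_mem hx, chartConj_of_mem (ψ.map_target h1), chartConj_of_mem hx,
      ψ.right_inv h1]
    rfl
  · rw [chartConj_of_notMem hx, chartConj_of_notMem hx, chartConj_of_notMem hx]

variable [NormedSpace ℝ V]

lemma contMDiff_chartConj [T2Space T] (hψ : ContMDiffOn I 𝓘(ℝ, V) ∞ ψ ψ.source)
    (hψ' : ContMDiffOn 𝓘(ℝ, V) I ∞ ψ.symm ψ.target) {K : Set V} (hKc : IsCompact K)
    (hK : K ⊆ ψ.target) {F : ℝ → V → V}
    (hF : ContMDiff (𝓘(ℝ, ℝ).prod 𝓘(ℝ, V)) 𝓘(ℝ, V) ∞ (fun q : ℝ × V => F q.1 q.2))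
    (hinj : ∀ t, Function.Injective (F t)) (hFK : ∀ t, ∀ v ∉ K, F t v = v) :
    ContMDiff (𝓘(ℝ, ℝ).prod I) I ∞ (fun q : ℝ × T => chartConj ψ (F q.1) q.2) := by
  rintro ⟨t, x⟩
  by_cases hx : x ∈ ψ.source
  · have h1 : ContMDiffAt (𝓘(ℝ, ℝ).prod I) I ∞
        (fun q : ℝ × T => ψ.symm (F q.1 (ψ q.2))) (t, x) := by
      have h2 : ContMDiffAt 𝓘(ℝ, V) I ∞ ψ.symm (F t (ψ x)) :=
        hψ'.contMDiffAt (ψ.open_target.mem_nhds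
          (apply_mem_target hK (hinj t) (hFK t) (ψ.map_source hx)))
      have h3 : ContMDiffAt (𝓘(ℝ, ℝ).prod I) 𝓘(ℝ, V) ∞ (fun q : ℝ × T => ψ q.2) (t, x) :=
        ContMDiffAt.comp (t, x) (hψ.contMDiffAt (ψ.open_source.mem_nhds hx)) contMDiffAt_snd
      have h4 : ContMDiffAt (𝓘(ℝ, ℝ).prod I) 𝓘(ℝ, V) ∞ (fun q : ℝ × T => F q.1 (ψ q.2)) (t, x) :=
        ContMDiffAt.comp (t, x) (g := fun q : ℝ × V => F q.1 q.2) (f := fun q : ℝ × T => (q.1, ψ q.2))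
          (hF (t, ψ x)) (contMDiffAt_fst.prodMk h3)
      exact ContMDiffAt.comp (t, x) (g := ψ.symm) (f := fun q : ℝ × T => F q.1 (ψ q.2)) h2 h4
    refine h1.congr_of_eventuallyEq ?_
    filter_upwards [continuous_snd.continuousAt.preimage_mem_nhds
      (ψ.open_source.mem_nhds hx : ψ.source ∈ 𝓝 ((t, x) : ℝ × T).2)] with q hq
    exact chartConj_of_mem hq
  · have hcl : IsClosed (ψ.symm '' K) := (hKc.image_of_continuousOn (ψ.continuousOn_symm.mono hK)).isClosed
    have hx' : x ∉ ψ.symm '' K := by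
      rintro ⟨v, hv, rfl⟩
      exact hx (ψ.map_target (hK hv))
    have h1 : ContMDiffAt (𝓘(ℝ, ℝ).prod I) I ∞ (fun q : ℝ × T => q.2) (t, x) := contMDiffAt_snd
    refine h1.congr_of_eventuallyEq ?_
    filter_upwards [continuous_snd.continuousAt.preimage_mem_nhds
      (hcl.isOpen_compl.mem_nhds hx' : (ψ.symm '' K)ᶜ ∈ 𝓝 ((t, x) : ℝ × T).2)] with q hq
    exact chartConj_of_notMem_image (hFK _) hq

lemma exists_diffeomorph_chartConj [T2Space T] (hψ : ContMDiffOn I 𝓘(ℝ, V) ∞ ψ ψ.source)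
    (hψ' : ContMDiffOn 𝓘(ℝ, V) I ∞ ψ.symm ψ.target) {K : Set V} (hKc : IsCompact K)
    (hK : K ⊆ ψ.target) (e : V ≃ₘ⟮𝓘(ℝ, V), 𝓘(ℝ, V)⟯ V) (he : ∀ v ∉ K, e v = v) :
    ∃ e' : T ≃ₘ⟮I, I⟯ T, ∀ x, e' x = chartConj ψ e x := by
  have he' : ∀ v ∉ K, e.symm v = v := fun v hv => symm_apply_of_notMem he hv
  have hs : ∀ f : V ≃ₘ⟮𝓘(ℝ, V), 𝓘(ℝ, V)⟯ V, (∀ v ∉ K, f v = v) →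
      ContMDiff I I ∞ (chartConj ψ f) := fun f hf =>
    (contMDiff_chartConj (F := fun _ => f) hψ hψ' hKc hK (f.contMDiff.comp contMDiff_snd)
      (fun _ => f.injective) (fun _ => hf)).comp
      ((contMDiff_const (c := (0 : ℝ))).prodMk contMDiff_id)
  refine ⟨⟨⟨chartConj ψ e, chartConj ψ e.symm, fun x => ?_, fun x => ?_⟩, hs e he, hs e.symm he'⟩,
    fun x => rfl⟩
  · rw [chartConj_comp hK e.injective_coe he]
    exact chartConj_of_apply_eq (e.symm_apply_apply _)
  · rw [chartConj_comp hK e.symm.injective_coe he']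
    exact chartConj_of_apply_eq (e.apply_symm_apply _)

/-- Null paths in a Darboux chart extend to the ambient contact manifold. -/
theorem NullReachable.chartConj [T2Space T] {n : ℕ} {α : CovectorField I T}
    {ψ : OpenPartialHomeomorph T (StdSpace n)} (hψ : IsDarbouxChart n α ψ)
    {K : Set (StdSpace n)} (hKc : IsCompact K) (hK : K ⊆ ψ.target)
    {e : StdSpace n ≃ₘ⟮𝓘(ℝ, StdSpace n), 𝓘(ℝ, StdSpace n)⟯ StdSpace n}
    (he : NullReachable (stdCovector n) K e) :
    ∃ e' : T ≃ₘ⟮I, I⟯ T, (∀ x, e' x = _root_.chartConj ψ e x) ∧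
      NullReachable α (ψ.symm '' K) e' := by
  obtain ⟨e', he'⟩ := exists_diffeomorph_chartConj (I := I) hψ.smooth hψ.smooth_symm hKc hK e
    (fun v hv => he.apply_of_notMem hv)
  refine ⟨e', he', ?_⟩
  obtain ⟨F, hF, hF0, hF1, hFK⟩ := he
  choose F' hF' using fun t => exists_diffeomorph_chartConj (I := I) hψ.smooth hψ.smooth_symm hKc hK
    (F t) (hFK t)
  have hsm : ContMDiff (𝓘(ℝ, ℝ).prod I) I ∞ (fun q : ℝ × T => F' q.1 q.2) := by
    have := contMDiff_chartConj (I := I) hψ.smooth hψ.smooth_symm hKc hK hF.smooth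
      (fun t => (F t).injective_coe) hFK
    refine this.congr fun q => ?_
    rw [hF']
  refine ⟨F', ⟨hsm, ?_⟩, ?_, ?_, ?_⟩
  · intro t x
    by_cases hx : x ∈ ψ.source
    · have hmem : ∀ s, F' s x ∈ ψ.source := fun s => by
        rw [hF', chartConj_of_mem hx]
        exact ψ.map_target (apply_mem_target hK (F s).injective_coe (hFK s) (ψ.map_source hx))
      rw [hψ.contact _ (hmem t)]
      have h1 : (fun s => ψ (F' s x)) = fun s => F s (ψ x) := by
        ext1 s
        rw [hF', chartConj_of_mem hx, ψ.right_inv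
          (apply_mem_target hK (F s).injective_coe (hFK s) (ψ.map_source hx))]
      have h2 : MDifferentiableAt I 𝓘(ℝ, StdSpace n) ψ (F' t x) :=
        (hψ.smooth.contMDiffAt (ψ.open_source.mem_nhds (hmem t))).mdifferentiableAt (by simp)
      have h3 : MDifferentiableAt 𝓘(ℝ, ℝ) I (fun s => F' s x) t :=
        (contMDiff_orbit (F := fun t => F' t) hsm x).mdifferentiable (by simp) t
      have h4 := mfderiv_comp (I := 𝓘(ℝ, ℝ)) (I' := I) (I'' := 𝓘(ℝ, StdSpace n)) t h2 h3
      have h5 : mfderiv I 𝓘(ℝ, StdSpace n) ψ (F' t x)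
          (mfderiv 𝓘(ℝ, ℝ) I (fun s => F' s x) t (1 : ℝ)) =
          mfderiv 𝓘(ℝ, ℝ) 𝓘(ℝ, StdSpace n) (fun s => F s (ψ x)) t (1 : ℝ) := by
        have := congrArg (fun L => L (1 : ℝ)) h4
        refine this.symm.trans ?_
        have h6 : (ψ ∘ fun s => F' s x) = fun s => F s (ψ x) := h1
        rw [h6]
      have h7 := hF.null t (ψ x)
      have h8 := congrFun h1 t
      have key : ∀ (a : StdSpace n) (b : StdSpace n), a = F t (ψ x) →
          b = (mfderiv 𝓘(ℝ, ℝ) 𝓘(ℝ, StdSpace n) (fun s => F s (ψ x)) t : ℝ →L[ℝ] StdSpace n) 1 →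
          stdForm n a b = 0 := by
        rintro a b rfl rfl
        exact (stdCovector_apply _ _).symm.trans h7
      exact key _ _ h8 h5
    · have h1 : (fun s : ℝ => F' s x) = fun _ => x := by
        ext1 s; rw [hF', chartConj_of_notMem hx]
      have h2 : mfderiv 𝓘(ℝ, ℝ) I (fun s : ℝ => F' s x) t = 0 := by
        rw [h1]; exact mfderiv_const
      have key : ∀ (L : ℝ →L[ℝ] E), L = 0 → (α (F' t x) : E →L[ℝ] ℝ) (L 1) = 0 := by
        rintro L rfl
        exact (α (F' t x)).map_zero
      exact key _ h2
  · ext x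
    rw [hF', hF0]
    exact chartConj_of_apply_eq rfl
  · ext x
    rw [hF', hF1, he']
  · intro t x hx
    rw [hF', chartConj_of_notMem_image (hFK t) hx]

end ChartTransport

section Patches

lemma eventually_fderiv_small {V W : Type*} [NormedAddCommGroup V] [NormedSpace ℝ V]
    [NormedAddCommGroup W] [NormedSpace ℝ W] {u : ℝ × V → W} {D : Set (ℝ × V)} (hD : IsOpen D)
    (hu : ContDiffOn ℝ ∞ u D) {t₀ : ℝ} {U B : Set V} (hU : IsOpen U) (hB : IsCompact B)
    (hBU : B ⊆ U) (hUD : ∀ v ∈ U, (t₀, v) ∈ D) (h0 : ∀ v ∈ U, u (t₀, v) = 0)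
    {L : ℝ} (hL : 0 < L) :
    ∀ᶠ t in 𝓝 t₀, ∀ v ∈ B, (t, v) ∈ D ∧ ‖fderiv ℝ (fun w => u (t, w)) v‖ ≤ L := by
  refine hB.eventually_forall_of_forall_eventually fun v hv => ?_
  have hder : ∀ q ∈ D, fderiv ℝ (fun w => u (q.1, w)) q.2 =
      (fderiv ℝ u q).comp (ContinuousLinearMap.inr ℝ ℝ V) := by
    rintro ⟨t, w⟩ hq
    have h1 : HasFDerivAt u (fderiv ℝ u (t, w)) (t, w) :=
      ((hu.contDiffAt (hD.mem_nhds hq)).differentiableAt (by simp)).hasFDerivAt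
    exact (h1.comp w (hasFDerivAt_prodMk_right t w)).fderiv
  have hmem : ∀ᶠ q in 𝓝 ((t₀, v) : ℝ × V), q ∈ D := hD.mem_nhds (hUD v (hBU hv))
  have hcont : ContinuousAt (fun q => (fderiv ℝ u q).comp (ContinuousLinearMap.inr ℝ ℝ V))
      (t₀, v) :=
    ((hu.continuousOn_fderiv_of_isOpen hD (by simp)).continuousAt
      (hD.mem_nhds (hUD v (hBU hv)))).clm_comp continuousAt_const
  have hzero : (fderiv ℝ u (t₀, v)).comp (ContinuousLinearMap.inr ℝ ℝ V) = 0 := by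
    rw [← hder _ (hUD v (hBU hv))]
    have : (fun w => u (t₀, w)) =ᶠ[𝓝 v] fun _ => 0 := by
      filter_upwards [hU.mem_nhds (hBU hv)] with w hw using h0 w hw
    refine this.fderiv_eq.trans ?_
    simp
  have hlt : ∀ᶠ q in 𝓝 ((t₀, v) : ℝ × V),
      ‖(fderiv ℝ u q).comp (ContinuousLinearMap.inr ℝ ℝ V)‖ < L := by
    refine hcont.norm.eventually_lt_const ?_
    simpa only [hzero, norm_zero] using hL
  filter_upwards [hmem, hlt] with q h1 h2
  exact ⟨h1, by rw [hder q h1]; exact h2.le⟩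

variable {k d : ℕ} {N T : Type*} [TopologicalSpace N] [ChartedSpace (Euc k) N]
  [TopologicalSpace T] [ChartedSpace (Euc d) T]

/-- An immersion has a smooth local left inverse. -/
lemma exists_local_retraction {e : N → T} {p : N} (he : IsImmersionAt (𝓡 k) (𝓡 d) ∞ e p) :
    ∃ U : Set T, IsOpen U ∧ e p ∈ U ∧ ∃ r : T → N, ContMDiffOn (𝓡 d) (𝓡 k) ∞ r U ∧
      ∀ᶠ p' in 𝓝 p, r (e p') = p' := by
  set a := he.domChart
  set b := he.codChart
  set L := he.equiv
  have ha : ContMDiffOn (𝓡 k) (𝓡 k) ∞ a.symm a.target :=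
    contMDiffOn_symm_of_mem_maximalAtlas he.domChart_mem_maximalAtlas
  have hb : ContMDiffOn (𝓡 d) (𝓡 d) ∞ b b.source :=
    contMDiffOn_of_mem_maximalAtlas he.codChart_mem_maximalAtlas
  have hL : ContMDiff (𝓡 d) (𝓡 k) ∞ (fun v : Euc d => (L.symm v).1) :=
    (L.symm.contDiff.fst).contMDiff
  have key : ∀ p' ∈ a.source, b (e p') = L (a p', 0) := by
    intro p' hp'
    have h := he.writtenInCharts
      (show a p' ∈ (a.extend (𝓡 k)).target by simpa using a.map_source hp')
    have h' : b (e (a.symm (a p'))) = L (a p', 0) := by simpa using h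
    rwa [a.left_inv hp'] at h'
  have hmap : ∀ p' ∈ a.source, e p' ∈ b.source := fun p' hp' => he.source_subset_preimage_source hp'
  refine ⟨b.source ∩ b ⁻¹' {v | (L.symm v).1 ∈ a.target}, ?_, ?_, fun x => a.symm (L.symm (b x)).1,
    ?_, ?_⟩
  · exact b.continuousOn.isOpen_inter_preimage b.open_source
      (a.open_target.preimage (by fun_prop))
  · refine ⟨he.mem_codChart_source, ?_⟩
    change (L.symm (b (e p))).1 ∈ a.target
    rw [key p he.mem_domChart_source, L.symm_apply_apply]
    exact a.map_source he.mem_domChart_source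
  · exact ha.comp (hL.comp_contMDiffOn (hb.mono inter_subset_left)) fun x hx => hx.2
  · filter_upwards [a.open_source.mem_nhds he.mem_domChart_source] with p' hp'
    rw [key p' hp', L.symm_apply_apply]
    exact a.left_inv hp'

/-- Near a point of a smooth embedding `ι t₀`, the isotopy `ι` run for a short time, cut off by a
function of the point, is induced by null paths. -/
theorem exists_patch {n : ℕ} (hn : 1 ≤ n) [T2Space T] {α : CovectorField (𝓡 d) T}
    {ψ : OpenPartialHomeomorph T (StdSpace n)} (hψ : IsDarbouxChart n α ψ)
    {ι : ℝ → N → T}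
    (hι : ContMDiff (𝓘(ℝ, ℝ).prod (𝓡 k)) (𝓡 d) ∞ (fun q : ℝ × N => ι q.1 q.2))
    {t₀ : ℝ} (hemb : IsSmoothEmbedding (𝓡 k) (𝓡 d) ∞ (ι t₀))
    {O : Set T} (hO : IsOpen O) {p : N} (hpO : ι t₀ p ∈ O) (hpψ : ι t₀ p ∈ ψ.source) :
    ∃ P : Set T, IsOpen P ∧ ι t₀ p ∈ P ∧ P ⊆ O ∧ ∃ A : ℝ × T → T,
      (∀ x ∈ P, A (t₀, x) = x) ∧ (∀ x ∈ P, ContinuousAt A (t₀, x)) ∧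
      ∀ s : T → ℝ, ContMDiff (𝓡 d) 𝓘(ℝ, ℝ) ∞ s → IsCompact (tsupport s) → tsupport s ⊆ P →
        ∀ᶠ t in 𝓝 t₀, ∃ g : T ≃ₘ⟮𝓡 d, 𝓡 d⟯ T,
          (∃ K, IsCompact K ∧ K ⊆ O ∧ NullReachable α K g) ∧
          (∀ x ∈ P, g x = A (t₀ + (t - t₀) * s x, x)) ∧ (∀ x, s x = 0 → g x = x) ∧
          ∀ p', g (ι t₀ p') = ι (t₀ + (t - t₀) * s (ι t₀ p')) p' := by
  classical
  obtain ⟨U, hU, hpU, r, hr, hrp⟩ := exists_local_retraction (hemb.isImmersion.isImmersionAt p)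
  obtain ⟨U', hU', hU'p⟩ : ∃ U' ∈ 𝓝 (ι t₀ p), ∀ p', ι t₀ p' ∈ U' → r (ι t₀ p') = p' := by
    rw [hemb.isEmbedding.isInducing.nhds_eq_comap, Filter.eventually_comap] at hrp
    obtain ⟨U', hU', h⟩ := Filter.eventually_iff_exists_mem.1 hrp
    exact ⟨U', hU', fun p' hp' => h _ hp' p' rfl⟩
  obtain ⟨U'', hU''U', hU'', hpU''⟩ := mem_nhds_iff.1 hU'
  have hι₀ : Continuous (ι t₀) := hemb.isEmbedding.continuous
  set S : Set T := U ∩ (U'' ∩ (O ∩ ψ.source)) with hS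
  have hSo : IsOpen S := hU.inter (hU''.inter (hO.inter ψ.open_source))
  set P : Set T := S ∩ (ι t₀ ∘ r) ⁻¹' ψ.source with hP
  have hPo : IsOpen P := ((hι₀.comp_continuousOn (hr.continuousOn.mono
    inter_subset_left)).isOpen_inter_preimage hSo ψ.open_source)
  have hrpp : r (ι t₀ p) = p := hrp.self_of_nhds
  have hpP : ι t₀ p ∈ P := ⟨⟨hpU, hpU'', hpO, hpψ⟩, by simpa [hrpp] using hpψ⟩
  have hPr : ∀ x ∈ P, ContMDiffAt (𝓡 d) (𝓡 k) ∞ r x := fun x hx =>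
    hr.contMDiffAt (hU.mem_nhds hx.1.1)
  have hPψ : P ⊆ ψ.source := fun x hx => hx.1.2.2.2
  have hPre : ∀ p', ι t₀ p' ∈ P → r (ι t₀ p') = p' := fun p' hp' => hU'p p' (hU''U' hp'.1.2.1)
  refine ⟨P, hPo, hpP, fun x hx => hx.1.2.2.1,
    fun q => ψ.symm (ψ q.2 + (ψ (ι q.1 (r q.2)) - ψ (ι t₀ (r q.2)))), ?_, ?_, ?_⟩
  · intro x hx
    simp [ψ.left_inv (hPψ hx)]
  · intro x hx
    have c1 : ContinuousAt (fun q : ℝ × T => r q.2) (t₀, x) :=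
      ContinuousAt.comp (x := (t₀, x)) (hPr x hx).continuousAt continuousAt_snd
    have c2 : ContinuousAt (fun q : ℝ × T => ι q.1 (r q.2)) (t₀, x) :=
      ContinuousAt.comp (x := (t₀, x)) (g := fun q : ℝ × N => ι q.1 q.2)
        hι.continuous.continuousAt (continuousAt_fst.prodMk c1)
    have c3 : ContinuousAt (fun q : ℝ × T => ι t₀ (r q.2)) (t₀, x) :=
      ContinuousAt.comp (x := (t₀, x)) (g := ι t₀) hι₀.continuousAt c1
    have c4 : ContinuousAt (fun q : ℝ × T => ψ (ι q.1 (r q.2))) (t₀, x) :=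
      ContinuousAt.comp (x := (t₀, x)) (g := ψ) (ψ.continuousAt hx.2) c2
    have c5 : ContinuousAt (fun q : ℝ × T => ψ (ι t₀ (r q.2))) (t₀, x) :=
      ContinuousAt.comp (x := (t₀, x)) (g := ψ) (ψ.continuousAt hx.2) c3
    have c6 : ContinuousAt (fun q : ℝ × T => ψ q.2) (t₀, x) :=
      ContinuousAt.comp (x := (t₀, x)) (g := ψ) (ψ.continuousAt (hPψ hx)) continuousAt_snd
    refine ContinuousAt.comp (x := (t₀, x)) (g := ψ.symm) ?_ (c6.add (c4.sub c5))
    refine ψ.continuousAt_symm ?_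
    simpa using ψ.map_source (hPψ hx)
  intro s hs hsc hsP
  -- the coordinate expression
  set W : Set (StdSpace n) := ψ.target ∩ ψ.symm ⁻¹' P with hW
  have hWo : IsOpen W := ψ.continuousOn_symm.isOpen_inter_preimage ψ.open_target hPo
  set B : Set (StdSpace n) := ψ '' tsupport s with hB
  have hBc : IsCompact B := hsc.image_of_continuousOn (ψ.continuousOn.mono (hsP.trans hPψ))
  have hBW : B ⊆ W := by
    rintro _ ⟨x, hx, rfl⟩
    refine ⟨ψ.map_source (hPψ (hsP hx)), ?_⟩
    rw [mem_preimage, ψ.left_inv (hPψ (hsP hx))]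
    exact hsP hx
  have hsB : ∀ v ∈ ψ.target, v ∉ B → s (ψ.symm v) = 0 := fun v hv hvB =>
    image_eq_zero_of_notMem_tsupport fun h => hvB ⟨_, h, ψ.right_inv hv⟩
  obtain ⟨B', hB'c, hB'O, L, hL, hsmall⟩ := exists_nullReachable_of_small hn hBc
    (ψ.continuousOn_symm.isOpen_inter_preimage ψ.open_target hO)
    (fun v hv => ⟨(hBW hv).1, (hBW hv).2.1.2.2.1⟩)
  set τ : ℝ × StdSpace n → ℝ := fun q => t₀ + (q.1 - t₀) * s (ψ.symm q.2) with hτ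
  set J : ℝ × StdSpace n → T := fun q => ι (τ q) (r (ψ.symm q.2)) with hJ
  set u : ℝ × StdSpace n → StdSpace n := fun q => ψ (J q) - ψ (ι t₀ (r (ψ.symm q.2))) with hu
  have hJs : ∀ q : ℝ × StdSpace n, q.2 ∈ W →
      ContMDiffAt 𝓘(ℝ, ℝ × StdSpace n) (𝓡 d) ∞ J q ∧
      ContMDiffAt 𝓘(ℝ, ℝ × StdSpace n) (𝓡 d) ∞ (fun q => ι t₀ (r (ψ.symm q.2))) q := by
    intro q hq
    have c1 : ContMDiffAt 𝓘(ℝ, ℝ × StdSpace n) (𝓡 d) ∞ (fun q : ℝ × StdSpace n => ψ.symm q.2) q :=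
      ContMDiffAt.comp q (hψ.smooth_symm.contMDiffAt (ψ.open_target.mem_nhds hq.1))
        contDiff_snd.contMDiff.contMDiffAt
    have c2 : ContMDiffAt 𝓘(ℝ, ℝ × StdSpace n) 𝓘(ℝ, ℝ) ∞
        (fun q : ℝ × StdSpace n => s (ψ.symm q.2)) q :=
      ContMDiffAt.comp q (g := s) hs.contMDiffAt c1
    have c3 : ContMDiffAt 𝓘(ℝ, ℝ × StdSpace n) 𝓘(ℝ, ℝ) ∞ τ q :=
      (contDiffAt_const.add ((contDiffAt_fst.sub contDiffAt_const).mul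
        c2.contDiffAt)).contMDiffAt
    have c4 : ContMDiffAt 𝓘(ℝ, ℝ × StdSpace n) (𝓡 k) ∞
        (fun q : ℝ × StdSpace n => r (ψ.symm q.2)) q :=
      ContMDiffAt.comp q (g := r) (hPr _ hq.2) c1
    exact ⟨ContMDiffAt.comp q (g := fun q : ℝ × N => ι q.1 q.2) hι.contMDiffAt (c3.prodMk c4),
      ContMDiffAt.comp q (g := fun q : ℝ × N => ι q.1 q.2) hι.contMDiffAt
        (contMDiffAt_const.prodMk c4)⟩
  set D : Set (ℝ × StdSpace n) := (univ ×ˢ W) ∩ J ⁻¹' ψ.source with hD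
  have hDo : IsOpen D := by
    refine ContinuousOn.isOpen_inter_preimage (fun q hq => ?_) (isOpen_univ.prod hWo)
      ψ.open_source
    exact (hJs q hq.2).1.continuousAt.continuousWithinAt
  have huD : ContDiffOn ℝ ∞ u D := by
    intro q hq
    refine ContDiffAt.contDiffWithinAt (ContDiffAt.sub ?_ ?_)
    · exact (ContMDiffAt.comp q (g := ψ) (hψ.smooth.contMDiffAt (ψ.open_source.mem_nhds hq.2))
        (hJs q hq.1.2).1).contDiffAt
    · exact (ContMDiffAt.comp q (g := ψ) (hψ.smooth.contMDiffAt
        (ψ.open_source.mem_nhds hq.1.2.2.2)) (hJs q hq.1.2).2).contDiffAt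
  have hu0 : ∀ t v, s (ψ.symm v) = 0 → u (t, v) = 0 := fun t v h => by
    simp [hu, hJ, hτ, h]
  filter_upwards [eventually_fderiv_small hDo huD (t₀ := t₀) hWo hBc hBW
    (fun v hv => ⟨⟨mem_univ _, hv⟩, by simpa [hJ, hτ] using hv.2.2⟩)
    (fun v hv => by simp [hu, hJ, hτ]) hL] with t ht
  set g : StdSpace n → StdSpace n := fun v => if v ∈ W then u (t, v) else 0 with hg
  have hgB : ∀ v ∉ B, g v = 0 := by
    intro v hv
    by_cases hvW : v ∈ W
    · simp [hg, hvW, hu0 t v (hsB v hvW.1 hv)]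
    · simp [hg, hvW]
  have hgW : ∀ v ∈ B, g =ᶠ[𝓝 v] fun w => u (t, w) := fun v hv => by
    filter_upwards [hWo.mem_nhds (hBW hv)] with w hw using if_pos hw
  have hg0 : ∀ v ∉ B, g =ᶠ[𝓝 v] fun _ => 0 := fun v hv => by
    filter_upwards [hBc.isClosed.isOpen_compl.mem_nhds hv] with w hw using hgB w hw
  have hgc : ContDiff ℝ ∞ g := by
    refine contDiff_iff_contDiffAt.2 fun v => ?_
    by_cases hv : v ∈ B
    · refine ContDiffAt.congr_of_eventuallyEq ?_ (hgW v hv)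
      exact ContDiffAt.comp v (huD.contDiffAt (hDo.mem_nhds (ht v hv).1))
        (contDiffAt_const.prodMk contDiffAt_id)
    · exact contDiffAt_const.congr_of_eventuallyEq (hg0 v hv)
  have hglip : ∀ v w, ‖g v - g w‖ ≤ L * ‖v - w‖ := by
    intro v w
    refine convex_univ.norm_image_sub_le_of_norm_fderiv_le (𝕜 := ℝ)
      (fun x _ => hgc.differentiable (by simp) x) (fun x _ => ?_) (mem_univ w) (mem_univ v)
    by_cases hx : x ∈ B
    · rw [(hgW x hx).fderiv_eq]
      exact (ht x hx).2
    · rw [(hg0 x hx).fderiv_eq]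
      simpa using hL.le
  obtain ⟨e, he, hered⟩ := hsmall g hgc hgB hglip
  obtain ⟨e', he', he'r⟩ := hered.chartConj hψ hB'c (fun v hv => (hB'O hv).1)
  have hform : ∀ x ∈ P, e' x = ψ.symm (ψ x + (ψ (ι (t₀ + (t - t₀) * s x) (r x)) -
      ψ (ι t₀ (r x)))) := by
    intro x hx
    have hxW : ψ x ∈ W := ⟨ψ.map_source (hPψ hx), by simpa [ψ.left_inv (hPψ hx)] using hx⟩
    rw [he', chartConj_of_mem (hPψ hx), he]
    simp only [hg, hxW, if_true, hu, hJ, hτ, ψ.left_inv (hPψ hx)]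
  have hfix : ∀ x, s x = 0 → e' x = x := by
    intro x hx
    rw [he']
    by_cases hxψ : x ∈ ψ.source
    · refine chartConj_of_apply_eq ?_
      rw [he, add_eq_left]
      by_cases hxW : ψ x ∈ W
      · simp only [hg, hxW, if_true]
        exact hu0 _ _ (by rwa [ψ.left_inv hxψ])
      · simp [hg, hxW]
    · exact chartConj_of_notMem hxψ
  refine ⟨e', ⟨ψ.symm '' B', hB'c.image_of_continuousOn (ψ.continuousOn_symm.mono
    fun v hv => (hB'O hv).1), ?_, he'r⟩, hform, hfix, ?_⟩
  · rintro _ ⟨v, hv, rfl⟩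
    exact (hB'O hv).2
  · intro p'
    by_cases h0 : s (ι t₀ p') = 0
    · rw [hfix _ h0, h0, mul_zero, add_zero]
    · have hts : ι t₀ p' ∈ tsupport s := subset_tsupport s h0
      have hxP := hsP hts
      have hx := (ht (ψ (ι t₀ p')) ⟨_, hts, rfl⟩).1.2
      simp only [mem_preimage, hJ, hτ, ψ.left_inv (hPψ hxP), hPre p' hxP] at hx
      rw [hform _ hxP, hPre p' hxP, add_sub_cancel, ψ.left_inv hx]

end Patches

section Isotopies

variable {n k d : ℕ} {N T : Type*} [TopologicalSpace N] [ChartedSpace (Euc k) N]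
  [TopologicalSpace T] [ChartedSpace (Euc d) T]

lemma IsProperEmbedding.isCompact_preimage {e : N → T} (he : IsProperEmbedding k d e) {K : Set T}
    (hK : IsCompact K) : IsCompact (e ⁻¹' K) := by
  rw [he.embedding.isEmbedding.isInducing.isCompact_iff, image_preimage_eq_inter_range, inter_comm]
  exact he.proper K hK

/-- The isotopy `ι`, run from time `t₀` on for a short time cut off by the function `s` on the
ambient manifold, is induced by null paths supported in a compact subset of `O`. -/
def CutoffReachable (α : CovectorField (𝓡 d) T) (O : Set T) (ι : ℝ → N → T) (t₀ : ℝ)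
    (s : T → ℝ) : Prop :=
  ContMDiff (𝓡 d) 𝓘(ℝ, ℝ) ∞ s ∧ IsCompact (tsupport s) ∧
    ∀ᶠ t in 𝓝 t₀, ∃ g : T ≃ₘ⟮𝓡 d, 𝓡 d⟯ T, (∃ K, IsCompact K ∧ K ⊆ O ∧ NullReachable α K g) ∧
      ∀ p, g (ι t₀ p) = ι (t₀ + (t - t₀) * s (ι t₀ p)) p

variable {α : CovectorField (𝓡 d) T} {O : Set T} {ι : ℝ → N → T} {t₀ : ℝ}

lemma CutoffReachable.zero : CutoffReachable α O ι t₀ (fun _ => 0) := by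
  have h0 : tsupport (fun _ : T => (0 : ℝ)) = ∅ := by
    rw [tsupport_eq_empty_iff]; rfl
  refine ⟨contMDiff_const, by rw [h0]; exact isCompact_empty, Filter.Eventually.of_forall fun t =>
    ⟨Diffeomorph.refl _ _ _, ⟨∅, isCompact_empty, empty_subset _, .refl⟩, fun p => by simp⟩⟩

variable [T2Space T] [IsManifold (𝓡 d) ∞ T] [SigmaCompactSpace T]

lemma exists_contMDiff_bump {K P : Set T} (hK : IsCompact K) (hP : IsOpen P) (hKP : K ⊆ P) :
    ∃ (V K' : Set T) (b : T → ℝ), IsOpen V ∧ K ⊆ V ∧ IsCompact K' ∧ K' ⊆ P ∧ V ⊆ K' ∧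
      ContMDiff (𝓡 d) 𝓘(ℝ, ℝ) ∞ b ∧ (∀ x ∈ V, b x = 1) ∧ tsupport b ⊆ K' ∧
      ∀ x, b x ∈ Icc (0 : ℝ) 1 := by
  have : LocallyCompactSpace T := ChartedSpace.locallyCompactSpace (Euc d) T
  obtain ⟨K₂, hK₂, hKK₂, hK₂P⟩ := exists_compact_between hK hP hKP
  obtain ⟨K₃, hK₃, hK₂₃, hK₃P⟩ := exists_compact_between hK₂ hP hK₂P
  obtain ⟨b, h0, h1, h2⟩ := exists_contMDiffMap_zero_one_of_isClosed (n := (⊤ : ℕ∞)) (𝓡 d)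
    (isOpen_interior (s := K₃)).isClosed_compl hK₂.isClosed (disjoint_compl_left_iff_subset.2 hK₂₃)
  refine ⟨interior K₂, K₃, b, isOpen_interior, hKK₂, hK₃, hK₃P,
    interior_subset.trans (hK₂₃.trans interior_subset), b.contMDiff,
    fun x hx => h1 (interior_subset hx), ?_, h2⟩
  refine closure_minimal (fun x hx => ?_) hK₃.isClosed
  by_contra h
  exact hx (h0 fun h' => h (interior_subset h'))

/-- Extending the cut-off function by a function which is supported in a patch. -/
lemma CutoffReachable.step
    (hι : ContMDiff (𝓘(ℝ, ℝ).prod (𝓡 k)) (𝓡 d) ∞ (fun q : ℝ × N => ι q.1 q.2))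
    (hemb : IsProperEmbedding k d (ι t₀)) {s s₁ : T → ℝ} (hs : CutoffReachable α O ι t₀ s)
    (hs₁ : ContMDiff (𝓡 d) 𝓘(ℝ, ℝ) ∞ s₁) (hs₁c : IsCompact (tsupport s₁)) {P : Set T}
    (hP : IsOpen P) (hs₁P : tsupport s₁ ⊆ P) {A : ℝ × T → T} (hA0 : ∀ x ∈ P, A (t₀, x) = x)
    (hAc : ∀ x ∈ P, ContinuousAt A (t₀, x))
    (hA : ∀ s : T → ℝ, ContMDiff (𝓡 d) 𝓘(ℝ, ℝ) ∞ s → IsCompact (tsupport s) → tsupport s ⊆ P →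
        ∀ᶠ t in 𝓝 t₀, ∃ g : T ≃ₘ⟮𝓡 d, 𝓡 d⟯ T,
          (∃ K, IsCompact K ∧ K ⊆ O ∧ NullReachable α K g) ∧
          (∀ x ∈ P, g x = A (t₀ + (t - t₀) * s x, x)) ∧ (∀ x, s x = 0 → g x = x) ∧
          ∀ p', g (ι t₀ p') = ι (t₀ + (t - t₀) * s (ι t₀ p')) p') :
    CutoffReachable α O ι t₀ (fun x => s x + (1 - s x) * s₁ x) := by
  obtain ⟨hsm, hsc, hsr⟩ := hs
  obtain ⟨V, K', b, hVo, hV, hK', hK'P, hVK', hb, hb1, hbK', -⟩ := exists_contMDiff_bump (d := d) hs₁c hP hs₁P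
  have hs' : ContMDiff (𝓡 d) 𝓘(ℝ, ℝ) ∞ (fun x => s x + (1 - s x) * s₁ x) :=
    hsm.add ((contMDiff_const.sub hsm).mul hs₁)
  have hsupp : ∀ f : T → ℝ, tsupport (fun x => b x * f x) ⊆ tsupport b := fun f =>
    closure_mono (Function.support_mul_subset_left b f)
  have hbc : IsCompact (tsupport b) := hK'.of_isClosed_subset (isClosed_tsupport b) hbK'
  have hprod : ∀ f : T → ℝ, IsCompact (tsupport fun x => b x * f x) ∧
      tsupport (fun x => b x * f x) ⊆ P := fun f =>
    ⟨hbc.of_isClosed_subset (isClosed_tsupport _) (hsupp f), (hsupp f).trans (hbK'.trans hK'P)⟩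
  have h₁ := hA (fun x => b x * s x) (hb.mul hsm) (hprod s).1 (hprod s).2
  have h₂ := hA (fun x => b x * (s x + (1 - s x) * s₁ x)) (hb.mul hs') (hprod _).1 (hprod _).2
  have hKp : IsCompact (ι t₀ ⁻¹' ((K' ∪ tsupport s) \ V)) :=
    hemb.isCompact_preimage ((hK'.union hsc).diff hVo)
  have hne : ∀ᶠ t in 𝓝 t₀, ∀ q ∈ (ι t₀ ⁻¹' ((K' ∪ tsupport s) \ V)) ×ˢ tsupport s₁,
      ι (t₀ + (t - t₀) * s (ι t₀ q.1)) q.1 ≠ A (t₀ + (t - t₀) * (b q.2 * s q.2), q.2) := by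
    refine (hKp.prod hs₁c).eventually_forall_of_forall_eventually ?_
    rintro ⟨p, x⟩ ⟨hp, hx⟩
    have hι₀ : Continuous (ι t₀) := hemb.embedding.isEmbedding.continuous
    have c1 : ContinuousAt (fun q : ℝ × N × T =>
        ι (t₀ + (q.1 - t₀) * s (ι t₀ q.2.1)) q.2.1) (t₀, p, x) := by
      have h : Continuous fun q : ℝ × N × T => s (ι t₀ q.2.1) :=
        hsm.continuous.comp (hι₀.comp (continuous_fst.comp continuous_snd))
      exact (hι.continuous.comp ((continuous_const.add ((continuous_fst.sub
        continuous_const).mul h)).prodMk (continuous_fst.comp continuous_snd))).continuousAt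
    have c2 : ContinuousAt (fun q : ℝ × N × T =>
        A (t₀ + (q.1 - t₀) * (b q.2.2 * s q.2.2), q.2.2)) (t₀, p, x) := by
      have h : Continuous fun q : ℝ × N × T => b q.2.2 * s q.2.2 :=
        (hb.continuous.mul hsm.continuous).comp (continuous_snd.comp continuous_snd)
      have h' : Continuous fun q : ℝ × N × T =>
          (t₀ + (q.1 - t₀) * (b q.2.2 * s q.2.2), q.2.2) :=
        (continuous_const.add ((continuous_fst.sub continuous_const).mul h)).prodMk
          (continuous_snd.comp continuous_snd)
      refine ContinuousAt.comp (x := (t₀, p, x)) (g := A) ?_ h'.continuousAt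
      simpa using hAc x (hs₁P hx)
    refine (c1.ne_iff_eventually_ne c2).1 ?_
    simp only [sub_self, zero_mul, add_zero, hA0 x (hs₁P hx)]
    have hpV : ι t₀ p ∉ V := hp.2
    intro h
    exact hpV (h ▸ hV hx)
  refine ⟨hs', ?_, ?_⟩
  · refine (hsc.union hs₁c).of_isClosed_subset (isClosed_tsupport _) ?_
    refine closure_minimal (fun x hx => ?_) ((isClosed_tsupport _).union (isClosed_tsupport _))
    by_contra h
    rw [mem_union, not_or] at h
    exact hx (by simp [image_eq_zero_of_notMem_tsupport h.1, image_eq_zero_of_notMem_tsupport h.2])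
  filter_upwards [hsr, h₁, h₂, hne] with t ⟨g, ⟨K₁, hK₁, hK₁O, hg⟩, hge⟩
    ⟨e, ⟨K₂, hK₂, hK₂O, he⟩, heA, he0, hee⟩ ⟨e', ⟨K₃, hK₃, hK₃O, he'⟩, he'A, he'0, he'e⟩ hne
  refine ⟨g.trans (e.symm.trans e'), ⟨K₁ ∪ K₂ ∪ K₃, (hK₁.union hK₂).union hK₃,
    union_subset (union_subset hK₁O hK₂O) hK₃O, ?_⟩, fun p => ?_⟩
  · exact (hg.mono (subset_union_left.trans subset_union_left)).trans
      ((he.symm.mono (subset_union_right.trans subset_union_left)).trans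
        (he'.mono subset_union_right))
  simp only [Diffeomorph.coe_trans, Function.comp_apply]
  by_cases hpV : ι t₀ p ∈ V
  · have h : e (ι t₀ p) = g (ι t₀ p) := by
      rw [hee, hge, hb1 _ hpV, one_mul]
    rw [← h, e.symm_apply_apply, he'e, hb1 _ hpV, one_mul]
  · have hs₁0 : s₁ (ι t₀ p) = 0 := image_eq_zero_of_notMem_tsupport fun h => hpV (hV h)
    rw [hs₁0, mul_zero, add_zero, ← hge]
    obtain ⟨x, hx⟩ : ∃ x, e x = g (ι t₀ p) := e.surjective _
    rw [← hx, e.symm_apply_apply]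
    by_cases hxs : s₁ x = 0
    · by_cases hxP : x ∈ P
      · rw [he'A x hxP, heA x hxP, hxs, mul_zero, add_zero]
      · have hbx : b x = 0 := image_eq_zero_of_notMem_tsupport fun h => hxP (hK'P (hbK' h))
        rw [he'0 x (by simp [hbx]), he0 x (by simp [hbx])]
    · exfalso
      have hxt : x ∈ tsupport s₁ := subset_tsupport _ hxs
      have hmem : ι t₀ p ∈ K' ∪ tsupport s := by
        by_contra h
        rw [mem_union, not_or] at h
        have hs0 : s (ι t₀ p) = 0 := image_eq_zero_of_notMem_tsupport h.2
        have h1 : e (ι t₀ p) = e x := by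
          rw [hx, hge, he0 _ (by simp [hs0]), hs0, mul_zero, add_zero]
        exact hpV (e.injective_coe h1 ▸ hV hxt)
      refine hne (p, x) ⟨⟨hmem, hpV⟩, hxt⟩ ?_
      rw [← hge, ← hx, heA x (hs₁P hxt)]

lemma exists_cutoffReachable (hn : 1 ≤ n)
    (hα : ∀ x : T, ∃ ψ : OpenPartialHomeomorph T (StdSpace n), IsDarbouxChart n α ψ ∧ x ∈ ψ.source)
    (hι : ContMDiff (𝓘(ℝ, ℝ).prod (𝓡 k)) (𝓡 d) ∞ (fun q : ℝ × N => ι q.1 q.2))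
    (hemb : IsProperEmbedding k d (ι t₀)) {D : Set N} (hD : IsCompact D) (hO : IsOpen O)
    (hDO : ∀ p ∈ D, ι t₀ p ∈ O) :
    ∃ s, CutoffReachable α O ι t₀ s ∧ ∀ p ∈ D, s (ι t₀ p) = 1 := by
  have hex : ∀ p ∈ D, ∃ V : Set T, IsOpen V ∧ ι t₀ p ∈ V ∧ ∀ s, CutoffReachable α O ι t₀ s →
      ∃ s', CutoffReachable α O ι t₀ s' ∧ (∀ x ∈ V, s' x = 1) ∧ ∀ x, s x = 1 → s' x = 1 := by
    intro p hp
    obtain ⟨ψ, hψ, hpψ⟩ := hα (ι t₀ p)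
    obtain ⟨P, hP, hpP, hPO, A, hA0, hAc, hA⟩ := exists_patch hn hψ hι hemb.embedding hO
      (hDO p hp) hpψ
    obtain ⟨V, K', b, hVo, hV, hK', hK'P, hVK', hb, hb1, hbK', -⟩ :=
      exists_contMDiff_bump (d := d) (isCompact_singleton (x := ι t₀ p)) hP (singleton_subset_iff.2 hpP)
    refine ⟨V, hVo, singleton_subset_iff.1 hV, fun s hs => ⟨_, hs.step hι hemb hb
      (hK'.of_isClosed_subset (isClosed_tsupport b) hbK') hP (hbK'.trans hK'P) hA0 hAc hA,
      fun x hx => ?_, fun x hx => ?_⟩⟩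
    · rw [hb1 x hx]; ring
    · rw [hx]; ring
  choose! V hVo hV hstep using hex
  have hcov := hD.elim_nhds_subcover (fun p => ι t₀ ⁻¹' V p) fun p hp =>
    (hemb.embedding.isEmbedding.continuous.isOpen_preimage _ (hVo p hp)).mem_nhds (hV p hp)
  obtain ⟨F, hF, hDF⟩ := hcov
  have hind : ∀ G : Finset N, (∀ p ∈ G, p ∈ D) → ∃ s, CutoffReachable α O ι t₀ s ∧
      ∀ p ∈ G, ∀ x ∈ V p, s x = 1 := by
    classical
    intro G
    induction G using Finset.induction_on with
    | empty => exact fun _ => ⟨_, CutoffReachable.zero, by simp⟩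
    | insert q G hq ih =>
      intro hG
      obtain ⟨s, hs, hs1⟩ := ih fun p hp => hG p (Finset.mem_insert_of_mem hp)
      obtain ⟨s', hs', h1, h2⟩ := hstep q (hG q (Finset.mem_insert_self _ _)) s hs
      refine ⟨s', hs', fun p hp x hx => ?_⟩
      rcases Finset.mem_insert.1 hp with rfl | hp
      · exact h1 x hx
      · exact h2 x (hs1 p hp x hx)
  obtain ⟨s, hs, hs1⟩ := hind F hF
  refine ⟨s, hs, fun p hp => ?_⟩
  obtain ⟨q, hq, hpq⟩ := mem_iUnion₂.1 (hDF hp)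
  exact hs1 q hq _ hpq

/-- Isotopy extension by null paths: over a compact set of points, and at all points which the
isotopy does not move, a smooth isotopy of proper embeddings is induced by null paths. -/
theorem exists_nullReachable_of_isotopy (hn : 1 ≤ n)
    (hα : ∀ x : T, ∃ ψ : OpenPartialHomeomorph T (StdSpace n), IsDarbouxChart n α ψ ∧ x ∈ ψ.source)
    (hι : ContMDiff (𝓘(ℝ, ℝ).prod (𝓡 k)) (𝓡 d) ∞ (fun q : ℝ × N => ι q.1 q.2))
    (hemb : ∀ t, IsProperEmbedding k d (ι t)) {D : Set N} (hD : IsCompact D) (hO : IsOpen O)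
    (hDO : ∀ t, ∀ p ∈ D, ι t p ∈ O) (a b : ℝ) :
    ∃ g : T ≃ₘ⟮𝓡 d, 𝓡 d⟯ T, (∃ K, IsCompact K ∧ K ⊆ O ∧ NullReachable α K g) ∧
      ∀ p, (p ∈ D ∨ ∀ t, ι t p = ι a p) → g (ι a p) = ι b p := by
  have key := (isPreconnected_univ (α := ℝ)).induction₂ (fun a b =>
    ∃ g : T ≃ₘ⟮𝓡 d, 𝓡 d⟯ T, (∃ K, IsCompact K ∧ K ⊆ O ∧ NullReachable α K g) ∧
      ∀ p, (p ∈ D ∨ ∀ s t, ι t p = ι s p) → g (ι a p) = ι b p) ?_ ?_ ?_ (mem_univ a) (mem_univ b)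
  · obtain ⟨g, h1, h2⟩ := key
    exact ⟨g, h1, fun p hp => h2 p (hp.imp_right fun h s t => (h t).trans (h s).symm)⟩
  · intro t₀ _
    rw [nhdsWithin_univ]
    obtain ⟨s, ⟨-, -, hs⟩, hs1⟩ := exists_cutoffReachable hn hα hι (hemb t₀) hD hO (hDO t₀)
    filter_upwards [hs] with t ⟨g, hg, hgp⟩
    refine ⟨g, hg, fun p hp => ?_⟩
    rw [hgp]
    rcases hp with hp | hp
    · rw [hs1 p hp, mul_one, add_sub_cancel]
    · exact hp _ _
  · rintro a b c - - - ⟨g, ⟨K, hK, hKO, hg⟩, hgp⟩ ⟨g', ⟨K', hK', hK'O, hg'⟩, hgp'⟩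
    refine ⟨g.trans g', ⟨K ∪ K', hK.union hK', union_subset hKO hK'O,
      (hg.mono subset_union_left).trans (hg'.mono subset_union_right)⟩, fun p hp => ?_⟩
    simp [hgp p hp, hgp' p hp]
  · rintro a b - - ⟨g, ⟨K, hK, hKO, hg⟩, hgp⟩
    refine ⟨g.symm, ⟨K, hK, hKO, hg.symm⟩, fun p hp => ?_⟩
    rw [← hgp p hp, g.symm_apply_apply]

end Isotopies

section Telescope

variable {E : Type*} [NormedAddCommGroup E] [NormedSpace ℝ E]
  {H : Type*} [TopologicalSpace H] {I : ModelWithCorners ℝ E H}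
  {M : Type*} [TopologicalSpace M] [ChartedSpace H M] {α : CovectorField I M}

/-- The composition `F 0 ∘ F 1 ∘ ⋯ ∘ F (k - 1)` of paths of diffeomorphisms. -/
def pathProd (F : ℕ → ℝ → M ≃ₘ⟮I, I⟯ M) : ℕ → ℝ → M ≃ₘ⟮I, I⟯ M
  | 0, _ => Diffeomorph.refl I M ∞
  | k + 1, t => (F k t).trans (pathProd F k t)

/-- The affine function which maps `[1 / (j + 2), 1 / (j + 1)]` onto `[0, 1]`. -/
def timeSlot (j : ℕ) (t : ℝ) : ℝ := (j + 1) * ((j + 2) * t - 1)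

lemma timeSlot_nonpos {j k : ℕ} (hjk : j < k) {t : ℝ} (ht : t ≤ 1 / (k + 1)) :
    timeSlot j t ≤ 0 := by
  have h1 : (j : ℝ) + 1 ≤ k := by exact_mod_cast hjk
  rw [le_div_iff₀ (by positivity)] at ht
  have h2 : ((j : ℝ) + 2) * t ≤ 1 := by
    rcases le_total t 0 with h | h
    · nlinarith [mul_nonpos_of_nonneg_of_nonpos (show (0 : ℝ) ≤ j + 2 by positivity) h]
    · nlinarith
  exact mul_nonpos_of_nonneg_of_nonpos (by positivity) (by linarith)

lemma one_le_timeSlot {j k : ℕ} (hjk : j ≤ k) {t : ℝ} (ht : 1 / ((j : ℝ) + 1) ≤ t) :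
    1 ≤ timeSlot k t := by
  have h1 : (j : ℝ) ≤ k := by exact_mod_cast hjk
  rw [div_le_iff₀ (by positivity)] at ht
  have h0 : 0 ≤ t := by
    by_contra h
    nlinarith [not_le.1 h, show (0 : ℝ) ≤ j + 1 by positivity]
  have h2 : 1 ≤ t * (k + 1) := by nlinarith
  unfold timeSlot
  nlinarith

lemma lt_of_timeSlot_lt {j : ℕ} {t : ℝ} (h : timeSlot j t < 1) : t < 1 / (j + 1) := by
  by_contra h'
  exact absurd (one_le_timeSlot le_rfl (not_lt.1 h')) (not_le.2 h)

lemma contDiff_timeSlot (j : ℕ) : ContDiff ℝ ∞ (timeSlot j) :=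
  contDiff_const.mul ((contDiff_const.mul contDiff_id).sub contDiff_const)

/-- An infinite composition of null paths with locally finite supports is a null path. -/
theorem nullReachable_of_telescope {r : ℕ → M ≃ₘ⟮I, I⟯ M} {U : ℕ → Set M}
    (hUo : ∀ j, IsOpen (U j)) (hU : Monotone U) (hUx : ∀ x, ∃ j, x ∈ U j)
    (hr : ∀ j, ∀ x ∈ U j, r j x = x)
    (hstep : ∀ j, ∃ K, Disjoint K (U j) ∧ NullReachable α K ((r (j + 1)).symm.trans (r j))) :
    NullReachable α univ (r 0) := by
  choose K hKU hK using hstep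
  choose F hF hF0 hF1 hFK using fun j => (hK j).exists_path
  set G : ℕ → ℝ → M ≃ₘ⟮I, I⟯ M := fun j t => F j (timeSlot j t) with hG
  have hGn : ∀ j, IsNullPath α (G j) := fun j => (hF j).reparam (contDiff_timeSlot j)
  have hGr : ∀ j t, timeSlot j t ≤ 0 → G j t = Diffeomorph.refl I M ∞ := fun j t h =>
    hF0 j _ (h.trans (by norm_num))
  have hG1 : ∀ j t, 1 ≤ timeSlot j t → G j t = (r (j + 1)).symm.trans (r j) := fun j t h =>
    hF1 j _ (le_trans (by norm_num) h)
  set P := pathProd G with hP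
  have hPr : ∀ (k : ℕ) (t : ℝ), t ≤ 1 / ((k : ℝ) + 1) → P k t = Diffeomorph.refl I M ∞ := by
    intro k
    induction k with
    | zero => exact fun t _ => rfl
    | succ k ih =>
      intro t ht
      have h1 : G k t = Diffeomorph.refl I M ∞ := hGr k t (timeSlot_nonpos (Nat.lt_succ_self k) ht)
      have h2 : P k t = Diffeomorph.refl I M ∞ := by
        refine ih t (ht.trans ?_)
        push_cast
        exact one_div_le_one_div_of_le (by positivity) (by linarith)
      change (G k t).trans (P k t) = _
      rw [h1, h2]
      rfl
  have hPn : ∀ k, IsNullPath α (P k) := by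
    intro k
    induction k with
    | zero => exact IsNullPath.const _
    | succ k ih =>
      refine ih.comp (hGn k) fun t => ?_
      rcases lt_or_ge (2 / 3) (timeSlot k t) with h | h
      · right
        filter_upwards [(contDiff_timeSlot k).continuous.continuousAt.preimage_mem_nhds
          (Ioi_mem_nhds h)] with s hs
        exact (hF1 k _ (le_of_lt hs)).trans (hF1 k _ h.le).symm
      · left
        have h' := lt_of_timeSlot_lt (lt_of_le_of_lt h (by norm_num))
        filter_upwards [Iio_mem_nhds h'] with s hs
        exact hPr k s (le_of_lt hs)
  have hPU : ∀ m k, m ≤ k → ∀ t, ∀ x ∈ U m, P k t x = P m t x := by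
    intro m k hmk t x hx
    induction k, hmk using Nat.le_induction with
    | base => rfl
    | succ k hmk ih =>
      have h1 : G k t x = x := hFK k _ x fun h => (hKU k).le_bot ⟨h, hU hmk hx⟩
      change P k t (G k t x) = _
      rw [h1, ih]
  have hPJ : ∀ J k : ℕ, J ≤ k → ∀ t : ℝ, 1 / ((J : ℝ) + 1) ≤ t → ∀ x, P k t (r k x) = P J t (r J x) := by
    intro J k hJk t ht x
    induction k, hJk using Nat.le_induction with
    | base => rfl
    | succ k hJk ih =>
      have h1 : G k t (r (k + 1) x) = r k x := by
        rw [hG1 k t (one_le_timeSlot hJk ht)]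
        simp
      change P k t (G k t (r (k + 1) x)) = _
      rw [h1, ih]
  have hex : ∀ t, ∃ h : M ≃ₘ⟮I, I⟯ M, ∀ m, ∀ x ∈ U m, h x = P m t x := by
    intro t
    rcases le_or_gt t 0 with ht | ht
    · refine ⟨Diffeomorph.refl I M ∞, fun m x _ => ?_⟩
      rw [hPr m t (ht.trans (by positivity))]
    · obtain ⟨J, hJ⟩ := exists_nat_one_div_lt ht
      refine ⟨(r J).trans (P J t), fun m x hx => ?_⟩
      have h1 := hPJ J (max m J) (le_max_right _ _) t hJ.le x
      rw [hr _ x (hU (le_max_left m J) hx), hPU m _ (le_max_left _ _) t x hx] at h1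
      exact h1.symm
  choose h hh using hex
  refine ⟨h, ⟨?_, ?_⟩, ?_, ?_, fun t x hx => absurd (mem_univ x) hx⟩
  · rintro ⟨t, x⟩
    obtain ⟨m, hm⟩ := hUx x
    refine ((hPn m).smooth (t, x)).congr_of_eventuallyEq ?_
    filter_upwards [continuous_snd.continuousAt.preimage_mem_nhds
      ((hUo m).mem_nhds hm : U m ∈ 𝓝 ((t, x) : ℝ × M).2)] with q hq
    exact hh q.1 m q.2 hq
  · intro t x
    obtain ⟨m, hm⟩ := hUx x
    have h1 : (fun s => h s x) = fun s => P m s x := funext fun s => hh s m x hm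
    have h2 := (hPn m).null t x
    have key : ∀ γ : ℝ → M, γ = (fun s => P m s x) →
        α (γ t) (mfderiv 𝓘(ℝ, ℝ) I γ t (1 : ℝ)) = 0 := by
      rintro γ rfl
      exact h2
    exact key _ h1
  · ext x
    obtain ⟨m, hm⟩ := hUx x
    rw [hh 0 m x hm, hPr m 0 (by positivity)]
  · ext x
    obtain ⟨m, hm⟩ := hUx x
    have h1 := hPJ 0 m (Nat.zero_le m) 1 (by norm_num) x
    rw [hr m x hm] at h1
    rw [hh 1 m x hm, h1]
    rfl

end Telescope

section Embeddings

variable {k d : ℕ} {N T : Type*} [TopologicalSpace N] [ChartedSpace (Euc k) N]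
  [TopologicalSpace T] [ChartedSpace (Euc d) T] [IsManifold (𝓡 d) ∞ T]

lemma IsProperEmbedding.diffeomorph_comp {j : N → T} (hj : IsProperEmbedding k d j)
    (g : T ≃ₘ⟮𝓡 d, 𝓡 d⟯ T) : IsProperEmbedding k d (g ∘ j) where
  embedding := by
    refine ⟨?_, g.toHomeomorph.isEmbedding.comp hj.embedding.isEmbedding⟩
    obtain ⟨F, _, _, hF⟩ := hj.embedding.isImmersion
    refine ⟨F, inferInstance, inferInstance, fun p => ?_⟩
    have h := hF p
    set c : OpenPartialHomeomorph T (Euc d) :=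
      g.symm.toHomeomorph.toOpenPartialHomeomorph.trans h.codChart with hc
    have hsrc : c.source = g.symm ⁻¹' h.codChart.source := by
      rw [hc, OpenPartialHomeomorph.trans_source]
      simp
    refine IsImmersionAtOfComplement.mk_of_charts h.equiv h.domChart c h.mem_domChart_source ?_
      h.domChart_mem_maximalAtlas ?_ ?_ ?_
    · rw [hsrc, mem_preimage, Function.comp_apply, g.symm_apply_apply]
      exact h.mem_codChart_source
    · refine OpenPartialHomeomorph.mem_maximalAtlas_of_contMDiffOn (I := 𝓡 d) (M := T) (n := ∞) (φ := c) ?_ ?_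
      · have h1 : ContMDiffOn (𝓡 d) (𝓡 d) ∞ h.codChart h.codChart.source :=
          contMDiffOn_of_mem_maximalAtlas h.codChart_mem_maximalAtlas
        rw [hsrc]
        exact h1.comp g.symm.contMDiff.contMDiffOn Subset.rfl
      · have htgt : c.target ⊆ h.codChart.target := by
          rw [hc, OpenPartialHomeomorph.trans_target]
          exact inter_subset_left
        exact g.contMDiff.comp_contMDiffOn
          ((contMDiffOn_symm_of_mem_maximalAtlas h.codChart_mem_maximalAtlas).mono htgt)
    · intro q hq
      rw [mem_preimage, hsrc, mem_preimage, Function.comp_apply, g.symm_apply_apply]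
      exact h.source_subset_preimage_source hq
    · intro v hv
      have h1 := h.writtenInCharts hv
      simp only [Function.comp_apply] at h1 ⊢
      rw [← h1]
      simp [hc]
  proper K hK := by
    have : range (g ∘ j) ∩ K = g '' (range j ∩ g.symm '' K) := by
      rw [image_inter g.injective_coe, Diffeomorph.image_symm_image, range_comp]
    rw [this]
    exact (hj.proper _ (hK.image g.symm.continuous)).image g.continuous

lemma isProperEmbedding_diffeomorph (g : T ≃ₘ⟮𝓡 d, 𝓡 d⟯ T) : IsProperEmbedding d d g := by
  have h : IsProperEmbedding d d (id : T → T) :=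
    ⟨IsSmoothEmbedding.id, fun K hK => by simpa using hK⟩
  exact h.diffeomorph_comp g

end Embeddings

section PositivePaths

variable {E : Type*} [NormedAddCommGroup E] [NormedSpace ℝ E]
  {H : Type*} [TopologicalSpace H] {I : ModelWithCorners ℝ E H}
  {M : Type*} [TopologicalSpace M] [ChartedSpace H M]

lemma mfderiv_path_comp {A : ℝ → M → M}
    (hA : ContMDiff (𝓘(ℝ, ℝ).prod I) I ∞ (fun q : ℝ × M => A q.1 q.2)) {γ : ℝ → M} {t : ℝ}
    (hγ : MDifferentiableAt 𝓘(ℝ, ℝ) I γ t) :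
    mfderiv 𝓘(ℝ, ℝ) I (fun s => A s (γ s)) t (1 : ℝ) =
      mfderiv 𝓘(ℝ, ℝ) I (fun s => A s (γ t)) t (1 : ℝ) +
        mfderiv I I (A t) (γ t) (mfderiv 𝓘(ℝ, ℝ) I γ t (1 : ℝ)) := by
  have hAd : MDifferentiableAt (𝓘(ℝ, ℝ).prod I) I (fun q : ℝ × M => A q.1 q.2) (t, γ t) :=
    hA.mdifferentiable (by simp) _
  have hid : MDifferentiableAt 𝓘(ℝ, ℝ) 𝓘(ℝ, ℝ) (fun s : ℝ => s) t := mdifferentiableAt_id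
  have h1 := mfderiv_comp (I := 𝓘(ℝ, ℝ)) (I' := 𝓘(ℝ, ℝ).prod I) (I'' := I) t hAd
    (hid.prodMk hγ)
  have h2 := mfderiv_prod_eq_add_apply
    (v := (((1 : ℝ), (mfderiv 𝓘(ℝ, ℝ) I γ t (1 : ℝ) : E)) : ℝ × E)) hAd
  have h3 : mfderiv 𝓘(ℝ, ℝ) (𝓘(ℝ, ℝ).prod I) (fun s : ℝ => (s, γ s)) t (1 : ℝ) =
      (((1 : ℝ), (mfderiv 𝓘(ℝ, ℝ) I γ t (1 : ℝ) : E)) : ℝ × E) := by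
    rw [MDifferentiableAt.mfderiv_prod hid hγ]
    have : mfderiv 𝓘(ℝ, ℝ) 𝓘(ℝ, ℝ) (fun s : ℝ => s) t = ContinuousLinearMap.id ℝ ℝ := mfderiv_id
    rw [this]
    rfl
  refine (congrArg (fun L => L (1 : ℝ)) h1).trans ?_
  refine Eq.trans (congrArg (mfderiv (𝓘(ℝ, ℝ).prod I) I (fun q : ℝ × M => A q.1 q.2) (t, γ t)) h3) ?_
  exact h2

/-- A smooth path of diffeomorphisms of `M`, with time in `ℝ`, which starts at the identity,
preserves the kernel of `α`, and all of whose orbits are positively transverse to it. -/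
structure IsPositivePath (α : CovectorField I M) (φ : ℝ → M ≃ₘ⟮I, I⟯ M) : Prop where
  smooth : ContMDiff (𝓘(ℝ, ℝ).prod I) I ∞ (fun q : ℝ × M => φ q.1 q.2)
  start : φ 0 = Diffeomorph.refl I M ∞
  preserves : ∀ (t : ℝ) (p : M) (v : TangentSpace I p),
    α p v = 0 → α (φ t p) (mfderiv I I (φ t) p v) = 0
  pos : ∀ (t : ℝ) (p : M), 0 < α (φ t p) (mfderiv 𝓘(ℝ, ℝ) I (fun s : ℝ => φ s p) t (1 : ℝ))

variable {α : CovectorField I M} {φ F : ℝ → M ≃ₘ⟮I, I⟯ M}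

lemma IsPositivePath.comp_isNullPath_pos (hφ : IsPositivePath α φ) (hF : IsNullPath α F) (t : ℝ)
    (p : M) :
    0 < α (φ t (F t p)) (mfderiv 𝓘(ℝ, ℝ) I (fun s : ℝ => φ s (F s p)) t (1 : ℝ)) := by
  have h := mfderiv_path_comp (A := fun t => φ t) hφ.smooth (γ := fun s => F s p) (t := t)
    ((contMDiff_orbit (F := fun t => F t) hF.smooth p).mdifferentiable (by simp) t)
  refine lt_of_lt_of_eq ?_ (congrArg (α (φ t (F t p))) h).symm
  refine lt_of_lt_of_eq ?_ ((α (φ t (F t p))).map_add _ _).symm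
  have h1 := hφ.preserves t (F t p) _ (hF.null t p)
  have h2 := hφ.pos t (F t p)
  exact lt_of_lt_of_eq h2 ((congrArg _ h1).trans (add_zero _)).symm

lemma IsPositivePath.reparam (hφ : IsPositivePath α φ) {c : ℝ} (hc : 0 < c) :
    IsPositivePath α (fun t => φ (c * t)) where
  smooth := hφ.smooth.comp (((contDiff_const.mul contDiff_id).contMDiff.comp
    contMDiff_fst).prodMk contMDiff_snd)
  start := by rw [mul_zero, hφ.start]
  preserves t := hφ.preserves (c * t)
  pos t p := by
    have h := mfderiv_reparam (γ := fun s => φ s p) (b := fun s => c * s) (t := t)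
      ((contMDiff_orbit (F := fun t => φ t) hφ.smooth p).mdifferentiable (by simp) (c * t))
      (differentiableAt_id.const_mul c)
    refine lt_of_lt_of_eq ?_ (congrArg (α (φ (c * t) p)) h).symm
    refine lt_of_lt_of_eq ?_ ((α (φ (c * t) p)).map_smul _ _).symm
    have h1 : deriv (fun s : ℝ => c * s) t = c := by
      simp
    rw [h1]
    exact mul_pos hc (hφ.pos (c * t) p)

end PositivePaths

section Isotopies

variable {k d : ℕ} {N T : Type*} [TopologicalSpace N] [ChartedSpace (Euc k) N]
  [TopologicalSpace T] [ChartedSpace (Euc d) T] {α : CovectorField (𝓡 d) T}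

lemma contMDiff_smoothTransition_of_Icc {κ : ℝ → N → T}
    (h : ContMDiffOn (𝓘(ℝ, ℝ).prod (𝓡 k)) (𝓡 d) ∞ (fun q : ℝ × N => κ q.1 q.2)
      (Icc (0 : ℝ) 1 ×ˢ univ)) :
    ContMDiff (𝓘(ℝ, ℝ).prod (𝓡 k)) (𝓡 d) ∞
      (fun q : ℝ × N => κ (Real.smoothTransition q.1) q.2) := by
  have h1 : ContMDiff (𝓘(ℝ, ℝ).prod (𝓡 k)) (𝓘(ℝ, ℝ).prod (𝓡 k)) ∞
      (fun q : ℝ × N => (Real.smoothTransition q.1, q.2)) :=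
    (Real.smoothTransition.contDiff.contMDiff.comp contMDiff_fst).prodMk contMDiff_snd
  exact h.comp_contMDiff h1 fun q => ⟨⟨Real.smoothTransition.nonneg _,
    Real.smoothTransition.le_one _⟩, mem_univ _⟩

lemma isotopyVelocity_eq {κ : ℝ → N → T} {p : N}
    (h : ContMDiff 𝓘(ℝ, ℝ) (𝓡 d) ∞ (fun s : ℝ => κ s p)) {t : ℝ} (ht : t ∈ Icc (0 : ℝ) 1) :
    isotopyVelocity κ t p = mfderiv 𝓘(ℝ, ℝ) (𝓡 d) (fun s : ℝ => κ s p) t (1 : ℝ) := by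
  unfold isotopyVelocity
  rw [mfderivWithin_eq_mfderiv ((uniqueDiffOn_Icc zero_lt_one).uniqueMDiffOn t ht)
    (h.mdifferentiable (by simp) t)]

variable [IsManifold (𝓡 d) ∞ T]

lemma isIsotopy_of_diffeomorph {j : N → T} (hj : IsProperEmbedding k d j)
    {P : ℝ → T ≃ₘ⟮𝓡 d, 𝓡 d⟯ T}
    (hP : ContMDiff (𝓘(ℝ, ℝ).prod (𝓡 d)) (𝓡 d) ∞ (fun q : ℝ × T => P q.1 q.2))
    (h0 : P 0 = Diffeomorph.refl (𝓡 d) T ∞) :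
    IsIsotopy k d (fun t p => P t (j p)) j (range (P 1 ∘ j)) where
  smooth := by
    have h1 : ContMDiff (𝓘(ℝ, ℝ).prod (𝓡 k)) (𝓘(ℝ, ℝ).prod (𝓡 d)) ∞
        (fun q : ℝ × N => (q.1, j q.2)) :=
      contMDiff_fst.prodMk (hj.embedding.contMDiff.comp contMDiff_snd)
    exact (hP.comp h1).contMDiffOn
  embedding t _ := hj.diffeomorph_comp (P t)
  start := by
    funext p
    simp only [h0]
    rfl
  finish := rfl

/-- A null path of diffeomorphisms moves a submanifold through a null isotopy. -/
lemma NullReachable.exists_isNullIsotopy [T2Space T] {K : Set T} {g : T ≃ₘ⟮𝓡 d, 𝓡 d⟯ T}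
    (hg : NullReachable α K g) {j : N → T} (hj : IsProperEmbedding k d j) :
    ∃ κ : ℝ → N → T, IsIsotopy k d κ j (range (g ∘ j)) ∧ IsNullIsotopy α κ ∧
      (IsCompact K → IsCompactlySupported κ) := by
  obtain ⟨F, hF, h0, h1, hK⟩ := hg
  refine ⟨fun t p => F t (j p), ?_, ?_, fun hKc => ⟨j ⁻¹' K, hj.isCompact_preimage hKc, ?_⟩⟩
  · rw [← h1]
    exact isIsotopy_of_diffeomorph hj hF.smooth h0
  · intro t ht p
    refine Eq.trans (congrArg (α (F t (j p))) (isotopyVelocity_eq (κ := fun t p => F t (j p))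
      (contMDiff_orbit (F := fun t => F t) hF.smooth (j p)) ht)) ?_
    exact hF.null t (j p)
  · intro p hp t _
    simp only
    rw [hK _ _ hp, hK _ _ hp]

lemma IsPositivePath.exists_isPositiveIsotopy {φ F : ℝ → T ≃ₘ⟮𝓡 d, 𝓡 d⟯ T}
    (hφ : IsPositivePath α φ) (hF : IsNullPath α F) (h0 : F 0 = Diffeomorph.refl (𝓡 d) T ∞)
    {j : N → T} (hj : IsProperEmbedding k d j) :
    IsIsotopy k d (fun t p => φ t (F t (j p))) j (range (fun p => φ 1 (F 1 (j p)))) ∧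
      IsPositiveIsotopy α (fun t p => φ t (F t (j p))) := by
  have hs : ContMDiff (𝓘(ℝ, ℝ).prod (𝓡 d)) (𝓡 d) ∞
      (fun q : ℝ × T => ((F q.1).trans (φ q.1)) q.2) :=
    hφ.smooth.comp (contMDiff_fst.prodMk hF.smooth)
  constructor
  · refine isIsotopy_of_diffeomorph (P := fun t => (F t).trans (φ t)) hj hs ?_
    rw [h0, hφ.start]
    rfl
  · intro t ht p
    refine lt_of_lt_of_eq ?_ (congrArg (α (φ t (F t (j p)))) (isotopyVelocity_eq
      (κ := fun t p => φ t (F t (j p)))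
      (contMDiff_orbit (F := fun t => (F t).trans (φ t)) hs (j p)) ht)).symm
    exact hφ.comp_isNullPath_pos hF t (j p)

/-- A diffeomorphism which is the endpoint of a positive path composed with a null path moves a
submanifold through a positive isotopy. -/
lemma IsPositivePath.exists_isotopy_of_nullReachable {φ : ℝ → T ≃ₘ⟮𝓡 d, 𝓡 d⟯ T}
    (hφ : IsPositivePath α φ) {f : T ≃ₘ⟮𝓡 d, 𝓡 d⟯ T} {K : Set T}
    (hf : NullReachable α K (f.trans (φ 1).symm)) {j : N → T} (hj : IsProperEmbedding k d j) :
    ∃ κ : ℝ → N → T, IsIsotopy k d κ j (range (f ∘ j)) ∧ IsPositiveIsotopy α κ := by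
  obtain ⟨F, hF, h0, h1, -⟩ := hf
  obtain ⟨h2, h3⟩ := hφ.exists_isPositiveIsotopy hF h0 hj
  refine ⟨_, ?_, h3⟩
  have h4 : (fun p => φ 1 (F 1 (j p))) = f ∘ j := by
    funext p
    rw [h1]
    simp
  rwa [h4] at h2

variable {n : ℕ} [T2Space T] [SigmaCompactSpace T]

/-- A compactly supported isotopy extends to a diffeomorphism which is the endpoint of a compactly
supported null path. -/
lemma exists_nullReachable_of_isIsotopy (hn : 1 ≤ n)
    (hα : ∀ x : T, ∃ ψ : OpenPartialHomeomorph T (StdSpace n), IsDarbouxChart n α ψ ∧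
      x ∈ ψ.source) {ι : ℝ → N → T} {j : N → T} {L : Set T} (hι : IsIsotopy k d ι j L)
    (hc : IsCompactlySupported ι) :
    ∃ (g : T ≃ₘ⟮𝓡 d, 𝓡 d⟯ T) (K : Set T), IsCompact K ∧ NullReachable α K g ∧
      range (g ∘ j) = L := by
  obtain ⟨D, hD, hDι⟩ := hc
  obtain ⟨g, ⟨K, hK, -, hg⟩, hgι⟩ := exists_nullReachable_of_isotopy (N := N) hn hα
    (ι := fun t => ι (Real.smoothTransition t)) (contMDiff_smoothTransition_of_Icc hι.smooth)
    (fun t => hι.embedding _ ⟨Real.smoothTransition.nonneg _, Real.smoothTransition.le_one _⟩)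
    hD isOpen_univ (fun _ _ _ => mem_univ _) 0 1
  refine ⟨g, K, hK, hg, ?_⟩
  have h1 : g ∘ j = ι 1 := by
    funext p
    have h2 := hgι p (by
      by_cases hp : p ∈ D
      · exact Or.inl hp
      · refine Or.inr fun t => ?_
        simp only [Real.smoothTransition.zero]
        exact hDι p hp _ ⟨Real.smoothTransition.nonneg _, Real.smoothTransition.le_one _⟩)
    simp only [Real.smoothTransition.zero, Real.smoothTransition.one, hι.start] at h2
    exact h2
  rw [h1, hι.finish]

/-- A diffeomorphism path, supported in an open set, can be followed on a compact set by a null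
path which is supported in the open set. -/
lemma exists_nullReachable_of_diffeoPath (hn : 1 ≤ n)
    (hα : ∀ x : T, ∃ ψ : OpenPartialHomeomorph T (StdSpace n), IsDarbouxChart n α ψ ∧
      x ∈ ψ.source) {F : ℝ → T → T} (hF : IsDiffeoPath d F) (h0 : F 0 = id) {D O : Set T}
    (hD : IsCompact D) (hO : IsOpen O) (hDO : ∀ t ∈ Icc (0 : ℝ) 1, ∀ x ∈ D, F t x ∈ O) :
    ∃ g : T ≃ₘ⟮𝓡 d, 𝓡 d⟯ T, (∃ K, IsCompact K ∧ K ⊆ O ∧ NullReachable α K g) ∧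
      ∀ x, (x ∈ D ∨ ∀ t ∈ Icc (0 : ℝ) 1, F t x = x) → g x = F 1 x := by
  have hI : ∀ t, Real.smoothTransition t ∈ Icc (0 : ℝ) 1 := fun t =>
    ⟨Real.smoothTransition.nonneg _, Real.smoothTransition.le_one _⟩
  obtain ⟨g, hg, hgι⟩ := exists_nullReachable_of_isotopy (N := T) hn hα
    (ι := fun t => F (Real.smoothTransition t)) (contMDiff_smoothTransition_of_Icc hF.smooth)
    (fun t => by
      obtain ⟨g, hg⟩ := hF.diffeo _ (hI t)
      rw [← hg]
      exact isProperEmbedding_diffeomorph g)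
    hD hO (fun t x hx => hDO _ (hI t) x hx) 0 1
  refine ⟨g, hg, fun x hx => ?_⟩
  simp only [Real.smoothTransition.zero, Real.smoothTransition.one, h0, id] at hgι
  exact hgι x (hx.imp_right fun h t => h _ (hI t))

lemma InDiffZeroCompact.exists_nullReachable (hn : 1 ≤ n)
    (hα : ∀ x : T, ∃ ψ : OpenPartialHomeomorph T (StdSpace n), IsDarbouxChart n α ψ ∧
      x ∈ ψ.source) {f : T ≃ₘ⟮𝓡 d, 𝓡 d⟯ T} (hf : InDiffZeroCompact f) :
    ∃ K, IsCompact K ∧ NullReachable α K f := by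
  obtain ⟨F, hF, h0, h1, D, hD, hDF⟩ := hf
  obtain ⟨g, ⟨K, hK, -, hg⟩, hgF⟩ := exists_nullReachable_of_diffeoPath hn hα hF h0 hD isOpen_univ
    (fun _ _ _ _ => mem_univ _)
  have : g = f := by
    ext x
    rw [hgF x, h1]
    by_cases hx : x ∈ D
    · exact Or.inl hx
    · exact Or.inr fun t ht => hDF t ht x hx
  exact ⟨K, hK, this ▸ hg⟩

end Isotopies

section Pairing

variable {E : Type*} [NormedAddCommGroup E] [NormedSpace ℝ E]
  {H : Type*} [TopologicalSpace H] {I : ModelWithCorners ℝ E H}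
  {M : Type*} [TopologicalSpace M] [ChartedSpace H M] [IsManifold I ∞ M]
  {F : Type*} [NormedAddCommGroup F] [NormedSpace ℝ F]
  {G : Type*} [TopologicalSpace G] {J : ModelWithCorners ℝ F G}
  {Q : Type*} [TopologicalSpace Q] [ChartedSpace G Q] [IsManifold J ∞ Q]

lemma CovectorField.IsSmooth.continuous_apply {α : CovectorField I M} (hα : α.IsSmooth)
    {B : Type*} [TopologicalSpace B] {w : B → TangentBundle I M} (hw : Continuous w) :
    Continuous (fun b => α (w b).proj (w b).2) := by
  have h1 : ContMDiff I.tangent I 0 (fun v : TangentBundle I M => v.proj) :=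
    contMDiff_proj (TangentSpace I)
  have h2 : ContMDiff I.tangent (I.prod 𝓘(ℝ, E →L[ℝ] ℝ)) 0
      (fun v : TangentBundle I M => (⟨v.proj, α v.proj⟩ : Cotangent I M)) :=
    (hα.of_le (by simp)).comp h1
  have h3 : ContMDiff I.tangent (I.prod 𝓘(ℝ, ℝ)) 0
      (fun v : TangentBundle I M => TotalSpace.mk' ℝ (E := Trivial M ℝ) v.proj
        (α v.proj v.2)) :=
    ContMDiff.clm_bundle_apply (F₁ := E) (F₂ := ℝ) (E₁ := TangentSpace I) (E₂ := Trivial M ℝ) h2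
      contMDiff_id
  have h4 : Continuous (fun v : TangentBundle I M => α v.proj v.2) := by
    have h5 := (Bundle.Trivial.homeomorphProd M ℝ).continuous.comp h3.continuous
    exact continuous_snd.comp h5
  exact h4.comp hw

lemma continuous_verticalVector : Continuous (fun b : Q × ℝ =>
    (⟨b, ((0 : F), (1 : ℝ))⟩ : TangentBundle (J.prod 𝓘(ℝ, ℝ)) (Q × ℝ))) := by
  have h1 : Continuous (fun q : Q => (⟨q, 0⟩ : TangentBundle J Q)) :=
    (contMDiff_zeroSection (IB := J) (n := 0) ℝ (TangentSpace J : Q → Type _)).continuous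
  have h2 : Continuous (fun z : ℝ => (⟨z, (1 : ℝ)⟩ : TangentBundle 𝓘(ℝ, ℝ) ℝ)) := by
    have := (tangentBundleModelSpaceHomeomorph 𝓘(ℝ, ℝ)).symm.continuous
    exact this.comp (continuous_id.prodMk continuous_const : Continuous fun z : ℝ => (z, (1 : ℝ)))
  have h3 : ContMDiff (J.tangent.prod 𝓘(ℝ, ℝ).tangent) (J.prod 𝓘(ℝ, ℝ)).tangent 0
    (equivTangentBundleProd J Q 𝓘(ℝ, ℝ) ℝ).symm := contMDiff_equivTangentBundleProd_symm
  exact h3.continuous.comp ((h1.comp continuous_fst).prodMk (h2.comp continuous_snd))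

lemma CovectorField.IsSmooth.continuous_vertical {α : CovectorField I M} (hα : α.IsSmooth)
    (Ψ : (Q × ℝ) ≃ₘ⟮J.prod 𝓘(ℝ, ℝ), I⟯ M) :
    Continuous (fun b : Q × ℝ => α (Ψ b)
      (mfderiv (J.prod 𝓘(ℝ, ℝ)) I Ψ b ((0 : F), (1 : ℝ)))) := by
  have h1 : Continuous (tangentMap (J.prod 𝓘(ℝ, ℝ)) I Ψ) :=
    (Ψ.contMDiff.contMDiff_tangentMap (m := 0) (by simp)).continuous
  exact hα.continuous_apply (h1.comp continuous_verticalVector)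

end Pairing

section Conjugation

variable {E : Type*} [NormedAddCommGroup E] [NormedSpace ℝ E]
  {H : Type*} [TopologicalSpace H] {I : ModelWithCorners ℝ E H}
  {M : Type*} [TopologicalSpace M] [ChartedSpace H M]
  {F : Type*} [NormedAddCommGroup F] [NormedSpace ℝ F]
  {G : Type*} [TopologicalSpace G] {J : ModelWithCorners ℝ F G}
  {B : Type*} [TopologicalSpace B] [ChartedSpace G B]

/-- The conjugate of a diffeomorphism of `B` by a diffeomorphism `M → B`. -/
def Diffeomorph.conjBy (Φ : M ≃ₘ⟮I, J⟯ B) (g : B ≃ₘ⟮J, J⟯ B) : M ≃ₘ⟮I, I⟯ M :=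
  Φ.trans (g.trans Φ.symm)

@[simp] lemma Diffeomorph.conjBy_apply (Φ : M ≃ₘ⟮I, J⟯ B) (g : B ≃ₘ⟮J, J⟯ B) (p : M) :
    Φ.conjBy g p = Φ.symm (g (Φ p)) := rfl

lemma Diffeomorph.conjBy_refl (Φ : M ≃ₘ⟮I, J⟯ B) :
    Φ.conjBy (Diffeomorph.refl J B ∞) = Diffeomorph.refl I M ∞ := by
  ext p; simp

lemma Diffeomorph.mfderiv_mfderiv_symm (Φ : M ≃ₘ⟮I, J⟯ B) (b : B) (w : TangentSpace J b) :
    mfderiv I J Φ (Φ.symm b) (mfderiv J I Φ.symm b w) = w := by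
  have h1 := mfderiv_comp b (Φ.contMDiff.mdifferentiable (by simp) (Φ.symm b))
    (Φ.symm.contMDiff.mdifferentiable (by simp) b)
  have h2 : (Φ ∘ Φ.symm : B → B) = id := by ext; simp
  have h3 : mfderiv J J (Φ ∘ Φ.symm) b = (ContinuousLinearMap.id ℝ F : F →L[ℝ] F) := by
    rw [h2]; exact mfderiv_id
  exact (congrArg (fun L : F →L[ℝ] F => L w) (h1.symm.trans h3))

/-- The diffeomorphism `Φ` pulls the covector field `β` back to a positive multiple of `α`. -/
def IsPositivePullback (α : CovectorField I M) (β : CovectorField J B) (Φ : M ≃ₘ⟮I, J⟯ B) : Prop :=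
  ∀ p : M, ∃ c > 0, ∀ v : TangentSpace I p, α p v = c * β (Φ p) (mfderiv I J Φ p v)

variable {α : CovectorField I M} {β : CovectorField J B} {Φ : M ≃ₘ⟮I, J⟯ B}

lemma IsPositivePullback.symm_apply (hΦ : IsPositivePullback α β Φ) (b : B) :
    ∃ c > 0, ∀ w : TangentSpace J b, α (Φ.symm b) (mfderiv J I Φ.symm b w) = c * β b w := by
  obtain ⟨c, hc, h⟩ := hΦ (Φ.symm b)
  refine ⟨c, hc, fun w => ?_⟩
  rw [h]
  have key : ∀ (b' : B) (w' : F), b' = b → w' = w → (β b' : F →L[ℝ] ℝ) w' = β b w := by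
    rintro _ _ rfl rfl; rfl
  congr 1
  exact key _ _ (Φ.apply_symm_apply b) (Φ.mfderiv_mfderiv_symm b w)

lemma contMDiff_conjBy {φ : ℝ → B ≃ₘ⟮J, J⟯ B}
    (hφ : ContMDiff (𝓘(ℝ, ℝ).prod J) J ∞ (fun q : ℝ × B => φ q.1 q.2)) (Φ : M ≃ₘ⟮I, J⟯ B) :
    ContMDiff (𝓘(ℝ, ℝ).prod I) I ∞ (fun q : ℝ × M => Φ.conjBy (φ q.1) q.2) :=
  Φ.symm.contMDiff.comp (hφ.comp (contMDiff_fst.prodMk (Φ.contMDiff.comp contMDiff_snd)))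

lemma mfderiv_conjBy {γ : ℝ → B} {t : ℝ} (hγ : MDifferentiableAt 𝓘(ℝ, ℝ) J γ t)
    (Φ : M ≃ₘ⟮I, J⟯ B) : mfderiv 𝓘(ℝ, ℝ) I (fun s => Φ.symm (γ s)) t (1 : ℝ) =
      mfderiv J I Φ.symm (γ t) (mfderiv 𝓘(ℝ, ℝ) J γ t (1 : ℝ)) := by
  have h := mfderiv_comp t (Φ.symm.contMDiff.mdifferentiable (by simp) (γ t)) hγ
  exact congrArg (fun L : ℝ →L[ℝ] E => L 1) h

lemma IsNullPath.conjBy {φ : ℝ → B ≃ₘ⟮J, J⟯ B} (hφ : IsNullPath β φ)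
    (hΦ : IsPositivePullback α β Φ) : IsNullPath α (fun t => Φ.conjBy (φ t)) where
  smooth := contMDiff_conjBy hφ.smooth Φ
  null t p := by
    obtain ⟨c, -, h⟩ := hΦ.symm_apply (φ t (Φ p))
    refine (congrArg (α (Φ.conjBy (φ t) p)) (mfderiv_conjBy (γ := fun s => φ s (Φ p))
      ((contMDiff_orbit (F := fun t => φ t) hφ.smooth (Φ p)).mdifferentiable (by simp) t) Φ)).trans ?_
    refine (h _).trans ?_
    rw [hφ.null t (Φ p), mul_zero]

lemma IsPositivePath.conjBy {φ : ℝ → B ≃ₘ⟮J, J⟯ B} (hφ : IsPositivePath β φ)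
    (hΦ : IsPositivePullback α β Φ) : IsPositivePath α (fun t => Φ.conjBy (φ t)) where
  smooth := contMDiff_conjBy hφ.smooth Φ
  start := by rw [hφ.start, Φ.conjBy_refl]
  preserves t p v hv := by
    obtain ⟨c, hc, h⟩ := hΦ p
    obtain ⟨c', -, h'⟩ := hΦ.symm_apply (φ t (Φ p))
    rw [h] at hv
    have h0 := hφ.preserves t _ _ ((mul_eq_zero.1 hv).resolve_left hc.ne')
    have h1 := mfderiv_comp p (Φ.symm.contMDiff.mdifferentiable (by simp) (φ t (Φ p)))
      (((φ t).contMDiff.mdifferentiable (by simp) (Φ p)).comp p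
        (Φ.contMDiff.mdifferentiable (by simp) p))
    have h2 := mfderiv_comp p ((φ t).contMDiff.mdifferentiable (by simp) (Φ p))
        (Φ.contMDiff.mdifferentiable (by simp) p)
    refine (congrArg (fun L : E →L[ℝ] E => (α (Φ.symm (φ t (Φ p))) : E →L[ℝ] ℝ) (L v)) h1).trans ?_
    refine (h' _).trans ?_
    refine Eq.trans (congrArg (fun L : E →L[ℝ] F => c' * (β (φ t (Φ p)) : F →L[ℝ] ℝ) (L v)) h2) ?_
    refine (congrArg (fun x => c' * x) h0).trans (mul_zero _)
  pos t p := by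
    obtain ⟨c, hc, h⟩ := hΦ.symm_apply (φ t (Φ p))
    refine lt_of_lt_of_eq ?_ (congrArg (α (Φ.conjBy (φ t) p)) (mfderiv_conjBy
      (γ := fun s => φ s (Φ p))
      ((contMDiff_orbit (F := fun t => φ t) hφ.smooth (Φ p)).mdifferentiable (by simp) t) Φ)).symm
    exact lt_of_lt_of_eq (mul_pos hc (hφ.pos t (Φ p))) (h _).symm

end Conjugation

section Contactization

variable {E : Type*} [NormedAddCommGroup E] [NormedSpace ℝ E]
  {H : Type*} [TopologicalSpace H] {I : ModelWithCorners ℝ E H}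
  {M : Type*} [TopologicalSpace M] [ChartedSpace H M]
  {F : Type*} [NormedAddCommGroup F] [NormedSpace ℝ F]
  {G : Type*} [TopologicalSpace G] {J : ModelWithCorners ℝ F G}
  {Q : Type*} [TopologicalSpace Q] [ChartedSpace G Q]

/-- The covector field `ε (dz - θ)` on `Q × ℝ`, for a covector field `θ` and a function `ε`
on `Q`. -/
def contactization (θ : CovectorField J Q) (ε : Q → ℝ) :
    CovectorField (J.prod 𝓘(ℝ, ℝ)) (Q × ℝ) := fun a =>
  ε a.1 • (ContinuousLinearMap.snd ℝ F ℝ -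
    (θ a.1 : F →L[ℝ] ℝ).comp (ContinuousLinearMap.fst ℝ F ℝ))

lemma contactization_apply (θ : CovectorField J Q) (ε : Q → ℝ) (a : Q × ℝ) (w : F × ℝ) :
    (contactization θ ε a : F × ℝ →L[ℝ] ℝ) w = ε a.1 * (w.2 - (θ a.1 : F →L[ℝ] ℝ) w.1) := rfl

/-- The Liouville form of the cotangent bundle. -/
def liouville (n : ℕ) (X : Type*) [TopologicalSpace X] [ChartedSpace (Euc n) X]
    [IsManifold (𝓡 n) ∞ X] :
    CovectorField ((𝓡 n).prod 𝓘(ℝ, Euc n →L[ℝ] ℝ)) (Cotangent (𝓡 n) X) := fun c =>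
  let dπ : TangentSpace ((𝓡 n).prod 𝓘(ℝ, Euc n →L[ℝ] ℝ)) c →L[ℝ] TangentSpace (𝓡 n) c.proj :=
    mfderiv ((𝓡 n).prod 𝓘(ℝ, Euc n →L[ℝ] ℝ)) (𝓡 n) (fun b : Cotangent (𝓡 n) X => b.proj) c
  let p : TangentSpace (𝓡 n) c.proj →L[ℝ] ℝ := c.snd
  p.comp dπ

lemma jetForm_eq (n : ℕ) (X : Type*) [TopologicalSpace X] [ChartedSpace (Euc n) X]
    [IsManifold (𝓡 n) ∞ X] : jetForm n X = contactization (liouville n X) 1 := by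
  funext a
  have h1 : MDifferentiableAt ((𝓡 n).prod 𝓘(ℝ, Euc n →L[ℝ] ℝ)) (𝓡 n)
      (fun b : Cotangent (𝓡 n) X => b.proj) a.1 :=
    (contMDiff_proj (n := 1) (IB := 𝓡 n) (F := Euc n →L[ℝ] ℝ)
      (fun p : X => TangentSpace (𝓡 n) p →L[ℝ] ℝ)).mdifferentiable (by simp) _
  have h2 := mfderiv_comp a h1 (mdifferentiableAt_fst (I := (𝓡 n).prod 𝓘(ℝ, Euc n →L[ℝ] ℝ))
    (I' := 𝓘(ℝ, ℝ)) (x := a))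
  have key : ∀ (Z : (Euc n × (Euc n →L[ℝ] ℝ)) × ℝ →L[ℝ] ℝ)
      (P : (Euc n × (Euc n →L[ℝ] ℝ)) × ℝ →L[ℝ] Euc n) (R : Euc n × (Euc n →L[ℝ] ℝ) →L[ℝ] Euc n)
      (S : (Euc n × (Euc n →L[ℝ] ℝ)) × ℝ →L[ℝ] Euc n × (Euc n →L[ℝ] ℝ)) (p : Euc n →L[ℝ] ℝ),
      Z = ContinuousLinearMap.snd ℝ _ ℝ → P = R.comp S → S = ContinuousLinearMap.fst ℝ _ ℝ →
      Z - p.comp P = (1 : ℝ) • (ContinuousLinearMap.snd ℝ _ ℝ -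
        (p.comp R).comp (ContinuousLinearMap.fst ℝ _ ℝ)) := by
    rintro _ _ R _ p rfl rfl rfl
    rw [one_smul]
    rfl
  exact key _ _ _ _ _ mfderiv_snd h2 mfderiv_fst

lemma apply_eq_mul_of_ker (a : E →L[ℝ] ℝ) (A : F × ℝ →L[ℝ] E) (L : F × ℝ →L[ℝ] ℝ)
    (h : ∀ w, a (A w) = 0 ↔ L w = 0) (h1 : L (0, 1) = 1) (w : F × ℝ) :
    a (A w) = a (A (0, 1)) * L w := by
  have h2 : L (w - L w • ((0 : F), (1 : ℝ))) = 0 := by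
    rw [map_sub, map_smul, h1, smul_eq_mul, mul_one, sub_self]
  have h3 := (h _).2 h2
  rw [map_sub, map_smul, map_sub, map_smul, sub_eq_zero] at h3
  rw [h3, smul_eq_mul, mul_comm]

/-- A contactomorphism onto `(Q × ℝ, ker (dz - θ))` becomes compatible with coorientations after
`dz - θ` is multiplied by a locally constant sign. -/
lemma exists_sign_isPositivePullback [IsManifold I ∞ M] [IsManifold J ∞ Q] {α : CovectorField I M}
    (hα : α.IsSmooth) {θ : CovectorField J Q} {Φ : M ≃ₘ⟮I, J.prod 𝓘(ℝ, ℝ)⟯ (Q × ℝ)}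
    (hΦ : ∀ (p : M) (v : TangentSpace I p), α p v = 0 ↔
      contactization θ 1 (Φ p) (mfderiv I (J.prod 𝓘(ℝ, ℝ)) Φ p v) = 0) :
    ∃ ε : Q → ℝ, IsLocallyConstant ε ∧ (∀ q, ε q = 1 ∨ ε q = -1) ∧
      IsPositivePullback α (contactization θ ε) Φ := by
  set h : Q × ℝ → ℝ := fun b => α (Φ.symm b)
    (mfderiv (J.prod 𝓘(ℝ, ℝ)) I Φ.symm b ((0 : F), (1 : ℝ))) with hh
  have hc : Continuous h := hα.continuous_vertical Φ.symm
  have hker : ∀ (b : Q × ℝ) (w : TangentSpace (J.prod 𝓘(ℝ, ℝ)) b),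
      α (Φ.symm b) (mfderiv (J.prod 𝓘(ℝ, ℝ)) I Φ.symm b w) = 0 ↔ contactization θ 1 b w = 0 := by
    intro b w
    rw [hΦ]
    have key : ∀ (b' : Q × ℝ) (w' : F × ℝ), b' = b → w' = w →
        ((contactization θ 1 b' : F × ℝ →L[ℝ] ℝ) w' = 0 ↔ contactization θ 1 b w = 0) := by
      rintro _ _ rfl rfl; rfl
    exact key _ _ (Φ.apply_symm_apply b) (Φ.mfderiv_mfderiv_symm b w)
  have h1 : ∀ b, (contactization θ 1 b : F × ℝ →L[ℝ] ℝ) (0, 1) = 1 := by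
    intro b
    rw [contactization_apply]
    have : (θ b.1 : F →L[ℝ] ℝ) 0 = 0 := map_zero (θ b.1 : F →L[ℝ] ℝ)
    change (1 : ℝ) * (1 - (θ b.1 : F →L[ℝ] ℝ) 0) = 1
    rw [this, sub_zero, mul_one]
  have h0 : ∀ b, h b ≠ 0 := fun b hb => one_ne_zero ((h1 b).symm.trans ((hker b _).1 hb))
  have hmul : ∀ (b : Q × ℝ) (w : F × ℝ),
      (α (Φ.symm b) : E →L[ℝ] ℝ) ((mfderiv (J.prod 𝓘(ℝ, ℝ)) I Φ.symm b : F × ℝ →L[ℝ] E) w) =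
        h b * (contactization θ 1 b : F × ℝ →L[ℝ] ℝ) w := fun b w =>
    apply_eq_mul_of_ker (E := E) (α (Φ.symm b)) (mfderiv (J.prod 𝓘(ℝ, ℝ)) I Φ.symm b)
      (contactization θ 1 b) (hker b) (h1 b) w
  have hsign : ∀ q z, 0 < h (q, z) ↔ 0 < h (q, 0) := by
    have aux : ∀ q z z', 0 < h (q, z) → 0 < h (q, z') := by
      intro q z z' hz
      by_contra hz'
      obtain ⟨y, hy⟩ := mem_range_of_exists_le_of_exists_ge
        (f := fun y : ℝ => h (q, y)) (hc.comp (continuous_const.prodMk continuous_id))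
        ⟨z', not_lt.1 hz'⟩ ⟨z, hz.le⟩
      exact h0 _ hy
    exact fun q z => ⟨aux q z 0, aux q 0 z⟩
  classical
  refine ⟨fun q => if 0 < h (q, 0) then 1 else -1, ?_, ?_, ?_⟩
  · rw [IsLocallyConstant.iff_eventually_eq]
    intro q
    have hc' : Continuous (fun q : Q => h (q, 0)) := hc.comp (continuous_id.prodMk continuous_const)
    rcases lt_or_gt_of_ne (h0 (q, 0)) with hq | hq
    · filter_upwards [hc'.continuousAt.preimage_mem_nhds (Iio_mem_nhds hq)] with q' hq'
      simp only [mem_preimage, mem_Iio] at hq'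
      rw [if_neg (not_lt.2 hq.le), if_neg (not_lt.2 hq'.le)]
    · filter_upwards [hc'.continuousAt.preimage_mem_nhds (Ioi_mem_nhds hq)] with q' hq'
      simp only [mem_preimage, mem_Ioi] at hq'
      rw [if_pos hq, if_pos hq']
  · intro q
    simp only
    split_ifs <;> simp
  · intro p
    refine ⟨|h (Φ p)|, abs_pos.2 (h0 _), fun v => ?_⟩
    have h1 := hmul (Φ p) (mfderiv I (J.prod 𝓘(ℝ, ℝ)) Φ p v)
    have key : ∀ (p' : M) (v' : E), p' = p → v' = v → (α p' : E →L[ℝ] ℝ) v' = α p v := by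
      rintro _ _ rfl rfl; rfl
    have h2 := (key _ _ (Φ.symm_apply_apply p) (Φ.symm.mfderiv_mfderiv_symm p v)).symm.trans h1
    rw [h2]
    set w : F × ℝ := mfderiv I (J.prod 𝓘(ℝ, ℝ)) Φ p v
    change h (Φ p) * (contactization θ 1 (Φ p) : F × ℝ →L[ℝ] ℝ) w =
      |h (Φ p)| * (contactization θ _ (Φ p) : F × ℝ →L[ℝ] ℝ) w
    rw [contactization_apply, contactization_apply]
    have h3 := hsign (Φ p).1 (Φ p).2
    rw [Prod.mk.eta] at h3
    simp only [Pi.one_apply, one_mul]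
    rw [← mul_assoc]
    congr 1
    split_ifs with h4
    · rw [abs_of_pos (h3.2 h4), mul_one]
    · rw [abs_of_nonpos (not_lt.1 fun h5 => h4 (h3.1 h5))]
      ring

end Contactization

section Steps

variable {n d : ℕ} {T : Type*} [TopologicalSpace T] [ChartedSpace (Euc d) T]
  [IsManifold (𝓡 d) ∞ T] [T2Space T] [SigmaCompactSpace T] {α : CovectorField (𝓡 d) T}

/-- A path of diffeomorphisms, constant on a neighbourhood of the closure of `U`, can be followed
on a compact set by a null path which is constant on `U`. -/
lemma exists_nullReachable_disjoint_eq (hn : 1 ≤ n)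
    (hα : ∀ x : T, ∃ ψ : OpenPartialHomeomorph T (StdSpace n), IsDarbouxChart n α ψ ∧
      x ∈ ψ.source) {F : ℝ → T → T} (hF : IsDiffeoPath d F) (h0 : F 0 = id)
    {D U C V : Set T} (hD : IsCompact D) (hC : IsClosed C)
    (hV : IsOpen V) (hUC : U ⊆ C) (hCV : C ⊆ V)
    (hFV : ∀ t ∈ Icc (0 : ℝ) 1, ∀ x ∈ V, F t x = x) :
    ∃ (g : T ≃ₘ⟮𝓡 d, 𝓡 d⟯ T) (K : Set T), Disjoint K U ∧ NullReachable α K g ∧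
      ∀ x, (x ∈ D ∨ ∀ t ∈ Icc (0 : ℝ) 1, F t x = x) → g x = F 1 x := by
  obtain ⟨g, ⟨K, -, hKC, hg⟩, hgF⟩ := exists_nullReachable_of_diffeoPath hn hα hF h0 (hD.diff hV)
    hC.isOpen_compl (by
      rintro t ht x ⟨-, hxV⟩ hxC
      obtain ⟨e, he⟩ := hF.diffeo t ht
      have h2 := hFV t ht _ (hCV hxC)
      rw [← he] at h2 hxC
      rw [e.injective h2] at hxC
      exact hxV (hCV hxC))
  refine ⟨g, K, disjoint_left.2 fun x hx hxU => hKC hx (hUC hxU), hg, fun x hx => hgF x ?_⟩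
  by_cases hxV : x ∈ V
  · exact Or.inr fun t ht => hFV t ht x hxV
  · exact hx.imp_left fun hxD => ⟨hxD, hxV⟩

/-- A compactly supported path of diffeomorphisms, constant on a neighbourhood of the closure
of `U`, can be replaced with a null path which is constant on `U`. -/
lemma exists_nullReachable_disjoint (hn : 1 ≤ n)
    (hα : ∀ x : T, ∃ ψ : OpenPartialHomeomorph T (StdSpace n), IsDarbouxChart n α ψ ∧
      x ∈ ψ.source) {F : ℝ → T → T} (hF : IsDiffeoPath d F) (h0 : F 0 = id)
    {f : T ≃ₘ⟮𝓡 d, 𝓡 d⟯ T} (h1 : F 1 = f) {D U C V : Set T} (hD : IsCompact D) (hC : IsClosed C)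
    (hV : IsOpen V) (hUC : U ⊆ C) (hCV : C ⊆ V)
    (hFV : ∀ t ∈ Icc (0 : ℝ) 1, ∀ x ∈ V, F t x = x)
    (hFD : ∀ t ∈ Icc (0 : ℝ) 1, ∀ x ∉ D, F t x = x) :
    ∃ K, Disjoint K U ∧ NullReachable α K f := by
  obtain ⟨g, K, hKU, hg, hgF⟩ :=
    exists_nullReachable_disjoint_eq hn hα hF h0 hD hC hV hUC hCV hFV
  have h2 : g = f := by
    ext x
    rw [← h1, hgF x]
    by_cases hx : x ∈ D
    · exact Or.inl hx
    · exact Or.inr fun t ht => hFD t ht x hx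
  exact ⟨K, hKU, h2 ▸ hg⟩

end Steps

section Shears

variable {F : Type*} [NormedAddCommGroup F] [NormedSpace ℝ F]
  {G : Type*} [TopologicalSpace G] {J : ModelWithCorners ℝ F G}
  {Q : Type*} [TopologicalSpace Q] [ChartedSpace G Q]
  {V : Type*} [NormedAddCommGroup V] [NormedSpace ℝ V]

lemma exists_diffeomorph_shear [CompleteSpace V] {c : Q → V} (hc : ContMDiff J 𝓘(ℝ, V) ∞ c)
    {m : Q → ℝ} (hm : ContMDiff J 𝓘(ℝ, ℝ) ∞ m) {W : V × ℝ → ℝ} (hW : ContDiff ℝ ∞ W) {L : ℝ}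
    (hL : L < 1) (hlip : ∀ v w, |W v - W w| ≤ L * ‖v - w‖) :
    ∃ g : (Q × ℝ) ≃ₘ⟮J.prod 𝓘(ℝ, ℝ), J.prod 𝓘(ℝ, ℝ)⟯ (Q × ℝ),
      ∀ a, g a = (a.1, a.2 + W (c a.1, a.2) + m a.1) := by
  obtain ⟨e, he⟩ := exists_diffeomorph_add (V := V × ℝ) (h := fun v => ((0 : V), W v))
    (contDiff_const.prodMk hW) hL (fun v w => by
      rw [Prod.mk_sub_mk, sub_zero, Prod.norm_mk, norm_zero, max_eq_right (norm_nonneg _)]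
      exact hlip v w)
  have he1 : ∀ v, (e.symm v).1 = v.1 := by
    intro v
    have h1 := congrArg Prod.fst (he (e.symm v))
    rw [e.apply_symm_apply] at h1
    simpa using h1.symm
  have hcf : ContMDiff (J.prod 𝓘(ℝ, ℝ)) 𝓘(ℝ, V) ∞ (fun a : Q × ℝ => c a.1) :=
    hc.comp contMDiff_fst
  have hmf : ContMDiff (J.prod 𝓘(ℝ, ℝ)) 𝓘(ℝ, ℝ) ∞ (fun a : Q × ℝ => m a.1) :=
    hm.comp contMDiff_fst
  refine ⟨⟨⟨fun a => (a.1, a.2 + W (c a.1, a.2) + m a.1),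
    fun a => (a.1, (e.symm (c a.1, a.2 - m a.1)).2), ?_, ?_⟩, ?_, ?_⟩, fun a => rfl⟩
  · intro a
    simp only
    have h1 : e (c a.1, a.2) = (c a.1, a.2 + W (c a.1, a.2) + m a.1 - m a.1) := by
      rw [he]; simp
    rw [← h1, e.symm_apply_apply]
  · intro a
    simp only
    set z := (e.symm (c a.1, a.2 - m a.1)).2 with hz
    have h1 : e.symm (c a.1, a.2 - m a.1) = (c a.1, z) := Prod.ext (he1 _) rfl
    have h2 := he (e.symm (c a.1, a.2 - m a.1))
    rw [e.apply_symm_apply, h1] at h2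
    have h3 := congrArg Prod.snd h2
    simp only [Prod.snd_add] at h3
    rw [← h3, sub_add_cancel]
  · exact contMDiff_fst.prodMk ((contMDiff_snd.add
      (hW.contMDiff.comp (hcf.prodMk_space contMDiff_snd))).add hmf)
  · exact contMDiff_fst.prodMk (contDiff_snd.contMDiff.comp
      (e.symm.contMDiff.comp (hcf.prodMk_space (contMDiff_snd.sub hmf))))

lemma IsLocallyConstant.contMDiff {ε : Q → ℝ} (hε : IsLocallyConstant ε) :
    ContMDiff J 𝓘(ℝ, ℝ) ∞ ε := fun q =>
  (contMDiffAt_const (c := ε q)).congr_of_eventuallyEq (hε.eventually_eq q)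

/-- The flow of `ε ∂_z`, for a locally constant sign `ε`, is a positive path. -/
lemma exists_isPositivePath_contactization {θ : CovectorField J Q} {ε : Q → ℝ}
    (hε : IsLocallyConstant ε) (hε1 : ∀ q, ε q = 1 ∨ ε q = -1) :
    ∃ φ : ℝ → (Q × ℝ) ≃ₘ⟮J.prod 𝓘(ℝ, ℝ), J.prod 𝓘(ℝ, ℝ)⟯ (Q × ℝ),
      IsPositivePath (contactization θ ε) φ ∧ ∀ t a, φ t a = (a.1, a.2 + t * ε a.1) := by
  have hεs : ContMDiff J 𝓘(ℝ, ℝ) ∞ ε := hε.contMDiff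
  have hex : ∀ t : ℝ, ∃ g : (Q × ℝ) ≃ₘ⟮J.prod 𝓘(ℝ, ℝ), J.prod 𝓘(ℝ, ℝ)⟯ (Q × ℝ),
      ∀ a, g a = (a.1, a.2 + t * ε a.1) := by
    intro t
    obtain ⟨g, hg⟩ := exists_diffeomorph_shear (V := ℝ) (contMDiff_const (c := 0))
      (contMDiff_const.mul hεs : ContMDiff J 𝓘(ℝ, ℝ) ∞ fun q => t * ε q)
      (W := fun _ => 0) contDiff_const zero_lt_one (by simp)
    exact ⟨g, fun a => by rw [hg, add_zero]; rfl⟩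
  choose φ hφ using hex
  refine ⟨φ, ⟨?_, ?_, ?_, ?_⟩, hφ⟩
  · have h1 : (fun q : ℝ × (Q × ℝ) => φ q.1 q.2) = fun q => (q.2.1, q.2.2 + q.1 * ε q.2.1) :=
      funext fun q => hφ _ _
    rw [h1]
    exact (contMDiff_fst.comp contMDiff_snd).prodMk ((contMDiff_snd.comp contMDiff_snd).add
      (contMDiff_fst.mul (hεs.comp (contMDiff_fst.comp contMDiff_snd))))
  · ext a
    · simp [hφ]
    · simp [hφ]
  · intro t a v hv
    have h1 : φ t =ᶠ[𝓝 a] Prod.map id (fun z => z + t * ε a.1) := by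
      filter_upwards [continuous_fst.continuousAt.eventually (hε.eventually_eq a.1)] with b hb
      rw [hφ, hb]
      rfl
    have h2 : HasMFDerivAt 𝓘(ℝ, ℝ) 𝓘(ℝ, ℝ) (fun z : ℝ => z + t * ε a.1) a.2
        (ContinuousLinearMap.id ℝ ℝ) := ((hasFDerivAt_id a.2).add_const _).hasMFDerivAt
    have h3 : HasMFDerivAt (J.prod 𝓘(ℝ, ℝ)) (J.prod 𝓘(ℝ, ℝ)) (φ t) a
        (ContinuousLinearMap.id ℝ (F × ℝ)) := by
      refine HasMFDerivAt.congr_of_eventuallyEq ?_ h1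
      have h5 := (hasMFDerivAt_id (I := J) a.1).prodMap h2
      have h6 : (mfderiv J J (id : Q → Q) a.1 : F →L[ℝ] F) = ContinuousLinearMap.id ℝ F :=
        mfderiv_id
      have key : ∀ (A : F →L[ℝ] F) (B : ℝ →L[ℝ] ℝ), A = ContinuousLinearMap.id ℝ F →
          B = ContinuousLinearMap.id ℝ ℝ → A.prodMap B = ContinuousLinearMap.id ℝ (F × ℝ) := by
        rintro _ _ rfl rfl; rfl
      exact h5.congr_mfderiv (key _ _ h6 h2.mfderiv)
    have h4 : (contactization θ ε (φ t a) : F × ℝ →L[ℝ] ℝ) v = 0 := by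
      rw [hφ]
      exact hv
    exact (congrArg (fun L : F × ℝ →L[ℝ] F × ℝ =>
      (contactization θ ε (φ t a) : F × ℝ →L[ℝ] ℝ) (L v)) h3.mfderiv).trans h4
  · intro t a
    have h1 : mfderiv 𝓘(ℝ, ℝ) 𝓘(ℝ, ℝ) (fun s : ℝ => a.2 + s * ε a.1) t (1 : ℝ) = ε a.1 := by
      rw [mfderiv_eq_fderiv]
      have : HasDerivAt (fun s : ℝ => a.2 + s * ε a.1) (1 * ε a.1) t :=
        ((hasDerivAt_id t).mul_const _).const_add _
      exact this.deriv.trans (one_mul _)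
    have h2 : mfderiv 𝓘(ℝ, ℝ) (J.prod 𝓘(ℝ, ℝ)) (fun s : ℝ => φ s a) t (1 : ℝ) =
        ((0 : F), ε a.1) := by
      have h3 : (fun s : ℝ => φ s a) = fun s => (a.1, a.2 + s * ε a.1) := funext fun s => hφ s a
      rw [h3, MDifferentiableAt.mfderiv_prod mdifferentiableAt_const
        ((differentiableAt_id.mul_const _).const_add _).mdifferentiableAt, mfderiv_const]
      exact Prod.ext rfl h1
    refine lt_of_lt_of_eq ?_ (congrArg (contactization θ ε (φ t a) : F × ℝ →L[ℝ] ℝ) h2).symm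
    rw [hφ, contactization_apply]
    change 0 < ε a.1 * (ε a.1 - (θ a.1 : F →L[ℝ] ℝ) 0)
    rw [show (θ a.1 : F →L[ℝ] ℝ) 0 = 0 from map_zero (θ a.1 : F →L[ℝ] ℝ)]
    rcases hε1 a.1 with h | h <;> rw [h] <;> norm_num

end Shears

section Translation

lemma exists_slow_bump (R : ℝ) : ∃ (b : ℝ → ℝ) (R' : ℝ), ContDiff ℝ ∞ b ∧
    (∀ z, |z| ≤ R → b z = 1) ∧ (∀ z, R' < |z| → b z = 0) ∧ (∀ z, |b z| ≤ 1) ∧ ∀ z w, |b z - b w| ≤ 1 / 8 * |z - w| := by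
  let f : ContDiffBump (0 : ℝ) := ⟨1, 2, one_pos, one_lt_two⟩
  obtain ⟨A, hA⟩ := (f.contDiff (n := 1)).lipschitzWith_of_hasCompactSupport f.hasCompactSupport
    (by simp)
  have hA' : ∀ z w, |f z - f w| ≤ A * |z - w| := fun z w => by
    simpa [Real.dist_eq] using hA.dist_le_mul z w
  set l : ℝ := |R| + 1 + 8 * A with hl
  have hA0 : (0 : ℝ) ≤ A := A.2
  have hl0 : 0 < l := by positivity
  have habs : ∀ z : ℝ, |z / l| = |z| / l := fun z => by rw [abs_div, abs_of_pos hl0]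
  refine ⟨fun z => f (z / l), 2 * l, f.contDiff.comp (contDiff_id.div_const l), fun z hz => ?_,
    fun z hz => ?_, fun z => ?_, fun z w => ?_⟩
  · refine f.one_of_mem_closedBall ?_
    rw [mem_closedBall_zero_iff, Real.norm_eq_abs, habs, div_le_iff₀ hl0]
    change |z| ≤ 1 * l
    linarith [le_abs_self R]
  · refine f.zero_of_le_dist ?_
    rw [dist_zero_right, Real.norm_eq_abs, habs, le_div_iff₀ hl0]
    exact hz.le
  · rw [abs_of_nonneg f.nonneg]
    exact f.le_one
  · refine (hA' _ _).trans ?_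
    rw [← sub_div, habs]
    have h1 : (A : ℝ) / l ≤ 1 / 8 := by
      rw [div_le_iff₀ hl0]
      have := abs_nonneg R
      linarith
    calc (A : ℝ) * (|z - w| / l) = A / l * |z - w| := by ring
      _ ≤ 1 / 8 * |z - w| := mul_le_mul_of_nonneg_right h1 (abs_nonneg _)

lemma abs_sin_mul_sub_le {b : ℝ → ℝ} (hb1 : ∀ z, |b z| ≤ 1)
    (hb : ∀ z w, |b z - b w| ≤ 1 / 8 * |z - w|) (u v z w : ℝ) :
    |Real.sin (u / 8) * b z - Real.sin (v / 8) * b w| ≤ 1 / 8 * |u - v| + 1 / 8 * |z - w| := by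
  have h1 : |Real.sin (u / 8) - Real.sin (v / 8)| ≤ 1 / 8 * |u - v| := by
    have h := Real.lipschitzWith_sin.dist_le_mul (u / 8) (v / 8)
    rw [Real.dist_eq, Real.dist_eq, ← sub_div, abs_div] at h
    norm_num at h
    linarith
  have h2 : Real.sin (u / 8) * b z - Real.sin (v / 8) * b w =
      (Real.sin (u / 8) - Real.sin (v / 8)) * b z + Real.sin (v / 8) * (b z - b w) := by ring
  rw [h2]
  refine (abs_add_le _ _).trans (add_le_add ?_ ?_)
  · rw [abs_mul]
    exact (mul_le_of_le_one_right (abs_nonneg _) (hb1 z)).trans h1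
  · rw [abs_mul]
    exact (mul_le_of_le_one_left (abs_nonneg _) (Real.abs_sin_le_one _)).trans (hb z w)

variable {n d : ℕ} {T : Type*} [TopologicalSpace T] [ChartedSpace (Euc d) T]
  [IsManifold (𝓡 d) ∞ T] [T2Space T] [SigmaCompactSpace T] {α : CovectorField (𝓡 d) T}
  {F : Type*} [NormedAddCommGroup F] [NormedSpace ℝ F]
  {G : Type*} [TopologicalSpace G] {J : ModelWithCorners ℝ F G}
  {Q : Type*} [TopologicalSpace Q] [ChartedSpace G Q]

lemma exists_exhausting_bumps [FiniteDimensional ℝ F] [IsManifold J ∞ Q] [T2Space Q]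
    [SigmaCompactSpace Q] [LocallyCompactSpace Q] (K : CompactExhaustion Q) (j : ℕ) :
    ∃ a : Q → ℝ, ContMDiff J 𝓘(ℝ, ℝ) ∞ a ∧ (j = 0 → ∀ q, a q = 0) ∧
      (j ≠ 0 → ∀ q ∈ K (j + 1), a q = 1) ∧ ∃ S, IsCompact S ∧ ∀ q ∉ S, a q = 0 := by
  rcases eq_or_ne j 0 with rfl | hj
  · exact ⟨fun _ => 0, contMDiff_const, fun _ _ => rfl, fun h => absurd rfl h, ∅, isCompact_empty,
      fun _ _ => rfl⟩
  · obtain ⟨a, h0, h1, -⟩ := exists_contMDiffMap_zero_one_of_isClosed (n := (⊤ : ℕ∞)) J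
      (isOpen_interior (s := K (j + 2))).isClosed_compl (K.isCompact (j + 1)).isClosed
      (disjoint_compl_left_iff_subset.2 (K.subset_interior_succ (j + 1)))
    exact ⟨a, a.contMDiff, fun h => absurd h hj, fun _ q hq => h1 hq, K (j + 2), K.isCompact _,
      fun q hq => h0 fun h => hq (interior_subset h)⟩

/-- A translation of the fibres of `Q × ℝ` is the endpoint of a null path. -/
theorem nullReachable_translation [FiniteDimensional ℝ F] [IsManifold J ∞ Q] [T2Space Q]
    [SigmaCompactSpace Q] [LocallyCompactSpace Q] (hn : 1 ≤ n)
    (hα : ∀ x : T, ∃ ψ : OpenPartialHomeomorph T (StdSpace n), IsDarbouxChart n α ψ ∧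
      x ∈ ψ.source) (Φ : T ≃ₘ⟮𝓡 d, J.prod 𝓘(ℝ, ℝ)⟯ (Q × ℝ)) {ε : Q → ℝ}
    (hε : IsLocallyConstant ε) (hε1 : ∀ q, ε q = 1 ∨ ε q = -1) {f : T ≃ₘ⟮𝓡 d, 𝓡 d⟯ T}
    (hf : ∀ p, Φ (f p) = ((Φ p).1, (Φ p).2 - ε (Φ p).1)) : NullReachable α univ f := by
  have hεs : ContMDiff J 𝓘(ℝ, ℝ) ∞ ε := hε.contMDiff
  let K := CompactExhaustion.choice Q
  choose a ha ha0 ha1 S hS haS using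
    fun j => exists_exhausting_bumps (J := J) K j
  choose b R hb hb1 hbR hb2 hbl using fun j : ℕ => exists_slow_bump j
  set c : ℕ → Q → ℝ := fun j q => ε q * (4 * Real.pi * a j q) with hc
  have hcs : ∀ j, ContMDiff J 𝓘(ℝ, ℝ) ∞ (c j) := fun j =>
    hεs.mul (contMDiff_const.mul (ha j))
  have hsin0 : ∀ j q, a j q = 0 → Real.sin (c j q / 8) = 0 := by
    intro j q h
    simp [hc, h]
  have hsin1 : ∀ j q, a j q = 1 → Real.sin (c j q / 8) = ε q := by
    intro j q h
    simp only [hc, h]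
    rcases hε1 q with h | h <;> rw [h]
    · rw [show (1 * (4 * Real.pi * 1) / 8 : ℝ) = Real.pi / 2 by ring, Real.sin_pi_div_two]
    · rw [show (-1 * (4 * Real.pi * 1) / 8 : ℝ) = -(Real.pi / 2) by ring, Real.sin_neg,
        Real.sin_pi_div_two]
  set W : ℕ → ℝ → (ℝ × ℝ) × ℝ → ℝ := fun j s v =>
    (1 - s) * (Real.sin (v.1.2 / 8) * b (j + 1) v.2) + s * (Real.sin (v.1.1 / 8) * b j v.2) with hW
  have hWs : ∀ j, ContDiff ℝ ∞ (fun q : ℝ × (ℝ × ℝ) × ℝ => W j q.1 q.2) := by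
    intro j
    simp only [hW]
    have h1 := hb j
    have h2 := hb (j + 1)
    fun_prop
  have hWl : ∀ j, ∀ s ∈ Icc (0 : ℝ) 1, ∀ v w, |W j s v - W j s w| ≤ 1 / 4 * ‖v - w‖ := by
    intro j s hs v w
    have h1 := abs_sin_mul_sub_le (hb2 (j + 1)) (hbl (j + 1)) v.1.2 w.1.2 v.2 w.2
    have h2 := abs_sin_mul_sub_le (hb2 j) (hbl j) v.1.1 w.1.1 v.2 w.2
    have h3 : |v.1.2 - w.1.2| ≤ ‖v - w‖ := (norm_snd_le (v - w).1).trans (norm_fst_le (v - w))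
    have h4 : |v.1.1 - w.1.1| ≤ ‖v - w‖ := (norm_fst_le (v - w).1).trans (norm_fst_le (v - w))
    have h5 : |v.2 - w.2| ≤ ‖v - w‖ := norm_snd_le (v - w)
    have h6 : W j s v - W j s w = (1 - s) * (Real.sin (v.1.2 / 8) * b (j + 1) v.2 -
        Real.sin (w.1.2 / 8) * b (j + 1) w.2) +
        s * (Real.sin (v.1.1 / 8) * b j v.2 - Real.sin (w.1.1 / 8) * b j w.2) := by
      simp only [hW]; ring
    rw [h6]
    refine (abs_add_le _ _).trans ?_
    rw [abs_mul, abs_mul, abs_of_nonneg hs.1, abs_of_nonneg (sub_nonneg.2 hs.2)]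
    nlinarith [hs.1, hs.2]
  have hWd : ∀ j s, ContDiff ℝ ∞ (W j s) := fun j s =>
    (hWs j).comp (contDiff_const.prodMk contDiff_id)
  have hgex : ∀ j, ∀ s ∈ Icc (0 : ℝ) 1, ∃ g : (Q × ℝ) ≃ₘ⟮J.prod 𝓘(ℝ, ℝ), J.prod 𝓘(ℝ, ℝ)⟯ (Q × ℝ),
      ∀ x, g x = (x.1, x.2 + W j s ((c j x.1, c (j + 1) x.1), x.2) + -ε x.1) := fun j s hs =>
    exists_diffeomorph_shear ((hcs j).prodMk_space (hcs (j + 1))) hεs.neg (hWd j s)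
      (by norm_num) (hWl j s hs)
  have hrex : ∀ j, ∃ g : (Q × ℝ) ≃ₘ⟮J.prod 𝓘(ℝ, ℝ), J.prod 𝓘(ℝ, ℝ)⟯ (Q × ℝ),
      ∀ x, g x = (x.1, x.2 + Real.sin (c j x.1 / 8) * b j x.2 + -ε x.1) := by
    intro j
    obtain ⟨g, hg⟩ := hgex j 1 ⟨zero_le_one, le_rfl⟩
    exact ⟨g, fun x => by rw [hg]; simp [hW]⟩
  choose r hr using hrex
  have hGfix : ∀ j s, ∀ x ∈ interior (K (j + 1)) ×ˢ Ioo (-(j : ℝ)) j,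
      W j s ((c j x.1, c (j + 1) x.1), x.2) = ε x.1 := by
    rintro j s ⟨q, z⟩ ⟨hq, hz⟩
    simp only at hq hz
    have hj0 : (0 : ℝ) < j := by linarith [hz.1, hz.2]
    have hj : j ≠ 0 := by rintro rfl; simp at hj0
    have hz' : |z| ≤ j := abs_le.2 ⟨hz.1.le, hz.2.le⟩
    have hq' : q ∈ K (j + 1) := interior_subset hq
    simp only [hW]
    rw [hb1 j z hz', hb1 (j + 1) z (hz'.trans (by push_cast; linarith)),
      hsin1 j q (ha1 j hj q hq'),
      hsin1 (j + 1) q (ha1 (j + 1) (Nat.succ_ne_zero j) q (K.subset_succ (j + 1) hq'))]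
    ring
  have hGeq : ∀ j s, ∀ x ∉ (S j ∪ S (j + 1)) ×ˢ Icc (-max (R j) (R (j + 1))) (max (R j) (R (j + 1))),
      W j s ((c j x.1, c (j + 1) x.1), x.2) = 0 := by
    rintro j s ⟨q, z⟩ hx
    simp only [hW]
    by_cases hq : q ∈ S j ∪ S (j + 1)
    · have hz : ¬ |z| ≤ max (R j) (R (j + 1)) := fun h => hx ⟨hq, abs_le.1 h⟩
      rw [not_le, max_lt_iff] at hz
      rw [hbR j z hz.1, hbR (j + 1) z hz.2]
      ring
    · rw [mem_union, not_or] at hq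
      rw [hsin0 j q (haS j q hq.1), hsin0 (j + 1) q (haS (j + 1) q hq.2)]
      ring
  have hr1 : ∀ (j : ℕ) (x : Q × ℝ), W j 0 ((c j x.1, c (j + 1) x.1), x.2) =
      Real.sin (c (j + 1) x.1 / 8) * b (j + 1) x.2 := by
    intro j x; simp [hW]
  have hr0 : ∀ (j : ℕ) (x : Q × ℝ), W j 1 ((c j x.1, c (j + 1) x.1), x.2) =
      Real.sin (c j x.1 / 8) * b j x.2 := by
    intro j x; simp [hW]
  have hf' : f = Φ.conjBy (r 0) := by
    ext p
    rw [Diffeomorph.conjBy_apply, ← Φ.symm_apply_apply (f p), hf, hr, hsin0 0 _ (ha0 0 rfl _)]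
    simp [sub_eq_add_neg]
  rw [hf']
  refine nullReachable_of_telescope (r := fun j => Φ.conjBy (r j))
    (U := fun j => Φ ⁻¹' (interior (K j) ×ˢ Ioo (1 / 2 - (j : ℝ)) (j - 1 / 2))) ?_ ?_ ?_ ?_ ?_
  · exact fun j => (isOpen_interior.prod isOpen_Ioo).preimage Φ.continuous
  · refine monotone_nat_of_le_succ fun j => preimage_mono (prod_mono ?_ ?_)
    · exact interior_mono (K.subset_succ j)
    · refine Ioo_subset_Ioo ?_ ?_ <;> push_cast <;> linarith
  · intro p
    obtain ⟨m, hm⟩ := exists_nat_gt (|(Φ p).2| + 1 / 2)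
    obtain ⟨k, hk⟩ := K.exists_mem (Φ p).1
    refine ⟨max m (k + 1), interior_mono (K.subset (le_max_right m (k + 1)))
      (K.subset_interior_succ k hk), ?_⟩
    have h1 : (m : ℝ) ≤ (max m (k + 1) : ℕ) := by exact_mod_cast le_max_left m (k + 1)
    have h2 := abs_lt.1 (show |(Φ p).2| < (max m (k + 1) : ℕ) - 1 / 2 by linarith)
    exact ⟨by linarith [h2.1], h2.2⟩
  · rintro j p ⟨hq, hz⟩
    have hx : Φ p ∈ interior (K (j + 1)) ×ˢ Ioo (-(j : ℝ)) j :=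
      ⟨interior_mono (K.subset_succ j) hq, by linarith [hz.1], by linarith [hz.2]⟩
    rw [Diffeomorph.conjBy_apply, hr, ← hr0, hGfix j 1 _ hx, add_neg_cancel_right, Prod.mk.eta,
      Φ.symm_apply_apply]
  · intro j
    set g : ℝ → Q × ℝ → Q × ℝ := fun s x =>
      (x.1, x.2 + W j s ((c j x.1, c (j + 1) x.1), x.2) + -ε x.1) with hg
    set P : ℝ → T → T := fun s p => Φ.symm (g s ((r (j + 1)).symm (Φ p))) with hP
    have hg0 : ∀ x, g 0 x = r (j + 1) x := fun x => by rw [hr, hg]; simp only [hr1]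
    have hg1 : ∀ x, g 1 x = r j x := fun x => by rw [hr, hg]; simp only [hr0]
    have hgs : ContMDiff (𝓘(ℝ, ℝ).prod (J.prod 𝓘(ℝ, ℝ))) (J.prod 𝓘(ℝ, ℝ)) ∞
        (fun q : ℝ × (Q × ℝ) => g q.1 q.2) := by
      have h1 : ContMDiff (𝓘(ℝ, ℝ).prod (J.prod 𝓘(ℝ, ℝ))) J ∞ (fun q : ℝ × (Q × ℝ) => q.2.1) :=
        contMDiff_fst.comp contMDiff_snd
      have h2 : ContMDiff (𝓘(ℝ, ℝ).prod (J.prod 𝓘(ℝ, ℝ))) 𝓘(ℝ, ℝ) ∞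
          (fun q : ℝ × (Q × ℝ) => q.2.2) := contMDiff_snd.comp contMDiff_snd
      have h3 : ContMDiff (𝓘(ℝ, ℝ).prod (J.prod 𝓘(ℝ, ℝ))) 𝓘(ℝ, ℝ × (ℝ × ℝ) × ℝ) ∞
          (fun q : ℝ × (Q × ℝ) => (q.1, ((c j q.2.1, c (j + 1) q.2.1), q.2.2))) :=
        contMDiff_fst.prodMk_space
          ((((hcs j).comp h1).prodMk_space ((hcs (j + 1)).comp h1)).prodMk_space h2)
      exact h1.prodMk ((h2.add ((hWs j).contMDiff.comp h3)).add (hεs.comp h1).neg)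
    refine exists_nullReachable_disjoint hn hα (F := P) ⟨?_, ?_⟩ ?_ ?_
      (D := Φ.symm '' (r (j + 1) '' ((S j ∪ S (j + 1)) ×ˢ
        Icc (-max (R j) (R (j + 1))) (max (R j) (R (j + 1))))))
      (C := Φ ⁻¹' (K j ×ˢ Icc (1 / 2 - (j : ℝ)) (j - 1 / 2)))
      (V := Φ ⁻¹' (interior (K (j + 1)) ×ˢ Ioo (-(j : ℝ)) j)) ?_ ?_ ?_ ?_ ?_ ?_ ?_
    · exact (Φ.symm.contMDiff.comp (hgs.comp (contMDiff_fst.prodMk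
        (((r (j + 1)).symm.contMDiff.comp Φ.contMDiff).comp contMDiff_snd)))).contMDiffOn
    · intro t ht
      obtain ⟨e, he⟩ := hgex j t ht
      refine ⟨Φ.conjBy ((r (j + 1)).symm.trans e), funext fun p => ?_⟩
      simp [hP, hg, he]
    · funext p
      simp only [hP, hg0, Diffeomorph.apply_symm_apply, Diffeomorph.symm_apply_apply, id]
    · funext p
      simp only [hP, hg1]
      simp [Diffeomorph.conjBy]
      rfl
    · exact ((((hS j).union (hS (j + 1))).prod isCompact_Icc).image (r (j + 1)).continuous).image
        Φ.symm.continuous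
    · exact ((K.isCompact j).isClosed.prod isClosed_Icc).preimage Φ.continuous
    · exact (isOpen_interior.prod isOpen_Ioo).preimage Φ.continuous
    · exact preimage_mono (prod_mono interior_subset Ioo_subset_Icc_self)
    · refine preimage_mono (prod_mono (K.subset_interior_succ j) fun z hz => ?_)
      exact ⟨by linarith [hz.1], by linarith [hz.2]⟩
    · intro t _ p hp
      have h1 : ∀ s, g s (Φ p) = Φ p := fun s => by
        simp only [hg]
        rw [hGfix j s _ hp, add_neg_cancel_right]
      have h2 : (r (j + 1)).symm (Φ p) = Φ p := by
        have h3 : r (j + 1) (Φ p) = Φ p := by rw [← hg0, h1]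
        conv_lhs => rw [← h3, Diffeomorph.symm_apply_apply]
      simp only [hP]
      rw [h2, h1, Φ.symm_apply_apply]
    · intro t _ p hp
      set y := (r (j + 1)).symm (Φ p) with hy
      have hy' : r (j + 1) y = Φ p := (r (j + 1)).apply_symm_apply _
      have h1 : y ∉ (S j ∪ S (j + 1)) ×ˢ
          Icc (-max (R j) (R (j + 1))) (max (R j) (R (j + 1))) := fun h =>
        hp ⟨Φ p, ⟨y, h, hy'⟩, Φ.symm_apply_apply p⟩
      have h2 : g t y = g 0 y := by
        simp only [hg]
        rw [hGeq j t y h1, hGeq j 0 y h1]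
      change Φ.symm (g t y) = p
      rw [h2, hg0, hy', Φ.symm_apply_apply]

end Translation

section JetContact

variable {n d : ℕ} {T : Type*} [TopologicalSpace T] [ChartedSpace (Euc d) T]
  [IsManifold (𝓡 d) ∞ T] [T2Space T] [SigmaCompactSpace T] {α : CovectorField (𝓡 d) T}
  {X : Type*} [TopologicalSpace X] [ChartedSpace (Euc n) X] [IsManifold (𝓡 n) ∞ X]

/-- A contact manifold which is covered by Darboux charts and contactomorphic to a 1-jet bundle
carries a positive path of diffeomorphisms, whose inverse is the endpoint of a null path. -/
lemma exists_isPositivePath_of_contactomorphic (hn : 1 ≤ n)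
    (hD : ∀ x : T, ∃ ψ : OpenPartialHomeomorph T (StdSpace n), IsDarbouxChart n α ψ ∧
      x ∈ ψ.source) (hα : α.IsSmooth) (hX : Contactomorphic α (jetForm n X)) :
    ∃ φ : ℝ → T ≃ₘ⟮𝓡 d, 𝓡 d⟯ T, IsPositivePath α φ ∧ NullReachable α univ (φ 1).symm := by
  obtain ⟨Φ, hΦ⟩ := hX
  rw [jetForm_eq] at hΦ
  obtain ⟨ε, hε, hε1, hΦε⟩ := exists_sign_isPositivePullback hα hΦ
  obtain ⟨φ, hφ, hφe⟩ := exists_isPositivePath_contactization (θ := liouville n X) hε hε1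
  have e1 : Topology.IsClosedEmbedding (fun q : Cotangent (𝓡 n) X => (q, (0 : ℝ))) :=
    ⟨isEmbedding_prodMkLeft 0, by
      have : range (fun q : Cotangent (𝓡 n) X => (q, (0 : ℝ))) = Prod.snd ⁻¹' {0} := by
        ext ⟨q, z⟩
        simp [eq_comm]
      rw [this]
      exact isClosed_singleton.preimage continuous_snd⟩
  have e2 := Φ.symm.toHomeomorph.isClosedEmbedding.comp e1
  have : T2Space (Cotangent (𝓡 n) X) := T2Space.of_injective_continuous e2.injective e2.continuous
  have : SigmaCompactSpace (Cotangent (𝓡 n) X) := e2.sigmaCompactSpace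
  have : LocallyCompactSpace T := ChartedSpace.locallyCompactSpace (Euc d) T
  have : LocallyCompactSpace (Cotangent (𝓡 n) X) := e2.locallyCompactSpace
  refine ⟨fun t => Φ.conjBy (φ t), hφ.conjBy hΦε, nullReachable_translation hn hD Φ hε hε1 fun p => ?_⟩
  have h1 : φ 1 ((Φ p).1, (Φ p).2 - ε (Φ p).1) = Φ p := by
    rw [hφe]
    simp
  have h2 : Φ.conjBy (φ 1) (Φ.symm ((Φ p).1, (Φ p).2 - ε (Φ p).1)) = p := by
    rw [Diffeomorph.conjBy_apply, Φ.apply_symm_apply, h1, Φ.symm_apply_apply]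
  conv_lhs => rw [← h2, Diffeomorph.symm_apply_apply, Φ.apply_symm_apply]

/-- In a contact manifold as in `exists_isPositivePath_of_contactomorphic`, a diffeomorphism which
is the endpoint of a null path moves a submanifold through a positive isotopy and through a null
isotopy. -/
lemma exists_isotopies_of_nullReachable {k : ℕ} {N : Type*} [TopologicalSpace N]
    [ChartedSpace (Euc k) N] (hn : 1 ≤ n)
    (hD : ∀ x : T, ∃ ψ : OpenPartialHomeomorph T (StdSpace n), IsDarbouxChart n α ψ ∧
      x ∈ ψ.source) (hα : α.IsSmooth) (hX : Contactomorphic α (jetForm n X)) {K : Set T}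
    {g : T ≃ₘ⟮𝓡 d, 𝓡 d⟯ T} (hg : NullReachable α K g) {j : N → T} (hj : IsProperEmbedding k d j) :
    (∃ κ : ℝ → N → T, IsIsotopy k d κ j (range (g ∘ j)) ∧ IsPositiveIsotopy α κ) ∧
    (∃ κ : ℝ → N → T, IsIsotopy k d κ j (range (g ∘ j)) ∧ IsNullIsotopy α κ ∧
      (IsCompact K → IsCompactlySupported κ)) := by
  obtain ⟨φ, hφ, h1⟩ := exists_isPositivePath_of_contactomorphic hn hD hα hX
  exact ⟨hφ.exists_isotopy_of_nullReachable ((hg.mono (subset_univ K)).trans h1) hj,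
    hg.exists_isNullIsotopy hj⟩

end JetContact

section JetEuclidean

variable (n : ℕ)

lemma inCoordinates_cotangent_euc (x₀ x : Euc n) (ϕ : TangentSpace (𝓡 n) x →L[ℝ] ℝ) :
    ContinuousLinearMap.inCoordinates (Euc n) (TangentSpace (𝓡 n)) ℝ (Trivial (Euc n) ℝ)
      x₀ x x₀ x ϕ = ϕ := by
  rw [ContinuousLinearMap.inCoordinates, TangentBundle.symmL_model_space]
  ext v
  simp
  rfl

lemma contMDiff_cotangent_snd :
    ContMDiff (M' := Euc n →L[ℝ] ℝ) ((𝓡 n).prod 𝓘(ℝ, Euc n →L[ℝ] ℝ)) 𝓘(ℝ, Euc n →L[ℝ] ℝ) ∞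
      (fun c : Cotangent (𝓡 n) (Euc n) => c.2) := by
  intro c
  have h1 : ContMDiffAt ((𝓡 n).prod 𝓘(ℝ, Euc n →L[ℝ] ℝ)) ((𝓡 n).prod 𝓘(ℝ, Euc n →L[ℝ] ℝ)) ∞
    (fun c : Cotangent (𝓡 n) (Euc n) => c) c := contMDiffAt_id
  have h2 := ((contMDiffAt_hom_bundle (E₁ := TangentSpace (𝓡 n)) (E₂ := Trivial (Euc n) ℝ) _).1 h1).2
  refine h2.congr_of_eventuallyEq (Filter.Eventually.of_forall fun c' => ?_)
  exact (inCoordinates_cotangent_euc n _ _ _).symm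

lemma contMDiff_cotangent_mk :
    ContMDiff 𝓘(ℝ, Euc n × (Euc n →L[ℝ] ℝ)) ((𝓡 n).prod 𝓘(ℝ, Euc n →L[ℝ] ℝ)) ∞
      (fun q : Euc n × (Euc n →L[ℝ] ℝ) => (⟨q.1, q.2⟩ : Cotangent (𝓡 n) (Euc n))) := by
  intro q
  refine (contMDiffAt_hom_bundle (E₁ := TangentSpace (𝓡 n)) (E₂ := Trivial (Euc n) ℝ) _).2
    ⟨contDiff_fst.contMDiff q, ?_⟩
  refine (contDiff_snd.contMDiff q).congr_of_eventuallyEq (Filter.Eventually.of_forall fun c' => ?_)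
  exact inCoordinates_cotangent_euc n _ _ _

/-- The identification of covectors and vectors of Euclidean space. -/
def eucDual : Euc n ≃L[ℝ] (Euc n →L[ℝ] ℝ) :=
  (InnerProductSpace.toDual ℝ (Euc n)).toContinuousLinearEquiv

lemma eucDual_apply (x y : Euc n) : eucDual n x y = inner ℝ x y := rfl

/-- The identification of `J¹ℝⁿ` with `ℝ²ⁿ⁺¹`, up to the sign `σ`. -/
lemma exists_jetStdDiffeomorph {σ : ℝ} (hσ : σ * σ = 1) :
    ∃ Θ : JetBundle n (Euc n) ≃ₘ⟮jetModel n, 𝓘(ℝ, StdSpace n)⟯ StdSpace n,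
      ∀ a, Θ a = (-(σ • (eucDual n).symm a.1.2), a.1.proj, σ * a.2) := by
  refine ⟨{
    toFun a := (-(σ • (eucDual n).symm a.1.2), a.1.proj, σ * a.2)
    invFun v := (⟨v.2.1, -(σ • eucDual n v.1)⟩, σ * v.2.2)
    left_inv := by
      rintro ⟨⟨x, p⟩, z⟩
      have h1 : ∀ p : Euc n →L[ℝ] ℝ, -(σ • eucDual n (-(σ • (eucDual n).symm p))) = p := by
        intro p
        rw [map_neg, map_smul, (eucDual n).apply_symm_apply, smul_neg, neg_neg, smul_smul, hσ,
          one_smul]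
      have h2 : σ * (σ * z) = z := by rw [← mul_assoc, hσ, one_mul]
      simp only [h2]
      exact congrArg (fun p' : Euc n →L[ℝ] ℝ => ((⟨x, p'⟩, z) : JetBundle n (Euc n))) (h1 p)
    right_inv := by
      rintro ⟨x, y, z⟩
      have h1 : -(σ • (eucDual n).symm (-(σ • eucDual n x))) = x := by
        rw [map_neg, map_smul, (eucDual n).symm_apply_apply, smul_neg, neg_neg, smul_smul, hσ,
          one_smul]
      have h2 : σ * (σ * z) = z := by rw [← mul_assoc, hσ, one_mul]
      exact Prod.ext h1 (Prod.ext rfl h2)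
    contMDiff_toFun := by
      have h1 : ContMDiff (jetModel n) 𝓘(ℝ, Euc n) ∞ (fun a : JetBundle n (Euc n) =>
          -(σ • (eucDual n).symm a.1.2)) :=
        ((eucDual n).symm.contDiff.const_smul σ).neg.contMDiff.comp
          ((contMDiff_cotangent_snd n).comp contMDiff_fst)
      have h2 : ContMDiff (jetModel n) 𝓘(ℝ, Euc n) ∞ (fun a : JetBundle n (Euc n) => a.1.proj) :=
        (contMDiff_proj (fun p : Euc n => TangentSpace (𝓡 n) p →L[ℝ] ℝ)).comp contMDiff_fst
      exact h1.prodMk_space (h2.prodMk_space (contMDiff_const.mul contMDiff_snd))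
    contMDiff_invFun := by
      have h1 : ContDiff ℝ ∞ (fun v : StdSpace n => (v.2.1, -(σ • eucDual n v.1))) :=
        (contDiff_fst.comp contDiff_snd).prodMk
          (((eucDual n).contDiff.comp contDiff_fst).const_smul σ).neg
      have h2 : ContDiff ℝ ∞ (fun v : StdSpace n => σ * v.2.2) :=
        contDiff_const.mul (contDiff_snd.comp contDiff_snd)
      exact ((contMDiff_cotangent_mk n).comp h1.contMDiff).prodMk h2.contMDiff
  }, fun a => rfl⟩

lemma stdCovector_mfderiv_jetStdDiffeomorph {σ : ℝ} (hσ : σ * σ = 1)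
    {Θ : JetBundle n (Euc n) ≃ₘ⟮jetModel n, 𝓘(ℝ, StdSpace n)⟯ StdSpace n}
    (hΘ : ∀ a, Θ a = (-(σ • (eucDual n).symm a.1.2), a.1.proj, σ * a.2)) (a : JetBundle n (Euc n))
    (v : TangentSpace (jetModel n) a) :
    stdCovector n (Θ a) (mfderiv (jetModel n) 𝓘(ℝ, StdSpace n) Θ a v) =
      σ * jetForm n (Euc n) a v := by
  have hd : MDifferentiableAt (jetModel n) 𝓘(ℝ, StdSpace n) Θ a :=
    Θ.contMDiff.mdifferentiable (by simp) a
  set w : StdSpace n := mfderiv (jetModel n) 𝓘(ℝ, StdSpace n) Θ a v with hw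
  have hproj : ∀ {V : Type} [NormedAddCommGroup V] [NormedSpace ℝ V] (L : StdSpace n →L[ℝ] V)
      (f : JetBundle n (Euc n) → V) (_ : ∀ b, f b = L (Θ b)),
      (mfderiv (jetModel n) 𝓘(ℝ, V) f a : ((Euc n × (Euc n →L[ℝ] ℝ)) × ℝ) →L[ℝ] V) v = L w := by
    intro V _ _ L f hf
    obtain rfl : f = fun b => L (Θ b) := funext hf
    have h1 : MDifferentiableAt 𝓘(ℝ, StdSpace n) 𝓘(ℝ, V) L (Θ a) :=
      L.differentiableAt.mdifferentiableAt
    have h2 := mfderiv_comp a h1 hd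
    have h3 : mfderiv 𝓘(ℝ, StdSpace n) 𝓘(ℝ, V) L (Θ a) = L := by
      rw [mfderiv_eq_fderiv, L.fderiv]
    refine (congrArg (fun M : ((Euc n × (Euc n →L[ℝ] ℝ)) × ℝ) →L[ℝ] V => M v) h2).trans ?_
    exact congrArg (fun M : StdSpace n →L[ℝ] V => M w) h3
  have hy := hproj ((ContinuousLinearMap.fst ℝ (Euc n) ℝ).comp
    (ContinuousLinearMap.snd ℝ (Euc n) (Euc n × ℝ))) (fun b => b.1.proj)
    (fun b => by rw [hΘ]; rfl)
  have hz := hproj (σ • (ContinuousLinearMap.snd ℝ (Euc n) ℝ).comp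
    (ContinuousLinearMap.snd ℝ (Euc n) (Euc n × ℝ))) (fun b => b.2) (fun b => by
      rw [hΘ]
      change b.2 = σ * (σ * b.2)
      rw [← mul_assoc, hσ, one_mul])
  have h1 : (Θ a).1 = -(σ • (eucDual n).symm a.1.2) := by rw [hΘ]
  have key : ∀ (p : Euc n →L[ℝ] ℝ) (y : Euc n),
      inner ℝ (-(σ • (eucDual n).symm p)) y = -(σ * p y) := by
    intro p y
    rw [inner_neg_left, inner_smul_left, ← eucDual_apply, (eucDual n).apply_symm_apply]
    rfl
  have h2 : inner ℝ (Θ a).1 w.2.1 = -(σ * (a.1.2 : Euc n →L[ℝ] ℝ) w.2.1) := by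
    rw [h1]
    exact key _ _
  rw [stdCovector_apply', h2]
  have h3 : (jetForm n (Euc n) a : ((Euc n × (Euc n →L[ℝ] ℝ)) × ℝ) →L[ℝ] ℝ) v =
    σ * w.2.2 - (a.1.2 : Euc n →L[ℝ] ℝ) w.2.1 := congrArg₂ (fun (x : ℝ) (y : Euc n) =>
      x - (a.1.2 : Euc n →L[ℝ] ℝ) y) hz hy
  refine Eq.trans ?_ (congrArg (fun x => σ * x) h3).symm
  rw [mul_sub, ← mul_assoc, hσ, one_mul]
  rfl

set_option maxHeartbeats 1000000 in
/-- A contact manifold which is contactomorphic to `J¹ℝⁿ` is diffeomorphic to `ℝ²ⁿ⁺¹`, by a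
diffeomorphism which preserves the cooriented contact structures. -/
lemma exists_isPositivePullback_stdCovector {n : ℕ} {E : Type*} [NormedAddCommGroup E]
    [NormedSpace ℝ E] {H : Type*} [TopologicalSpace H] {I : ModelWithCorners ℝ E H} {M : Type*}
    [TopologicalSpace M] [ChartedSpace H M] [IsManifold I ∞ M] {α : CovectorField I M}
    (hα : α.IsSmooth) (h : Contactomorphic α (jetForm n (Euc n))) :
    ∃ Θ : M ≃ₘ⟮I, 𝓘(ℝ, StdSpace n)⟯ StdSpace n, IsPositivePullback α (stdCovector n) Θ := by
  obtain ⟨Φ, hΦ⟩ := h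
  have hΦ' := hΦ
  rw [jetForm_eq] at hΦ'
  obtain ⟨ε, hε, hε1, hΦε⟩ := exists_sign_isPositivePullback hα hΦ'
  have : PreconnectedSpace (Cotangent (𝓡 n) (Euc n)) := by
    refine ⟨?_⟩
    have h1 := isPreconnected_range (contMDiff_cotangent_mk n).continuous
    convert h1 using 1
    exact (range_eq_univ.2 fun c => ⟨(c.1, c.2), rfl⟩).symm
  have hσ : ε ⟨0, 0⟩ * ε ⟨0, 0⟩ = 1 := by rcases hε1 ⟨0, 0⟩ with h | h <;> rw [h] <;> norm_num
  obtain ⟨Θ, hΘ⟩ := exists_jetStdDiffeomorph n hσ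
  refine ⟨Φ.trans Θ, fun p => ?_⟩
  obtain ⟨c, hc, hcv⟩ := hΦε p
  refine ⟨c, hc, fun v => ?_⟩
  have h1 := mfderiv_comp p (Θ.contMDiff.mdifferentiable (by simp) (Φ p))
    (Φ.contMDiff.mdifferentiable (by simp) p)
  have h2 : ε (Φ p).1 = ε ⟨0, 0⟩ := hε.apply_eq_of_preconnectedSpace _ _
  have h3 : ∀ w : (Euc n × (Euc n →L[ℝ] ℝ)) × ℝ,
      (contactization (liouville n (Euc n)) ε (Φ p) :
        (Euc n × (Euc n →L[ℝ] ℝ)) × ℝ →L[ℝ] ℝ) w =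
      ε ⟨0, 0⟩ * (jetForm n (Euc n) (Φ p) : (Euc n × (Euc n →L[ℝ] ℝ)) × ℝ →L[ℝ] ℝ) w := by
    intro w
    rw [jetForm_eq, contactization_apply, contactization_apply, h2, Pi.one_apply, one_mul]
  have key : ∀ (S : StdSpace n →L[ℝ] ℝ) (D : E →L[ℝ] StdSpace n)
      (D₁ : (Euc n × (Euc n →L[ℝ] ℝ)) × ℝ →L[ℝ] StdSpace n)
      (D₂ : E →L[ℝ] (Euc n × (Euc n →L[ℝ] ℝ)) × ℝ)
      (A B : (Euc n × (Euc n →L[ℝ] ℝ)) × ℝ →L[ℝ] ℝ) (u : E) (x : ℝ), D = D₁.comp D₂ →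
      (∀ w, S (D₁ w) = ε ⟨0, 0⟩ * B w) → (∀ w, A w = ε ⟨0, 0⟩ * B w) → x = c * A (D₂ u) →
      x = c * S (D u) := by
    rintro S _ D₁ D₂ A B u x rfl hS hA rfl
    rw [hA]
    exact congrArg (fun x => c * x) (hS (D₂ u)).symm
  exact key (stdCovector n (Θ (Φ p))) _ (mfderiv (jetModel n) 𝓘(ℝ, StdSpace n) Θ (Φ p))
    (mfderiv I (jetModel n) Φ p) (contactization (liouville n (Euc n)) ε (Φ p))
    (jetForm n (Euc n) (Φ p)) v _ h1
    (stdCovector_mfderiv_jetStdDiffeomorph n hσ hΘ (Φ p)) h3 (hcv v)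

end JetEuclidean

section Dilations

variable {n d : ℕ} {T : Type*} [TopologicalSpace T] [ChartedSpace (Euc d) T]
  [IsManifold (𝓡 d) ∞ T] [T2Space T] [SigmaCompactSpace T] {α : CovectorField (𝓡 d) T}
  {V : Type*} [NormedAddCommGroup V] [NormedSpace ℝ V] [FiniteDimensional ℝ V]

lemma exists_nullReachable_dilate (hn : 1 ≤ n)
    (hα : ∀ x : T, ∃ ψ : OpenPartialHomeomorph T (StdSpace n), IsDarbouxChart n α ψ ∧
      x ∈ ψ.source) (Θ : T ≃ₘ⟮𝓡 d, 𝓘(ℝ, V)⟯ V) {r : T ≃ₘ⟮𝓡 d, 𝓡 d⟯ T} {R : ℝ} (hR : 0 < R)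
    (hr : ∀ p, ‖Θ p‖ ≤ R → r p = p) :
    ∃ r' : T ≃ₘ⟮𝓡 d, 𝓡 d⟯ T, (∀ p, ‖Θ p‖ ≤ 2 * R → r' p = p) ∧
      ∃ K, Disjoint K (Θ ⁻¹' Metric.ball 0 (R / 2)) ∧ NullReachable α K (r'.symm.trans r) := by
  set F : ℝ → T → T := fun s p =>
    Θ.symm (Real.exp s • Θ (r (Θ.symm (Real.exp (-s) • Θ (r.symm p))))) with hF
  have hF1 : ∀ s p, ‖Real.exp (-s) • Θ (r.symm p)‖ ≤ R → F s p = r.symm p := by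
    intro s p h
    simp only [hF]
    rw [hr _ (by rwa [Θ.apply_symm_apply]), Θ.apply_symm_apply, smul_smul, ← Real.exp_add,
      add_neg_cancel, Real.exp_zero, one_smul, Θ.symm_apply_apply]
  have hrs : ∀ p, ‖Θ p‖ ≤ R → r.symm p = p := fun p hp => by
    conv_lhs => rw [← hr p hp, r.symm_apply_apply]
  have hFd : IsDiffeoPath d F := by
    constructor
    · have hexp : ContMDiff (𝓘(ℝ, ℝ).prod (𝓡 d)) 𝓘(ℝ, ℝ) ∞ (fun q : ℝ × T => Real.exp q.1) :=
        Real.contDiff_exp.contMDiff.comp contMDiff_fst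
      have hexp' : ContMDiff (𝓘(ℝ, ℝ).prod (𝓡 d)) 𝓘(ℝ, ℝ) ∞ (fun q : ℝ × T => Real.exp (-q.1)) :=
        (Real.contDiff_exp.comp contDiff_neg).contMDiff.comp contMDiff_fst
      have h1 : ContMDiff (𝓘(ℝ, ℝ).prod (𝓡 d)) 𝓘(ℝ, V) ∞
          (fun q : ℝ × T => Real.exp (-q.1) • Θ (r.symm q.2)) :=
        hexp'.smul (Θ.contMDiff.comp (r.symm.contMDiff.comp contMDiff_snd))
      have h2 : ContMDiff (𝓘(ℝ, ℝ).prod (𝓡 d)) 𝓘(ℝ, V) ∞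
          (fun q : ℝ × T => Real.exp q.1 • Θ (r (Θ.symm (Real.exp (-q.1) • Θ (r.symm q.2))))) :=
        hexp.smul (Θ.contMDiff.comp (r.contMDiff.comp (Θ.symm.contMDiff.comp h1)))
      exact (Θ.symm.contMDiff.comp h2).contMDiffOn
    · intro t _
      let δ : ∀ s : ℝ, V ≃ₘ⟮𝓘(ℝ, V), 𝓘(ℝ, V)⟯ V := fun s =>
        (ContinuousLinearEquiv.smulLeft (Units.mk0 (Real.exp s) (Real.exp_ne_zero s)) :
          V ≃L[ℝ] V).toDiffeomorph
      exact ⟨r.symm.trans (Θ.trans ((δ (-t)).trans (Θ.symm.trans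
        (r.trans (Θ.trans ((δ t).trans Θ.symm)))))), rfl⟩
  have hF0 : F 0 = id := by
    funext p
    simp [hF]
  have hexp1 : ∀ t : ℝ, 0 ≤ t → ∀ v : V, ‖Real.exp (-t) • v‖ ≤ ‖v‖ := by
    intro t ht v
    rw [norm_smul, Real.norm_of_nonneg (Real.exp_pos _).le]
    exact mul_le_of_le_one_left (norm_nonneg _) (Real.exp_le_one_iff.2 (by linarith))
  obtain ⟨g, K, hK, hg, hgF⟩ := exists_nullReachable_disjoint_eq hn hα hFd hF0
    (D := r '' (Θ.symm '' Metric.closedBall 0 (2 * R))) (U := Θ ⁻¹' Metric.ball 0 (R / 2))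
    (C := Θ ⁻¹' Metric.closedBall 0 (R / 2)) (V := Θ ⁻¹' Metric.ball 0 R)
    (((isCompact_closedBall _ _).image Θ.symm.continuous).image r.continuous)
    (Metric.isClosed_closedBall.preimage Θ.continuous) (Metric.isOpen_ball.preimage Θ.continuous)
    (preimage_mono Metric.ball_subset_closedBall)
    (preimage_mono (Metric.closedBall_subset_ball (by linarith))) (by
      intro t ht p hp
      rw [mem_preimage, mem_ball_zero_iff] at hp
      rw [hF1, hrs p hp.le]
      rw [hrs p hp.le]
      exact (hexp1 t ht.1 _).trans hp.le)
  refine ⟨r.trans g, fun p hp => ?_, K, hK, ?_⟩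
  · rw [Diffeomorph.coe_trans, Function.comp_apply,
      hgF _ (Or.inl ⟨p, ⟨Θ p, by simpa using hp, Θ.symm_apply_apply p⟩, rfl⟩), hF1,
      r.symm_apply_apply]
    rw [r.symm_apply_apply, norm_smul, Real.norm_of_nonneg (Real.exp_pos _).le, Real.exp_neg,
      inv_mul_le_iff₀ (Real.exp_pos _)]
    have := Real.add_one_le_exp 1
    nlinarith
  · have h : (r.trans g).symm.trans r = g.symm := by
      ext p
      change r (r.symm (g.symm p)) = g.symm p
      rw [r.apply_symm_apply]
    rw [h]
    exact hg.symm

/-- On a contact manifold diffeomorphic to a vector space, a diffeomorphism which is isotopic to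
the identity is the endpoint of a null path. -/
theorem InDiffZero.nullReachable (hn : 1 ≤ n)
    (hα : ∀ x : T, ∃ ψ : OpenPartialHomeomorph T (StdSpace n), IsDarbouxChart n α ψ ∧
      x ∈ ψ.source) (Θ : T ≃ₘ⟮𝓡 d, 𝓘(ℝ, V)⟯ V) {f : T ≃ₘ⟮𝓡 d, 𝓡 d⟯ T} (hf : InDiffZero f) :
    NullReachable α univ f := by
  obtain ⟨F, hF, hF0, hF1⟩ := hf
  obtain ⟨g, ⟨K, -, -, hg⟩, hgF⟩ := exists_nullReachable_of_diffeoPath hn hα hF hF0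
    ((isCompact_closedBall (0 : V) 1).image Θ.symm.continuous) isOpen_univ
    (fun _ _ _ _ => mem_univ _)
  have hstep : ∀ (j : ℕ) (r : T ≃ₘ⟮𝓡 d, 𝓡 d⟯ T), (∀ p, ‖Θ p‖ ≤ 2 ^ j → r p = p) →
      ∃ r' : T ≃ₘ⟮𝓡 d, 𝓡 d⟯ T, (∀ p, ‖Θ p‖ ≤ 2 ^ (j + 1) → r' p = p) ∧
      ∃ K, Disjoint K (Θ ⁻¹' Metric.ball 0 (2 ^ j / 2)) ∧
        NullReachable α K (r'.symm.trans r) := by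
    intro j r hr
    rw [pow_succ, mul_comm _ (2 : ℝ)]
    exact exists_nullReachable_dilate hn hα Θ (by positivity) hr
  choose! next hnext hK using hstep
  set r : ℕ → T ≃ₘ⟮𝓡 d, 𝓡 d⟯ T := fun j => Nat.rec (f.trans g.symm) next j with hrdef
  have hr : ∀ j p, ‖Θ p‖ ≤ 2 ^ j → r j p = p := by
    intro j
    induction j with
    | zero =>
      intro p hp
      have h1 : g p = f p := by
        rw [← hF1]
        exact hgF p (Or.inl ⟨Θ p, by simpa using hp, Θ.symm_apply_apply p⟩)
      change g.symm (f p) = p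
      rw [← h1, g.symm_apply_apply]
    | succ j ih => exact hnext j (r j) ih
  have h0 : NullReachable α univ (r 0) := by
    refine nullReachable_of_telescope (U := fun j : ℕ => Θ ⁻¹' Metric.ball 0 (2 ^ j / 2))
      (fun j => Metric.isOpen_ball.preimage Θ.continuous) ?_ ?_ ?_ fun j => hK j (r j) (hr j)
    · refine monotone_nat_of_le_succ fun j => preimage_mono (Metric.ball_subset_ball ?_)
      rw [pow_succ]
      have : (0 : ℝ) < 2 ^ j := by positivity
      linarith
    · intro p
      obtain ⟨m, hm⟩ := pow_unbounded_of_one_lt (2 * ‖Θ p‖) (one_lt_two)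
      refine ⟨m, ?_⟩
      rw [mem_preimage, mem_ball_zero_iff]
      linarith
    · intro j p hp
      rw [mem_preimage, mem_ball_zero_iff] at hp
      have : (0 : ℝ) < 2 ^ j := by positivity
      exact hr j p (by linarith)
  have h1 : f = (r 0).trans g := by
    ext p
    change f p = g (g.symm (f p))
    rw [g.apply_symm_apply]
  rw [h1]
  exact h0.trans (hg.mono (subset_univ _))

end Dilations

section ParametricDerivatives

variable {P V W : Type*} [NormedAddCommGroup P] [NormedSpace ℝ P] [NormedAddCommGroup V]
  [NormedSpace ℝ V] [NormedAddCommGroup W] [NormedSpace ℝ W]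

lemma contDiffOn_iteratedFDeriv_param {g : P × V → W} {Ω : Set (P × V)} (hΩ : IsOpen Ω)
    (hg : ContDiffOn ℝ ∞ g Ω) (k : ℕ) :
    ContDiffOn ℝ ∞ (fun q : P × V => iteratedFDeriv ℝ k (fun v => g (q.1, v)) q.2) Ω := by
  induction k with
  | zero =>
    simp only [iteratedFDeriv_zero_eq_comp]
    exact (continuousMultilinearCurryFin0 ℝ V W).symm.contDiff.comp_contDiffOn hg
  | succ k ih =>
    simp only [iteratedFDeriv_succ_eq_comp_left]
    intro q hq
    have h1 := ih.contDiffAt (hΩ.mem_nhds hq)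
    have h2 : ContDiffAt ℝ ∞ (Function.uncurry fun (q : P × V) (w : V) =>
        iteratedFDeriv ℝ k (fun v => g (q.1, v)) w) (q, q.2) :=
      ContDiffAt.comp (q, q.2) (g := fun q : P × V => iteratedFDeriv ℝ k (fun v => g (q.1, v)) q.2)
        (f := fun q : (P × V) × V => (q.1.1, q.2)) h1
        ((contDiff_fst.comp contDiff_fst).prodMk contDiff_snd).contDiffAt
    have h3 : ContDiffAt ℝ ∞ (fun q : P × V =>
        fderiv ℝ (iteratedFDeriv ℝ k fun v => g (q.1, v)) q.2) q :=
      ContDiffAt.fderiv (m := ∞) h2 contDiffAt_snd (by simp)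
    exact (h3.continuousLinearMap_comp
      ((continuousMultilinearCurryLeftEquiv ℝ (fun _ : Fin (k + 1) => V) W).symm :
        _ →L[ℝ] V [×(k + 1)]→L[ℝ] W)).contDiffWithinAt

lemma eventually_iteratedFDeriv_sub_lt {g : ℝ × V → W} {Ω : Set (ℝ × V)} (hΩ : IsOpen Ω)
    (hg : ContDiffOn ℝ ∞ g Ω) {C : Set V} (hC : IsCompact C) (hCΩ : ∀ v ∈ C, (0, v) ∈ Ω) (r : ℕ)
    {ε : ℝ} (hε : 0 < ε) :
    ∀ᶠ μ in 𝓝 (0 : ℝ), ∀ v ∈ C, (μ, v) ∈ Ω ∧ ∀ k ≤ r,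
      ‖iteratedFDeriv ℝ k (fun v => g (μ, v)) v - iteratedFDeriv ℝ k (fun v => g (0, v)) v‖ < ε := by
  refine hC.eventually_forall_of_forall_eventually fun v hv => ?_
  refine Filter.Eventually.and (hΩ.mem_nhds (hCΩ v hv)) ?_
  have h := (Filter.eventually_all_finite (Set.finite_Iic r) (l := 𝓝 ((0 : ℝ), v))
    (p := fun k z => ‖iteratedFDeriv ℝ k (fun v => g (z.1, v)) z.2 -
      iteratedFDeriv ℝ k (fun v => g (0, v)) z.2‖ < ε)).2 fun k _ => by
    have h1 : ContinuousAt (fun q : ℝ × V => iteratedFDeriv ℝ k (fun v => g (q.1, v)) q.2) (0, v) :=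
      (contDiffOn_iteratedFDeriv_param hΩ hg k).continuousOn.continuousAt (hΩ.mem_nhds (hCΩ v hv))
    have h2 : ContinuousAt (fun q : ℝ × V => iteratedFDeriv ℝ k (fun v => g (0, v)) q.2) (0, v) :=
      ContinuousAt.comp (x := ((0 : ℝ), v)) (f := fun q : ℝ × V => ((0 : ℝ), q.2))
        (g := fun q : ℝ × V => iteratedFDeriv ℝ k (fun v => g (q.1, v)) q.2) h1
        (continuous_const.prodMk continuous_snd).continuousAt
    have h3 := (h1.sub h2).norm
    have h4 := h3.tendsto.eventually_lt_const (u := ε) (by simpa using hε)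
    exact h4
  filter_upwards [h] with z hz k hk
  exact hz k hk

end ParametricDerivatives

section Closeness

variable {n d : ℕ} {N T : Type*} [TopologicalSpace N] [ChartedSpace (Euc n) N]
  [TopologicalSpace T] [ChartedSpace (Euc d) T]

/-- Isotopies which are, outside a closed set, given by a smooth family of ambient isotopies, with
a parameter `μ`, belong to a given neighbourhood of the constant isotopy for small `μ`. -/
lemma BasicNhd.eventually_memOutside {j : N → T} (hj : ContMDiff (𝓡 n) (𝓡 d) ∞ j)
    {G : (ℝ × ℝ) × T → T} (hG : ContMDiff (𝓘(ℝ, ℝ × ℝ).prod (𝓡 d)) (𝓡 d) ∞ G)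
    (hG0 : ∀ t x, G ((0, t), x) = x) {K : Set N} (hK : IsClosed K) (U : BasicNhd n d j) :
    ∀ᶠ μ in 𝓝 (0 : ℝ), ∀ κ : ℝ → N → T, (∀ t, ∀ p ∉ K, κ t p = G ((μ, t), j p)) →
      U.MemOutside K κ := by
  set g : ℝ × (ℝ × Euc n) → Euc d := fun q => U.ψ (G ((q.1, q.2.1), j (U.φ.symm q.2.2))) with hg
  set Ω₀ : Set (ℝ × (ℝ × Euc n)) := {q | q.2.2 ∈ U.φ.target} with hΩ₀
  have hΩ₀o : IsOpen Ω₀ := U.φ.open_target.preimage (continuous_snd.comp continuous_snd)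
  have hinner : ContMDiffOn 𝓘(ℝ, ℝ × (ℝ × Euc n)) (𝓡 d) ∞
      (fun q : ℝ × (ℝ × Euc n) => G ((q.1, q.2.1), j (U.φ.symm q.2.2))) Ω₀ := by
    have h1 : ContMDiffOn 𝓘(ℝ, ℝ × (ℝ × Euc n)) (𝓡 n) ∞
        (fun q : ℝ × (ℝ × Euc n) => U.φ.symm q.2.2) Ω₀ :=
      (contMDiffOn_symm_of_mem_maximalAtlas U.φ_mem).comp
        (contDiff_snd.comp contDiff_snd).contMDiff.contMDiffOn fun q hq => hq
    have h2 : ContMDiffOn 𝓘(ℝ, ℝ × (ℝ × Euc n)) 𝓘(ℝ, ℝ × ℝ) ∞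
        (fun q : ℝ × (ℝ × Euc n) => (q.1, q.2.1)) Ω₀ :=
      (contDiff_fst.prodMk (contDiff_fst.comp contDiff_snd)).contMDiff.contMDiffOn
    exact hG.comp_contMDiffOn (h2.prodMk (hj.comp_contMDiffOn h1))
  set Ω : Set (ℝ × (ℝ × Euc n)) := Ω₀ ∩
    (fun q : ℝ × (ℝ × Euc n) => G ((q.1, q.2.1), j (U.φ.symm q.2.2))) ⁻¹' U.ψ.source with hΩ
  have hΩo : IsOpen Ω := hinner.continuousOn.isOpen_inter_preimage hΩ₀o U.ψ.open_source
  have hgs : ContDiffOn ℝ ∞ g Ω := by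
    rw [← contMDiffOn_iff_contDiffOn]
    exact (contMDiffOn_of_mem_maximalAtlas U.ψ_mem).comp (hinner.mono inter_subset_left)
      fun q hq => hq.2
  have hC : IsCompact (Icc (0 : ℝ) 1 ×ˢ (U.φ '' U.C)) :=
    isCompact_Icc.prod (U.C_compact.image_of_continuousOn (U.φ.continuousOn.mono U.C_subset))
  have hCΩ : ∀ v ∈ Icc (0 : ℝ) 1 ×ˢ (U.φ '' U.C), (0, v) ∈ Ω := by
    rintro ⟨t, _⟩ ⟨-, p, hp, rfl⟩
    refine ⟨U.φ.map_source (U.C_subset hp), ?_⟩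
    simp only [mem_preimage, hG0, U.φ.left_inv (U.C_subset hp)]
    exact U.mapsTo hp
  filter_upwards [eventually_iteratedFDeriv_sub_lt hΩo hgs hC hCΩ U.r U.ε_pos] with μ hμ κ hκ p hp t ht
  obtain ⟨h1, h2⟩ := hμ (t, U.φ p) ⟨ht, p, hp.1, rfl⟩
  have hps := U.C_subset hp.1
  have h0 := hCΩ (t, U.φ p) ⟨ht, p, hp.1, rfl⟩
  have hS : UniqueDiffOn ℝ (Icc (0 : ℝ) 1 ×ˢ U.φ.target) :=
    (uniqueDiffOn_Icc zero_lt_one).prod U.φ.open_target.uniqueDiffOn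
  have hmem : (t, U.φ p) ∈ Icc (0 : ℝ) 1 ×ˢ U.φ.target := ⟨ht, U.φ.map_source hps⟩
  have hsm : ∀ μ', (μ', (t, U.φ p)) ∈ Ω → ∀ k : ℕ,
      iteratedFDerivWithin ℝ k (fun v => g (μ', v)) (Icc (0 : ℝ) 1 ×ˢ U.φ.target) (t, U.φ p) =
        iteratedFDeriv ℝ k (fun v => g (μ', v)) (t, U.φ p) := by
    intro μ' hμ' k
    refine iteratedFDerivWithin_eq_iteratedFDeriv hS ?_ hmem
    have h3 : ContDiffAt ℝ k g (μ', (t, U.φ p)) :=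
      (hgs.contDiffAt (hΩo.mem_nhds hμ')).of_le (by exact_mod_cast le_top)
    exact ContDiffAt.comp (t, U.φ p) (g := g) (f := fun v => (μ', v)) h3 (contDiff_const.prodMk contDiff_id).contDiffAt
  refine ⟨?_, fun k hk => ?_⟩
  · rw [hκ t p hp.2]
    have h3 := h1.2
    simp only [mem_preimage, U.φ.left_inv hps] at h3
    exact h3
  · have h3 : (fun q : ℝ × Euc n => U.ψ (j (U.φ.symm q.2))) = fun v => g (0, v) := by
      funext q
      simp only [hg, hG0]
    have h4 : (fun q : ℝ × Euc n => U.ψ (κ q.1 (U.φ.symm q.2))) =ᶠ[𝓝 (t, U.φ p)]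
        fun v => g (μ, v) := by
      have h5 : ContinuousAt (fun q : ℝ × Euc n => U.φ.symm q.2) (t, U.φ p) :=
        ContinuousAt.comp (f := Prod.snd) (U.φ.continuousAt_symm (U.φ.map_source hps))
          continuousAt_snd
      have h6 : Kᶜ ∈ 𝓝 (U.φ.symm (t, U.φ p).2) := by
        rw [U.φ.left_inv hps]
        exact hK.isOpen_compl.mem_nhds hp.2
      filter_upwards [h5 h6] with q hq
      simp only [hg]
      rw [hκ q.1 _ hq]
    rw [(h4.filter_mono nhdsWithin_le_nhds).iteratedFDerivWithin_eq h4.eq_of_nhds k, h3,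
      hsm μ h1 k, hsm 0 h0 k]
    exact h2 k hk

end Closeness

section StandardPaths

variable {n : ℕ}

lemma contDiff_add_smul_prodMk {W : Type*} [NormedAddCommGroup W] [NormedSpace ℝ W] (e : Euc n)
    {a b β c : W → ℝ} {v : W → StdSpace n} (ha : ContDiff ℝ ∞ a) (hb : ContDiff ℝ ∞ b)
    (hβ : ContDiff ℝ ∞ β) (hc : ContDiff ℝ ∞ c) (hv : ContDiff ℝ ∞ v) :
    ContDiff ℝ ∞ (fun w => (((v w).1 + a w • e, (v w).2.1 + b w • e,
      (v w).2.2 + β w * inner ℝ e (v w).1 + c w) : StdSpace n)) :=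
  (hv.fst.add (ha.smul contDiff_const)).prodMk ((hv.snd.fst.add (hb.smul contDiff_const)).prodMk
    ((hv.snd.snd.add (hβ.mul (contDiff_const.inner ℝ hv.fst))).add hc))

/-- The diffeomorphism `(x, y, z) ↦ (x + a e, y + b e, z + β ⟪e, x⟫ + c)` of `ℝ²ⁿ⁺¹`. -/
def affineShear (e : Euc n) (a b β c : ℝ) :
    StdSpace n ≃ₘ⟮𝓘(ℝ, StdSpace n), 𝓘(ℝ, StdSpace n)⟯ StdSpace n where
  toFun v := (v.1 + a • e, v.2.1 + b • e, v.2.2 + β * inner ℝ e v.1 + c)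
  invFun v := (v.1 - a • e, v.2.1 - b • e, v.2.2 - c - β * inner ℝ e (v.1 - a • e))
  left_inv v := by
    refine Prod.ext ?_ (Prod.ext ?_ ?_) <;> simp
  right_inv v := by
    refine Prod.ext ?_ (Prod.ext ?_ ?_) <;> simp
  contMDiff_toFun :=
    (contDiff_add_smul_prodMk e (a := fun _ => a) (b := fun _ => b) (β := fun _ => β)
      (c := fun _ => c) contDiff_const contDiff_const contDiff_const contDiff_const
      contDiff_id).contMDiff
  contMDiff_invFun := by
    have h1 : ContDiff ℝ ∞ (fun v : StdSpace n => v.1 - a • e) := contDiff_fst.sub contDiff_const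
    have h2 : ContDiff ℝ ∞ (fun v : StdSpace n => v.2.1 - b • e) :=
      contDiff_snd.fst.sub contDiff_const
    exact (h1.prodMk (h2.prodMk ((contDiff_snd.snd.sub contDiff_const).sub
      (contDiff_const.mul (contDiff_const.inner ℝ h1))))).contMDiff

lemma affineShear_apply (e : Euc n) (a b β c : ℝ) (v : StdSpace n) :
    affineShear e a b β c v = (v.1 + a • e, v.2.1 + b • e, v.2.2 + β * inner ℝ e v.1 + c) := rfl

lemma contDiff_affineShear {W : Type*} [NormedAddCommGroup W] [NormedSpace ℝ W] (e : Euc n)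
    {a b β c : W → ℝ} {v : W → StdSpace n} (ha : ContDiff ℝ ∞ a) (hb : ContDiff ℝ ∞ b)
    (hβ : ContDiff ℝ ∞ β) (hc : ContDiff ℝ ∞ c) (hv : ContDiff ℝ ∞ v) :
    ContDiff ℝ ∞ (fun w => affineShear e (a w) (b w) (β w) (c w) (v w)) :=
  contDiff_add_smul_prodMk e ha hb hβ hc hv

/-- The translations in the direction of `z` form a positive path. -/
lemma isPositivePath_affineShear (e : Euc n) :
    IsPositivePath (stdCovector n) (fun t => affineShear e 0 0 0 t) := by
  have h : ∀ t, (affineShear e 0 0 0 t : StdSpace n → StdSpace n) =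
      fun v => v + ((0, 0, t) : StdSpace n) := by
    intro t
    funext v
    rw [affineShear_apply]
    refine Prod.ext ?_ (Prod.ext ?_ ?_) <;> simp
  refine ⟨?_, ?_, ?_, ?_⟩
  · exact contMDiff_prod_of_contDiff
      (f := fun q : ℝ × StdSpace n => affineShear e 0 0 0 q.1 q.2)
      (contDiff_affineShear e contDiff_const contDiff_const contDiff_const contDiff_fst contDiff_snd)
  · refine Diffeomorph.ext fun v => ?_
    rw [h]
    exact add_zero v
  · intro t p v hv
    have h1 : HasFDerivAt (affineShear e 0 0 0 t) (ContinuousLinearMap.id ℝ (StdSpace n)) p := by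
      rw [h]
      exact (hasFDerivAt_id p).add_const _
    rw [mfderiv_eq_fderiv, h1.fderiv]
    have h2 : ∀ w : StdSpace n, (stdCovector n (affineShear e 0 0 0 t p) : StdSpace n →L[ℝ] ℝ) w =
        (stdCovector n p : StdSpace n →L[ℝ] ℝ) w := fun w => by
      change w.2.2 + inner ℝ (p.1 + (0 : ℝ) • e) w.2.1 = w.2.2 + inner ℝ p.1 w.2.1
      rw [zero_smul, add_zero]
    exact (h2 v).trans hv
  · intro t p
    have h1 : HasDerivAt (fun s => affineShear e 0 0 0 s p) ((0, 0, 1) : StdSpace n) t := by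
      simp only [h]
      exact ((hasDerivAt_const t (0 : Euc n)).prodMk
        ((hasDerivAt_const t (0 : Euc n)).prodMk (hasDerivAt_id t))).const_add p
    have h2 : stdCovector n (affineShear e 0 0 0 t p) ((0, 0, 1) : StdSpace n) = 1 := by
      rw [stdCovector_apply']
      simp
    rw [mfderiv_eq_fderiv]
    exact lt_of_lt_of_eq zero_lt_one
      (h2.symm.trans (congrArg (stdCovector n (affineShear e 0 0 0 t p)) h1.deriv.symm))

/-- The lift, to a null path, of a circle of radius `μ` in the `(x, y)`-space. -/
def circleLift (e : Euc n) (μ θ : ℝ) :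
    StdSpace n ≃ₘ⟮𝓘(ℝ, StdSpace n), 𝓘(ℝ, StdSpace n)⟯ StdSpace n :=
  affineShear e (μ * (Real.cos θ - 1)) (μ * Real.sin θ) (-(μ * Real.sin θ))
    (-(μ ^ 2 * (θ / 2 + Real.sin (2 * θ) / 4 - Real.sin θ)))

lemma contDiff_circleLift (e : Euc n) :
    ContDiff ℝ ∞ (fun q : (ℝ × ℝ) × StdSpace n => circleLift e q.1.1 q.1.2 q.2) := by
  refine contDiff_affineShear e ?_ ?_ ?_ ?_ contDiff_snd <;> fun_prop

lemma circleLift_zero_left (e : Euc n) (θ : ℝ) (v : StdSpace n) : circleLift e 0 θ v = v := by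
  rw [circleLift, affineShear_apply]
  refine Prod.ext ?_ (Prod.ext ?_ ?_) <;> simp

lemma circleLift_zero (e : Euc n) (μ : ℝ) :
    circleLift e μ 0 = Diffeomorph.refl 𝓘(ℝ, StdSpace n) (StdSpace n) ∞ := by
  refine Diffeomorph.ext fun v => ?_
  rw [circleLift, affineShear_apply]
  refine Prod.ext ?_ (Prod.ext ?_ ?_) <;> simp

/-- The translation by the area of the circle undoes the lift of the circle. -/
lemma affineShear_circleLift (e : Euc n) (μ : ℝ) (v : StdSpace n) :
    affineShear e 0 0 0 (Real.pi * μ ^ 2) (circleLift e μ (2 * Real.pi) v) = v := by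
  have h : Real.sin (2 * (2 * Real.pi)) = 0 := by
    have := Real.sin_nat_mul_pi 4
    rw [← this]
    congr 1
    push_cast
    ring
  rw [affineShear_apply, circleLift, affineShear_apply]
  refine Prod.ext ?_ (Prod.ext ?_ ?_)
  · simp
  · simp
  · simp [h]
    ring

lemma isNullPath_circleLift {e : Euc n} (he : ‖e‖ = 1) (μ : ℝ) :
    IsNullPath (stdCovector n) (circleLift e μ) where
  smooth := contMDiff_prod_of_contDiff (f := fun q : ℝ × StdSpace n => circleLift e μ q.1 q.2)
    ((contDiff_circleLift e).comp ((contDiff_const.prodMk contDiff_fst).prodMk contDiff_snd))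
  null t p := by
    have hs := Real.hasDerivAt_sin t
    have hc := Real.hasDerivAt_cos t
    have hs2 : HasDerivAt (fun s : ℝ => Real.sin (2 * s)) (Real.cos (2 * t) * 2) t := by
      simpa using ((hasDerivAt_id t).const_mul 2).sin
    have h1 : HasDerivAt (fun s => circleLift e μ s p)
        (((μ * -Real.sin t) • e, (μ * Real.cos t) • e, -(μ * Real.cos t) * inner ℝ e p.1 +
          -(μ ^ 2 * (1 / 2 + Real.cos (2 * t) * 2 / 4 - Real.cos t))) : StdSpace n) t := by
      simp only [circleLift, affineShear_apply]
      exact ((((hc.sub_const 1).const_mul μ).smul_const e).const_add p.1).prodMk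
        ((((hs.const_mul μ).smul_const e).const_add p.2.1).prodMk
          ((((hs.const_mul μ).neg.mul_const _).const_add p.2.2).add
            (((((hasDerivAt_id t).div_const 2).add (hs2.div_const 4)).sub hs).const_mul
              (μ ^ 2)).neg))
    rw [mfderiv_eq_fderiv]
    refine (congrArg (stdCovector n (circleLift e μ t p)) h1.deriv).trans ?_
    rw [stdCovector_apply', circleLift, affineShear_apply]
    simp only [inner_add_left, inner_smul_left, inner_smul_right, real_inner_self_eq_norm_sq, he,
      real_inner_comm e p.1, RCLike.conj_to_real, Real.cos_two_mul]
    ring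

end StandardPaths

section NearConstant

lemma ContDiff.contMDiff_conj {P V : Type*} [NormedAddCommGroup P] [NormedSpace ℝ P]
    [NormedAddCommGroup V] [NormedSpace ℝ V] {E : Type*} [NormedAddCommGroup E] [NormedSpace ℝ E]
    {H : Type*} [TopologicalSpace H] {I : ModelWithCorners ℝ E H} {M : Type*} [TopologicalSpace M]
    [ChartedSpace H M] {A : P × V → V} (hA : ContDiff ℝ ∞ A) (Θ : M ≃ₘ⟮I, 𝓘(ℝ, V)⟯ V) :
    ContMDiff (𝓘(ℝ, P).prod I) I ∞ (fun q : P × M => Θ.symm (A (q.1, Θ q.2))) :=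
  Θ.symm.contMDiff.comp ((contMDiff_prod_of_contDiff hA).comp
    (contMDiff_fst.prodMk (Θ.contMDiff.comp contMDiff_snd)))

variable {n k d : ℕ} {N T : Type*} [TopologicalSpace N] [ChartedSpace (Euc k) N]
  [TopologicalSpace T] [ChartedSpace (Euc d) T] [IsManifold (𝓡 d) ∞ T] [T2Space T]
  {α : CovectorField (𝓡 d) T}

/-- In a contact manifold which is contactomorphic to `ℝ²ⁿ⁺¹`, a diffeomorphism which is the
endpoint of a compactly supported null path moves a submanifold through a positive isotopy, which
is as close to the constant one as we like outside a compact set. -/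
lemma NullReachable.exists_isPositiveIsotopy_memOutside (hn : 1 ≤ n)
    {Θ : T ≃ₘ⟮𝓡 d, 𝓘(ℝ, StdSpace n)⟯ StdSpace n} (hΘ : IsPositivePullback α (stdCovector n) Θ)
    {K : Set T} (hK : IsCompact K) {g : T ≃ₘ⟮𝓡 d, 𝓡 d⟯ T} (hg : NullReachable α K g) {j : N → T}
    (hj : IsProperEmbedding k d j) {S : Set (BasicNhd k d j)} (hS : S.Finite) :
    ∃ κ : ℝ → N → T, IsIsotopy k d κ j (range (g ∘ j)) ∧ IsPositiveIsotopy α κ ∧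
      ∀ U ∈ S, U.MemOutside (j ⁻¹' K) κ := by
  obtain ⟨F, hF, hF0, hF1, hFK⟩ := hg.exists_path
  set e : Euc n := EuclideanSpace.single ⟨0, hn⟩ 1
  have he : ‖e‖ = 1 := by simp [e]
  set b : ℝ → ℝ := fun t => 2 * Real.pi * Real.smoothTransition (4 * t - 3) with hb
  have hbs : ContDiff ℝ ∞ b := contDiff_const.mul (Real.smoothTransition.contDiff.comp
    ((contDiff_const.mul contDiff_id).sub contDiff_const))
  have hb0 : ∀ t ≤ 3 / 4, b t = 0 := fun t ht => by
    simp only [hb]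
    rw [Real.smoothTransition.zero_of_nonpos (by linarith), mul_zero]
  have hb1 : b 1 = 2 * Real.pi := by
    simp only [hb]
    rw [Real.smoothTransition.one_of_one_le (by norm_num), mul_one]
  set G : (ℝ × ℝ) × T → T := fun q =>
    Θ.symm (affineShear e 0 0 0 (Real.pi * q.1.1 ^ 2 * q.1.2)
      (circleLift e q.1.1 (b q.1.2) (Θ q.2))) with hG
  have hGs : ContMDiff (𝓘(ℝ, ℝ × ℝ).prod (𝓡 d)) (𝓡 d) ∞ G := by
    have h1 : ContDiff ℝ ∞ (fun q : (ℝ × ℝ) × StdSpace n =>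
        affineShear e 0 0 0 (Real.pi * q.1.1 ^ 2 * q.1.2) (circleLift e q.1.1 (b q.1.2) q.2)) := by
      have h2 : ContDiff ℝ ∞ (fun q : (ℝ × ℝ) × StdSpace n => circleLift e q.1.1 (b q.1.2) q.2) :=
        (contDiff_circleLift e).comp (((contDiff_fst.comp contDiff_fst).prodMk
          (hbs.comp (contDiff_snd.comp contDiff_fst))).prodMk contDiff_snd)
      refine contDiff_affineShear e contDiff_const contDiff_const contDiff_const ?_ h2
      fun_prop
    exact h1.contMDiff_conj Θ
  have hG0 : ∀ t x, G ((0, t), x) = x := by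
    intro t x
    simp only [hG, circleLift_zero_left]
    have h1 : affineShear e 0 0 0 (Real.pi * 0 ^ 2 * t) (Θ x) = Θ x := by
      rw [affineShear_apply]
      refine Prod.ext ?_ (Prod.ext ?_ ?_) <;> simp
    rw [h1, Θ.symm_apply_apply]
  have hKc : IsClosed (j ⁻¹' K) := hK.isClosed.preimage hj.embedding.contMDiff.continuous
  have hev := (Filter.eventually_all_finite hS).2 fun U (_ : U ∈ S) =>
    U.eventually_memOutside hj.embedding.contMDiff hGs hG0 hKc
  obtain ⟨μ, hμ, hμ0⟩ := ((hev.filter_mono nhdsWithin_le_nhds).and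
    (self_mem_nhdsWithin : Ioi (0 : ℝ) ∈ 𝓝[>] 0)).exists
  have hc : 0 < Real.pi * μ ^ 2 := mul_pos Real.pi_pos (pow_pos hμ0 2)
  have hφ := ((isPositivePath_affineShear e).reparam hc).conjBy hΘ
  have hZ := ((isNullPath_circleLift he μ).reparam hbs).conjBy hΘ
  have hZF := hZ.comp hF fun t => by
    rcases lt_or_ge t (3 / 4) with ht | ht
    · refine Or.inl ?_
      filter_upwards [Iio_mem_nhds ht] with s hs
      rw [hb0 s (le_of_lt hs), circleLift_zero, Θ.conjBy_refl]
    · refine Or.inr ?_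
      filter_upwards [Ioi_mem_nhds (show (2 / 3 : ℝ) < t by linarith)] with s hs
      rw [hF1 s (le_of_lt hs), hF1 t (by linarith)]
  obtain ⟨h1, h2⟩ := hφ.exists_isPositiveIsotopy hZF (by
    rw [hb0 0 (by norm_num), circleLift_zero, Θ.conjBy_refl, hF0 0 (by norm_num)]
    rfl) hj
  refine ⟨_, ?_, h2, fun U hU => hμ U hU _ fun t p hp => ?_⟩
  · have h3 : (fun p => Θ.conjBy (affineShear e 0 0 0 (Real.pi * μ ^ 2 * 1))
        (((F 1).trans (Θ.conjBy (circleLift e μ (b 1)))) (j p))) = g ∘ j := by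
      funext p
      rw [hF1 1 (by norm_num), hb1, mul_one]
      change Θ.symm (affineShear e 0 0 0 (Real.pi * μ ^ 2)
        (Θ (Θ.symm (circleLift e μ (2 * Real.pi) (Θ (g (j p))))))) = g (j p)
      rw [Θ.apply_symm_apply, affineShear_circleLift, Θ.symm_apply_apply]
    rwa [h3] at h1
  · change Θ.symm (affineShear e 0 0 0 (Real.pi * μ ^ 2 * t)
      (Θ (Θ.symm (circleLift e μ (b t) (Θ (F t (j p))))))) = _
    rw [hFK t _ hp, Θ.apply_symm_apply]

end NearConstant

section GlobalChart

variable {n : ℕ} {E : Type*} [NormedAddCommGroup E] [NormedSpace ℝ E]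
  {H : Type*} [TopologicalSpace H] {I : ModelWithCorners ℝ E H}
  {M : Type*} [TopologicalSpace M] [ChartedSpace H M] {α : CovectorField I M}

lemma IsPositivePullback.exists_isDarbouxChart {Θ : M ≃ₘ⟮I, 𝓘(ℝ, StdSpace n)⟯ StdSpace n}
    (hΘ : IsPositivePullback α (stdCovector n) Θ) (x : M) :
    ∃ ψ : OpenPartialHomeomorph M (StdSpace n), IsDarbouxChart n α ψ ∧ x ∈ ψ.source := by
  refine ⟨Θ.toHomeomorph.toOpenPartialHomeomorph, ⟨Θ.contMDiff.contMDiffOn,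
    Θ.symm.contMDiff.contMDiffOn, fun p _ v => ?_⟩, mem_univ x⟩
  obtain ⟨c, hc, h⟩ := hΘ p
  have h1 : α p v = c * stdForm n (Θ p) (mfderiv I 𝓘(ℝ, StdSpace n) Θ p v) :=
    (h v).trans (congrArg (c * ·) (stdCovector_apply (Θ p) (mfderiv I 𝓘(ℝ, StdSpace n) Θ p v)))
  rw [h1]
  exact mul_eq_zero.trans (or_iff_right hc.ne')

end GlobalChart

end

theorem mainTheorem8 (n : ℕ) (hn : 1 ≤ n)
    -- the thermodynamic phase space, with its contact structure `ker α` cooriented by `α`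
    (T : Type u) [TopologicalSpace T] [T2Space T] [SecondCountableTopology T]
    [ChartedSpace (Euc (2 * n + 1)) T] [IsManifold (𝓡 (2 * n + 1)) ∞ T]
    (α : CovectorField (𝓡 (2 * n + 1)) T) (hα : α.IsSmooth)
    -- two Legendrians, and any parametrization `j : N → T` of the first one
    (L₁ L₂ : Set T) (hL₁ : IsLegendrian n α L₁) (hL₂ : IsLegendrian n α L₂)
    (N : Type v) [TopologicalSpace N] [ChartedSpace (Euc n) N] [IsManifold (𝓡 n) ∞ N]
    (j : N → T) (hj : IsProperEmbedding n (2 * n + 1) j) (hjL : range j = L₁) :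
    -- the general case: `T` is contactomorphic to `J¹X`
    (∀ (X : Type w) [TopologicalSpace X] [T2Space X] [SecondCountableTopology X]
        [ChartedSpace (Euc n) X] [IsManifold (𝓡 n) ∞ X],
      Contactomorphic α (jetForm n X) → HasFiniteDarbouxCover n α →
      (∃ ι : ℝ → N → T, IsIsotopy n (2 * n + 1) ι j L₂ ∧ IsCompactlySupported ι) →
        (∃ κ : ℝ → N → T, IsIsotopy n (2 * n + 1) κ j L₂ ∧ IsPositiveIsotopy α κ) ∧
        (∃ κ : ℝ → N → T, IsIsotopy n (2 * n + 1) κ j L₂ ∧ IsNullIsotopy α κ ∧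
          IsCompactlySupported κ)) ∧
    -- the case where `T` is contactomorphic to `J¹ℝⁿ`
    (Contactomorphic α (jetForm n (Euc n)) →
      ((∃ f : T ≃ₘ⟮𝓡 (2 * n + 1), 𝓡 (2 * n + 1)⟯ T, InDiffZero f ∧ f '' L₁ = L₂) →
        (∃ κ : ℝ → N → T, IsIsotopy n (2 * n + 1) κ j L₂ ∧ IsPositiveIsotopy α κ) ∧
        (∃ κ : ℝ → N → T, IsIsotopy n (2 * n + 1) κ j L₂ ∧ IsNullIsotopy α κ)) ∧
      ((∃ f : T ≃ₘ⟮𝓡 (2 * n + 1), 𝓡 (2 * n + 1)⟯ T, InDiffZeroCompact f ∧ f '' L₁ = L₂) ∨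
          (∃ ι : ℝ → N → T, IsIsotopy n (2 * n + 1) ι j L₂ ∧ IsCompactlySupported ι) →
        (∃ κ : ℝ → N → T, IsIsotopy n (2 * n + 1) κ j L₂ ∧ IsNullIsotopy α κ ∧
          IsCompactlySupported κ) ∧
        -- one compact set works for all neighbourhoods of the constant isotopy
        (∃ K : Set N, IsCompact K ∧ ∀ S : Set (BasicNhd n (2 * n + 1) j), S.Finite →
          ∃ κ : ℝ → N → T, IsIsotopy n (2 * n + 1) κ j L₂ ∧ IsPositiveIsotopy α κ ∧
            ∀ U ∈ S, U.MemOutside K κ))) := by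
  have : LocallyCompactSpace T := ChartedSpace.locallyCompactSpace (Euc (2 * n + 1)) T
  have hrange : ∀ f : T ≃ₘ⟮𝓡 (2 * n + 1), 𝓡 (2 * n + 1)⟯ T, f '' L₁ = L₂ → range (f ∘ j) = L₂ := by
    intro f hf
    rw [range_comp, hjL, hf]
  refine ⟨?_, fun hX => ?_⟩
  · rintro X _ _ _ _ _ hX ⟨S, -, hS, hcov⟩ ⟨ι, hι, hc⟩
    have hD : ∀ x : T, ∃ ψ : OpenPartialHomeomorph T (StdSpace n), IsDarbouxChart n α ψ ∧
        x ∈ ψ.source := fun x => by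
      obtain ⟨e, he, hx⟩ := hcov x
      exact ⟨e, hS e he, hx⟩
    obtain ⟨g, K, hK, hg, hgj⟩ := exists_nullReachable_of_isIsotopy hn hD hι hc
    obtain ⟨h1, κ, h2, h3, h4⟩ := exists_isotopies_of_nullReachable hn hD hα hX hg hj
    rw [hgj] at h1 h2
    exact ⟨h1, κ, h2, h3, h4 hK⟩
  · obtain ⟨Θ, hΘ⟩ := exists_isPositivePullback_stdCovector hα hX
    have hD := hΘ.exists_isDarbouxChart
    refine ⟨?_, fun h => ?_⟩
    · rintro ⟨f, hf, hfL⟩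
      obtain ⟨h1, κ, h2, h3, -⟩ := exists_isotopies_of_nullReachable hn hD hα hX
        (hf.nullReachable hn hD Θ) hj
      rw [hrange f hfL] at h1 h2
      exact ⟨h1, κ, h2, h3⟩
    · obtain ⟨g, K, hK, hg, hgj⟩ : ∃ (g : T ≃ₘ⟮𝓡 (2 * n + 1), 𝓡 (2 * n + 1)⟯ T) (K : Set T),
          IsCompact K ∧ NullReachable α K g ∧ range (g ∘ j) = L₂ := by
        rcases h with ⟨f, hf, hfL⟩ | ⟨ι, hι, hc⟩
        · obtain ⟨K, hK, hfK⟩ := hf.exists_nullReachable hn hD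
          exact ⟨f, K, hK, hfK, hrange f hfL⟩
        · exact exists_nullReachable_of_isIsotopy hn hD hι hc
      obtain ⟨κ, h2, h3, h4⟩ := hg.exists_isNullIsotopy hj
      rw [hgj] at h2
      refine ⟨⟨κ, h2, h3, h4 hK⟩, j ⁻¹' K, hj.isCompact_preimage hK, fun S hS => ?_⟩
      rw [← hgj]
      exact hg.exists_isPositiveIsotopy_memOutside hn hΘ hK hj hS
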